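/- **Conventions.** All rings are commutative. Fix integers $d,r\ge 0$ and finitely supported $h=(h^i)_{i\in\mathbb Z}$, $h^i\in\mathbb N$; put $m=\sum_i h^i$ and $j_k=\sum_{i\ge k}h^i$. * For a ring $A$ let $A^d_{r,A}=A[t_1,\dots,t_d]/(t_1,\dots,t_d)^{r+1}$ and $\mathbb D^d_{r,A}=\operatorname{Spec}A^d_{r,A}$. For a scheme $S$ over a ring $R$, $J^d_rS$ is the functor on $R$-algebras $A\mapsto \operatorname{Hom}_R(\operatorname{Spec}A\times_R\mathbb D^d_{r,R},S)$. * $\check L(A)$ is the set of finite decreasing filtrations $F^\bullet$ of $A^m$ such that $F^i/F^{i+1}$ is locally free of rank $h^i$ for all $i$; $\mathrm{GL}_m$ acts on $\check L$, and $q:\mathrm{GL}_m\to\check L$ sends $M$ to the filtration whose $k$-th step is spanned by the first $j_k$ columns of $M$. * A filtered bundle with flat connection (a triple) on $S/R$ is a vector bundle $\mathcal H$ of rank $m$ with a decreasing filtration $F^\bullet$ by subbundles such that $F^i/F^{i+1}$ is locally free of rank $h^i$, and a flat connection $\nabla:\mathcal H\to\Omega^1_{S/R}\otimes\mathcal H$.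 * A map of stacks $X\to \mathrm{GL}_{m,R}\backslash J^d_r\check L_R$ from a sheaf of sets $X$ is a $\mathrm{GL}_m$-torsor $\gamma:P\to X$ with a $\mathrm{GL}_m$-equivariant map $\alpha:P\to J^d_r\check L_R$; diagrams of stacks commute up to 2-isomorphism. * Let $U\subset S$ be an affine open subscheme with an étale map $\delta=(z_1,\dots,z_n):U\to\mathbb A^n_R$, let $I=(z_1,\dots,z_n)$, and let $\mathcal O^r_\delta=\mathcal O(U)/I^{r+1}$, $\mathcal H^r_\delta=\mathcal H(U)/I^{r+1}\mathcal H(U)$. An $r$-elimp (étale local infinitesimal period map of order $r$) for $\delta$ is $\psi=q\circ M:\operatorname{Spec}\mathcal O^r_\delta\to\check L$, where $M\in\mathrm{GL}_m(\mathcal O^r_\delta)$ is the change-of-basis matrix from a frame $v^1,\dots,v^m$ of $\mathcal H^r_\delta$ such that the image of $F^k$ is spanned by $v^1,\dots,v^{j_k}$ for all $k$, to a frame $b^1,\dots,b^m$ of $\mathcal H^r_\delta$ that is flat for the induced map $\nabla:\mathcal H^r_\delta\to(\Omega^1_{U/R}\otimes\mathcal H)/I^r$ (the $i$-th column of $M$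 holds the coordinates of $v^i$ in the basis $b$). It is defined at $s\in U(R)$ if $\delta(s)=0$. **Theorem.** To every integral domain $R$ over $\mathbb Z[1/r!]$, every quasi-projective $R$-scheme $S$ and every triple $(\mathcal H,F^\bullet,\nabla)$ on $S/R$ as above, one can associate a map of stacks over $R$ $$\eta^d_r: J^d_rS\to \mathrm{GL}_{m,R}\backslash J^d_r\check L_R,$$ for all $d$, $r$ and $h$, such that: 1. (i) If $R\to R'$ is a map of integral domains over $\mathbb Z[1/r!]$ and $\eta'^d_r$ is the map associated with the base change of the triple to $S'=S_{R'}$, then the square formed by $\eta'^d_r:J^d_rS'\to\mathrm{GL}_{m,R'}\backslash J^d_r\check L_{R'}$, $\eta^d_r$ and the natural maps $J^d_rS'\to J^d_rS$ and $\mathrm{GL}_{m,R'}\backslash J^d_r\check L_{R'}\to\mathrm{GL}_{m,R}\backslash J^d_r\check L_R$ commutes. 2. (ii) If $g:S'\to S$ is a map of quasi-projective $R$-schemes and $\eta'^d_r$ is the map associated with the pullback of the triple along $g$, then $\eta'^d_r\cong\eta^d_r\circ J^d_rg$. 3. (iii) If $v:\mathbb D^d_{r,R}\to\mathbb D^{d'}_{r',R}$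 is a map over $R$ with $r'\le r$, then $((-)\circ v)\circ\eta^{d'}_{r'}\cong\eta^d_r\circ((-)\circ v)$ as maps $J^{d'}_{r'}S\to \mathrm{GL}_{m,R}\backslash J^d_r\check L_R$. 4. (iv) If $\psi$ is an $r$-elimp associated with $\delta:U\to\mathbb A^n_R$, and $j\in(J^d_rU)(R)$ is a jet such that $\psi$ is defined at the base point of $j$, then $\psi\circ j=\eta^d_r(j)$ as points of $(\mathrm{GL}_m\backslash J^d_r\check L)(R)$, that is, there is a point $p\in P(R)$ above $j$ with $\alpha(p)=\psi\circ j$, where $(\gamma:P\to J^d_rS,\ \alpha)$ is the pair defining $\eta^d_r$. -/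

import Mathlib

open CategoryTheory AlgebraicGeometry TensorProduct

universe u

namespace PeriodJets

noncomputable section

/-! ### Filtrations of free modules -/

/-- The total rank `m = ∑ i, hⁱ`. -/
abbrev totalRank (h : ℤ →₀ ℕ) : ℕ := ∑ i ∈ h.support, h i

/-- `tailRank h k = ∑ i ≥ k, hⁱ`, the rank of the `k`-th step of a filtration whose graded
pieces have ranks `hⁱ`. -/
def tailRank (h : ℤ →₀ ℕ) (k : ℤ) : ℕ := ∑ i ∈ h.support with k ≤ i, h i

/-- `F` is a finite decreasing filtration of `Bᵐ` that is graded locally free, with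
`Fᵏ / Fᵏ⁺¹` of rank `hᵏ` for all `k`. -/
structure IsGLF {B : Type u} [CommRing B] (h : ℤ →₀ ℕ)
    (F : ℤ → Submodule B (Fin (totalRank h) → B)) : Prop where
  antitone : Antitone F
  exhaustive : ∃ a, F a = ⊤
  separated : ∃ b, F b = ⊥
  finite : ∀ k, Module.Finite B (F k ⧸ (F (k + 1)).submoduleOf (F k))
  projective : ∀ k, Module.Projective B (F k ⧸ (F (k + 1)).submoduleOf (F k))
  rank : ∀ k, Module.rankAtStalk (R := B) (F k ⧸ (F (k + 1)).submoduleOf (F k)) = fun _ => h k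

/-- The set of `B`-points of the flag scheme `Ľ`. -/
@[ext]
structure Flag (h : ℤ →₀ ℕ) (B : Type u) [CommRing B] where
  F : ℤ → Submodule B (Fin (totalRank h) → B)
  isGLF : IsGLF h F

section FlagLemmas

variable {h : ℤ →₀ ℕ} {B : Type u} [CommRing B]

/-- The image of a filtration under an automorphism of `Bᵐ`. -/
theorem IsGLF.map_equiv {F : ℤ → Submodule B (Fin (totalRank h) → B)} (hF : IsGLF h F)
    (e : (Fin (totalRank h) → B) ≃ₗ[B] (Fin (totalRank h) → B)) :
    IsGLF h (fun k => (F k).map (e : (Fin (totalRank h) → B) →ₗ[B] (Fin (totalRank h) → B))) := by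
  have key : ∀ k, Nonempty ((F k ⧸ (F (k + 1)).submoduleOf (F k)) ≃ₗ[B]
      (((F k).map (e : (Fin (totalRank h) → B) →ₗ[B] (Fin (totalRank h) → B))) ⧸
        ((F (k + 1)).map
          (e : (Fin (totalRank h) → B) →ₗ[B] (Fin (totalRank h) → B))).submoduleOf
          ((F k).map (e : (Fin (totalRank h) → B) →ₗ[B] (Fin (totalRank h) → B))))) := by
    intro k
    refine ⟨Submodule.Quotient.equiv _ _ (e.submoduleMap (F k)) ?_⟩
    ext x
    simp only [Submodule.mem_map, Submodule.submoduleOf, Submodule.mem_comap]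
    constructor
    · rintro ⟨y, hy, rfl⟩
      exact ⟨y, hy, rfl⟩
    · rintro ⟨y, hy, hyx⟩
      exact ⟨⟨y, hF.antitone (by omega) hy⟩, hy, Subtype.ext hyx⟩
  refine ⟨fun a b hab => Submodule.map_mono (hF.antitone hab), ?_, ?_, ?_, ?_, ?_⟩
  · obtain ⟨a, ha⟩ := hF.exhaustive
    exact ⟨a, by simp [ha]⟩
  · obtain ⟨a, ha⟩ := hF.separated
    exact ⟨a, by simp [ha]⟩
  · intro k
    have := hF.finite k
    exact Module.Finite.equiv (key k).some
  · intro k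
    have := hF.projective k
    exact Module.Projective.of_equiv (key k).some
  · intro k
    rw [← Module.rankAtStalk_eq_of_equiv (key k).some, hF.rank k]

theorem tailRank_anti (h : ℤ →₀ ℕ) : Antitone (tailRank h) := by
  intro a b hab
  refine Finset.sum_le_sum_of_subset ?_
  intro i hi
  simp only [Finset.mem_filter] at hi ⊢
  exact ⟨hi.1, hab.trans hi.2⟩

theorem tailRank_le (h : ℤ →₀ ℕ) (k : ℤ) : tailRank h k ≤ totalRank h :=
  Finset.sum_le_sum_of_subset (Finset.filter_subset _ _)

theorem tailRank_succ (h : ℤ →₀ ℕ) (k : ℤ) : tailRank h k = h k + tailRank h (k + 1) := by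
  classical
  unfold tailRank
  by_cases hk : k ∈ h.support
  · rw [← Finset.sum_insert (a := k) (f := h) (by simp)]
    congr 1
    ext i
    simp only [Finset.mem_filter, Finset.mem_insert]
    constructor
    · rintro ⟨h1, h2⟩
      rcases eq_or_lt_of_le h2 with h3 | h3
      · exact Or.inl h3.symm
      · exact Or.inr ⟨h1, h3⟩
    · rintro (rfl | ⟨h1, h2⟩)
      · exact ⟨hk, le_rfl⟩
      · exact ⟨h1, by omega⟩
  · have : h k = 0 := by simpa using hk
    rw [this, zero_add]
    congr 1
    ext i
    simp only [Finset.mem_filter]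
    refine and_congr_right fun hi => ⟨fun h1 => ?_, fun h1 => by omega⟩
    rcases eq_or_lt_of_le h1 with h3 | h3
    · exact absurd (h3 ▸ hi) hk
    · exact h3

theorem exists_tailRank_eq_total (h : ℤ →₀ ℕ) : ∃ a, tailRank h a = totalRank h := by
  obtain ⟨a, ha⟩ := h.support.finite_toSet.bddBelow
  refine ⟨a, ?_⟩
  unfold tailRank
  rw [Finset.filter_true_of_mem fun i hi => ha hi]

theorem exists_tailRank_eq_zero (h : ℤ →₀ ℕ) : ∃ a, tailRank h a = 0 := by
  obtain ⟨a, ha⟩ := h.support.finite_toSet.bddAbove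
  refine ⟨a + 1, ?_⟩
  unfold tailRank
  rw [Finset.filter_false_of_mem, Finset.sum_empty]
  intro i hi h1
  have := ha hi
  omega

/-- The filtration whose `k`-th step is spanned by the first `j_k` coordinate vectors. -/
theorem isGLF_std (h : ℤ →₀ ℕ) (B : Type u) [CommRing B] : IsGLF (B := B) h (fun k =>
    Submodule.span B ((fun i => Pi.single i (1 : B)) '' {i | (i : ℕ) < tailRank h k})) := by
  classical
  have mem : ∀ (t : ℕ) (x : Fin (totalRank h) → B),
      x ∈ Submodule.span B ((fun i => Pi.single i (1 : B)) '' {i : Fin (totalRank h) | (i : ℕ) < t})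
        ↔ ∀ i : Fin (totalRank h), t ≤ (i : ℕ) → x i = 0 := by
    intro t x
    constructor
    · intro hx i hi
      induction hx using Submodule.span_induction with
      | mem x hx =>
        obtain ⟨j, hj, rfl⟩ := hx
        have : i ≠ j := by
          rintro rfl
          exact absurd hj (by simpa using hi)
        simp [this]
      | zero => rfl
      | add x y _ _ hx hy => simp [hx, hy]
      | smul a x _ hx => simp [hx]
    · intro hx
      rw [pi_eq_sum_univ x]
      refine Submodule.sum_mem _ fun i _ => ?_
      by_cases hi : (i : ℕ) < t
      · refine Submodule.smul_mem _ _ (Submodule.subset_span ⟨i, hi, ?_⟩)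
        ext j
        simp [Pi.single_apply, eq_comm]
      · rw [hx i (by omega), zero_smul]
        exact Submodule.zero_mem _
  have key : ∀ k, Nonempty
      ((Submodule.span B ((fun i => Pi.single i (1 : B)) ''
          {i : Fin (totalRank h) | (i : ℕ) < tailRank h k}) ⧸
        (Submodule.span B ((fun i => Pi.single i (1 : B)) ''
          {i : Fin (totalRank h) | (i : ℕ) < tailRank h (k + 1)})).submoduleOf
        (Submodule.span B ((fun i => Pi.single i (1 : B)) ''
          {i : Fin (totalRank h) | (i : ℕ) < tailRank h k}))) ≃ₗ[B] (Fin (h k) → B)) := by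
    intro k
    have hs := tailRank_succ h k
    have hl := tailRank_le h k
    let ix : Fin (h k) → Fin (totalRank h) := fun j => ⟨tailRank h (k + 1) + j, by omega⟩
    let φ : Submodule.span B ((fun i => Pi.single i (1 : B)) ''
        {i : Fin (totalRank h) | (i : ℕ) < tailRank h k}) →ₗ[B] (Fin (h k) → B) :=
      (LinearMap.funLeft B B ix).comp (Submodule.subtype _)
    have hφ : Function.Surjective φ := by
      intro y
      refine ⟨⟨fun i => if hi : tailRank h (k + 1) ≤ (i : ℕ) ∧ (i : ℕ) < tailRank h k then
        y ⟨i - tailRank h (k + 1), by omega⟩ else 0, ?_⟩, ?_⟩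
      · rw [mem]
        intro i hi
        rw [dif_neg (by omega)]
      · ext j
        have : tailRank h (k + 1) ≤ tailRank h (k + 1) + (j : ℕ) ∧
          tailRank h (k + 1) + (j : ℕ) < tailRank h k := by omega
        simp [φ, LinearMap.funLeft_apply, ix, this]
    have hk : LinearMap.ker φ = (Submodule.span B ((fun i => Pi.single i (1 : B)) ''
          {i : Fin (totalRank h) | (i : ℕ) < tailRank h (k + 1)})).submoduleOf
        (Submodule.span B ((fun i => Pi.single i (1 : B)) ''
          {i : Fin (totalRank h) | (i : ℕ) < tailRank h k})) := by
      ext ⟨x, hx⟩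
      simp only [LinearMap.mem_ker, Submodule.submoduleOf, Submodule.mem_comap,
        Submodule.subtype_apply]
      rw [mem] at hx ⊢
      constructor
      · intro h0 i hi
        by_cases hi' : (i : ℕ) < tailRank h k
        · have := congrFun h0 ⟨i - tailRank h (k + 1), by omega⟩
          simp only [φ, ix, LinearMap.comp_apply, LinearMap.funLeft_apply, Submodule.subtype_apply,
            Pi.zero_apply] at this
          convert this using 2
          ext
          simp
          omega
        · exact hx i (by omega)
      · intro h0
        ext j
        exact h0 _ (by simp [ix])
    exact ⟨(Submodule.quotEquivOfEq _ _ hk.symm).trans (φ.quotKerEquivOfSurjective hφ)⟩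
  refine ⟨?_, ?_, ?_, ?_, ?_, ?_⟩
  · intro a b hab
    refine Submodule.span_mono (Set.image_mono fun i hi => ?_)
    exact lt_of_lt_of_le hi (tailRank_anti h hab)
  · obtain ⟨a, ha⟩ := exists_tailRank_eq_total h
    refine ⟨a, ?_⟩
    rw [eq_top_iff]
    intro x _
    rw [mem]
    intro i hi
    omega
  · obtain ⟨a, ha⟩ := exists_tailRank_eq_zero h
    refine ⟨a, ?_⟩
    rw [eq_bot_iff]
    intro x hx
    rw [mem] at hx
    simp only [Submodule.mem_bot]
    ext i
    exact hx i (by omega)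
  · intro k
    exact Module.Finite.equiv (key k).some.symm
  · intro k
    exact Module.Projective.of_equiv (key k).some.symm
  · intro k
    rw [Module.rankAtStalk_eq_of_equiv (key k).some]
    ext p
    have : Nontrivial B := ⟨⟨0, 1, fun h01 => p.2.ne_top (by
      rw [Ideal.eq_top_iff_one, ← h01]; exact Ideal.zero_mem _)⟩⟩
    rw [Module.rankAtStalk_eq_finrank_of_free]
    simp

/-- Each step of a graded locally free filtration is a direct summand. -/
theorem IsGLF.exists_proj {F : ℤ → Submodule B (Fin (totalRank h) → B)} (hF : IsGLF h F) (k : ℤ) :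
    ∃ e : (Fin (totalRank h) → B) →ₗ[B] (F k), ∀ x : F k, e x = x := by
  obtain ⟨a, ha⟩ := hF.exhaustive
  have base : ∀ k ≤ a, ∃ e : (Fin (totalRank h) → B) →ₗ[B] (F k), ∀ x : F k, e x = x := by
    intro k hk
    have : F k = ⊤ := top_le_iff.mp (ha ▸ hF.antitone hk)
    exact ⟨LinearMap.codRestrict _ LinearMap.id (by simp [this]), fun x => rfl⟩
  rcases le_total k a with hk | hk
  · exact base k hk
  induction k, hk using Int.leInduction with
  | base => exact base a le_rfl
  | succ k hk ih =>
    obtain ⟨e, he⟩ := ih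
    have := hF.projective k
    obtain ⟨s, hs⟩ := Module.projective_lifting_property
      ((F (k + 1)).submoduleOf (F k)).mkQ LinearMap.id (Submodule.mkQ_surjective _)
    let ρ : F k →ₗ[B] F k := LinearMap.id - s ∘ₗ ((F (k + 1)).submoduleOf (F k)).mkQ
    have hρ : ∀ x : F k, ((ρ x : F k) : Fin (totalRank h) → B) ∈ F (k + 1) := by
      intro x
      change ρ x ∈ (F (k + 1)).submoduleOf (F k)
      rw [← Submodule.ker_mkQ ((F (k + 1)).submoduleOf (F k)), LinearMap.mem_ker]
      have := LinearMap.congr_fun hs (((F (k + 1)).submoduleOf (F k)).mkQ x)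
      simp only [LinearMap.comp_apply, LinearMap.id_apply] at this
      simp only [ρ, LinearMap.sub_apply, LinearMap.id_apply, LinearMap.comp_apply, map_sub, this,
        sub_self]
    refine ⟨LinearMap.codRestrict _ ((F k).subtype ∘ₗ ρ ∘ₗ e) (fun x => hρ _), fun x => ?_⟩
    ext1
    have h1 : (x : Fin (totalRank h) → B) ∈ F k := hF.antitone (by omega) x.2
    have h2 : ((F (k + 1)).submoduleOf (F k)).mkQ ⟨x, h1⟩ = 0 := by
      rw [← LinearMap.mem_ker, Submodule.ker_mkQ]
      exact x.2
    have h3 := he ⟨x, h1⟩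
    simp only at h3
    change ((e x - s (((F (k + 1)).submoduleOf (F k)).mkQ (e x)) : F k) : Fin (totalRank h) → B) = x
    rw [h3, h2, map_zero, sub_zero]

/-- The base change of a filtration along a ring homomorphism: the `k`-th step is the span
of the image of the `k`-th step. -/
def baseChangeStep {n : ℕ} {C : Type u} [CommRing C] (f : B →+* C)
    (N : Submodule B (Fin n → B)) : Submodule C (Fin n → C) :=
  Submodule.span C ((fun x i => f (x i)) '' (N : Set (Fin n → B)))

theorem baseChangeStep_mono {n : ℕ} {C : Type u} [CommRing C] (f : B →+* C)
    {N N' : Submodule B (Fin n → B)} (hN : N ≤ N') : baseChangeStep f N ≤ baseChangeStep f N' :=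
  Submodule.span_mono (Set.image_mono hN)

theorem IsGLF.baseChange {C : Type u} [CommRing C] (f : B →+* C)
    {F : ℤ → Submodule B (Fin (totalRank h) → B)} (hF : IsGLF h F) :
    IsGLF h (fun k => baseChangeStep f (F k)) := by
  classical
  let _ := f.toAlgebra
  -- the base change of a linear map out of `Bⁿ`
  let lin : ∀ {Q : Type u} [AddCommGroup Q] [Module B Q],
      ((Fin (totalRank h) → B) →ₗ[B] Q) → ((Fin (totalRank h) → C) →ₗ[C] C ⊗[B] Q) :=
    fun {Q} _ _ φ => Fintype.linearCombination C (fun i => (1 : C) ⊗ₜ[B] φ (Pi.single i 1))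
  have lin_apply : ∀ {Q : Type u} [AddCommGroup Q] [Module B Q]
      (φ : (Fin (totalRank h) → B) →ₗ[B] Q) (x : Fin (totalRank h) → B),
      lin φ (fun i => f (x i)) = (1 : C) ⊗ₜ[B] φ x := by
    intro Q _ _ φ x
    simp only [lin, Fintype.linearCombination_apply]
    conv_rhs => rw [pi_eq_sum_univ' x]
    rw [map_sum, TensorProduct.tmul_sum]
    refine Finset.sum_congr rfl fun i _ => ?_
    rw [map_smul, TensorProduct.tmul_smul]
    rw [TensorProduct.smul_tmul', TensorProduct.smul_tmul']
    congr 1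
  -- evaluation back into `Cⁿ`
  let back : C ⊗[B] (Fin (totalRank h) → B) →ₗ[C] (Fin (totalRank h) → C) :=
    (TensorProduct.piScalarRight B C C (Fin (totalRank h))).toLinearMap
  have back_apply : ∀ (c : C) (x : Fin (totalRank h) → B),
      back (c ⊗ₜ x) = c • (fun i => f (x i)) := by
    intro c x
    ext i
    simp [back, Algebra.smul_def, RingHom.algebraMap_toAlgebra, mul_comm]
  have key : ∀ k, Nonempty ((baseChangeStep f (F k) ⧸
      (baseChangeStep f (F (k + 1))).submoduleOf (baseChangeStep f (F k))) ≃ₗ[C]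
      C ⊗[B] (F k ⧸ (F (k + 1)).submoduleOf (F k))) := by
    intro k
    obtain ⟨e, he⟩ := hF.exists_proj k
    have := hF.projective k
    obtain ⟨s, hs⟩ := Module.projective_lifting_property
      ((F (k + 1)).submoduleOf (F k)).mkQ LinearMap.id (Submodule.mkQ_surjective _)
    set mk := ((F (k + 1)).submoduleOf (F k)).mkQ with hmk
    let φ := (lin (mk ∘ₗ e)).comp (baseChangeStep f (F k)).subtype
    have hφ : Function.Surjective φ := by
      intro y
      induction y using TensorProduct.induction_on with
      | zero => exact ⟨0, map_zero _⟩
      | tmul c q =>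
        obtain ⟨x, rfl⟩ := Submodule.mkQ_surjective _ q
        refine ⟨c • ⟨fun i => f ((x : Fin (totalRank h) → B) i),
          Submodule.subset_span ⟨x, x.2, rfl⟩⟩, ?_⟩
        rw [map_smul]
        simp only [φ, LinearMap.comp_apply, Submodule.subtype_apply]
        rw [lin_apply, TensorProduct.smul_tmul']
        simp [he, hmk]
      | add y y' hy hy' =>
        obtain ⟨x, rfl⟩ := hy
        obtain ⟨x', rfl⟩ := hy'
        exact ⟨x + x', map_add _ _ _⟩
    have hback : ∀ x ∈ baseChangeStep f (F k),
        x - back (((F k).subtype ∘ₗ s).baseChange C (lin (mk ∘ₗ e) x)) ∈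
          baseChangeStep f (F (k + 1)) := by
      intro x hx
      induction hx using Submodule.span_induction with
      | mem x hx =>
        obtain ⟨x, hx, rfl⟩ := hx
        rw [lin_apply, LinearMap.baseChange_tmul, back_apply, one_smul]
        refine Submodule.subset_span ⟨x - s (mk (e x)), ?_, ?_⟩
        · have h1 := he ⟨x, hx⟩
          simp only at h1
          have : (⟨x, hx⟩ : F k) - s (mk ⟨x, hx⟩) ∈ (F (k + 1)).submoduleOf (F k) := by
            rw [← Submodule.Quotient.mk_eq_zero, ← Submodule.mkQ_apply, ← hmk, map_sub, sub_eq_zero]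
            exact (LinearMap.congr_fun hs (mk ⟨x, hx⟩)).symm
          rw [h1]
          exact this
        · ext i
          simp
      | zero => simp
      | add x y _ _ hx hy =>
        simp only [map_add]
        convert Submodule.add_mem _ hx hy using 1
        abel
      | smul a x _ hx =>
        simp only [map_smul]
        rw [← smul_sub]
        exact Submodule.smul_mem _ _ hx
    have hk : LinearMap.ker φ =
        (baseChangeStep f (F (k + 1))).submoduleOf (baseChangeStep f (F k)) := by
      apply le_antisymm
      · intro x hx
        have h0 : lin (mk ∘ₗ e) x = 0 := hx
        have := hback x x.2
        rw [h0, map_zero, map_zero, sub_zero] at this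
        exact this
      · have : baseChangeStep f (F (k + 1)) ≤ LinearMap.ker (lin (mk ∘ₗ e)) := by
          refine Submodule.span_le.mpr ?_
          rintro _ ⟨x, hx, rfl⟩
          simp only [SetLike.mem_coe, LinearMap.mem_ker]
          rw [lin_apply]
          have hx' : x ∈ F k := hF.antitone (by omega) hx
          have h1 := he ⟨x, hx'⟩
          simp only at h1
          have : mk ⟨x, hx'⟩ = 0 := by
            rw [← LinearMap.mem_ker, hmk, Submodule.ker_mkQ]
            exact hx
          rw [LinearMap.comp_apply, h1, this, TensorProduct.tmul_zero]
        intro x hx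
        exact this hx
    exact ⟨(Submodule.quotEquivOfEq _ _ hk.symm).trans (φ.quotKerEquivOfSurjective hφ)⟩
  refine ⟨fun a b hab => baseChangeStep_mono f (hF.antitone hab), ?_, ?_, ?_, ?_, ?_⟩
  · obtain ⟨a, ha⟩ := hF.exhaustive
    refine ⟨a, eq_top_iff.mpr fun x _ => ?_⟩
    rw [pi_eq_sum_univ' x]
    refine Submodule.sum_mem _ fun i _ => Submodule.smul_mem _ _ (Submodule.subset_span
      ⟨Pi.single i 1, by simp [ha], ?_⟩)
    ext j
    by_cases hij : j = i <;> simp [hij]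
  · obtain ⟨a, ha⟩ := hF.separated
    refine ⟨a, eq_bot_iff.mpr (Submodule.span_le.mpr ?_)⟩
    rintro _ ⟨x, hx, rfl⟩
    rw [ha] at hx
    simp only [SetLike.mem_coe, Submodule.mem_bot] at hx ⊢
    ext i
    simp [hx]
  · intro k
    have := hF.finite k
    exact Module.Finite.equiv (key k).some.symm
  · intro k
    have := hF.projective k
    exact Module.Projective.of_equiv (key k).some.symm
  · intro k
    have := hF.finite k
    have := hF.projective k
    rw [Module.rankAtStalk_eq_of_equiv (key k).some]
    ext p
    rw [Module.rankAtStalk_baseChange, hF.rank k]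

theorem baseChangeStep_id {n : ℕ} (N : Submodule B (Fin n → B)) :
    baseChangeStep (RingHom.id B) N = N := by
  simp [baseChangeStep]

theorem baseChangeStep_comp {n : ℕ} {C D : Type u} [CommRing C] [CommRing D] (f : B →+* C)
    (g : C →+* D) (N : Submodule B (Fin n → B)) :
    baseChangeStep (g.comp f) N = baseChangeStep g (baseChangeStep f N) := by
  apply le_antisymm
  · refine Submodule.span_le.mpr ?_
    rintro _ ⟨x, hx, rfl⟩
    exact Submodule.subset_span ⟨_, Submodule.subset_span ⟨x, hx, rfl⟩, rfl⟩
  · refine Submodule.span_le.mpr ?_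
    rintro _ ⟨x, hx, rfl⟩
    simp only [SetLike.mem_coe]
    induction hx using Submodule.span_induction with
    | mem x hx =>
      obtain ⟨x, hx, rfl⟩ := hx
      exact Submodule.subset_span ⟨x, hx, rfl⟩
    | zero =>
      convert Submodule.zero_mem _ using 1
      ext i
      simp
    | add x y _ _ hx hy =>
      convert Submodule.add_mem _ hx hy using 1
      ext i
      simp
    | smul a x _ hx =>
      convert Submodule.smul_mem _ (g a) hx using 1
      ext i
      simp

end FlagLemmas

/-- The map `Ľ(B) → Ľ(C)` induced by a ring homomorphism `B → C`. -/
def Flag.baseChange {h : ℤ →₀ ℕ} {B C : Type u} [CommRing B] [CommRing C] (f : B →+* C)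
    (x : Flag h B) : Flag h C where
  F k := baseChangeStep f (x.F k)
  isGLF := x.isGLF.baseChange f

theorem Flag.baseChange_id {h : ℤ →₀ ℕ} {B : Type u} [CommRing B] (x : Flag h B) :
    x.baseChange (RingHom.id B) = x :=
  Flag.ext (funext fun _ => baseChangeStep_id _)

theorem Flag.baseChange_comp {h : ℤ →₀ ℕ} {B C D : Type u} [CommRing B] [CommRing C] [CommRing D]
    (f : B →+* C) (g : C →+* D) (x : Flag h B) :
    x.baseChange (g.comp f) = (x.baseChange f).baseChange g :=
  Flag.ext (funext fun _ => baseChangeStep_comp _ _ _)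

/-- The action of `GL_m(B)` on filtrations of `Bᵐ`. -/
def Flag.act {h : ℤ →₀ ℕ} {B : Type u} [CommRing B] (g : GL (Fin (totalRank h)) B)
    (x : Flag h B) : Flag h B where
  F k := (x.F k).map (Matrix.mulVecLin (g : Matrix (Fin (totalRank h)) (Fin (totalRank h)) B))
  isGLF := x.isGLF.map_equiv
    (LinearMap.GeneralLinearGroup.generalLinearEquiv B _ (Matrix.GeneralLinearGroup.toLin g))

/-- The map `q : GL_m → Ľ`: the `k`-th step of `q M` is the span of the first `j_k` columns
of `M`. -/
def flagOfMatrix (h : ℤ →₀ ℕ) {B : Type u} [CommRing B] (M : GL (Fin (totalRank h)) B) :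
    Flag h B where
  F k := Submodule.span B ((fun i => (M : Matrix (Fin (totalRank h)) (Fin (totalRank h)) B).col i) '' {i | (i : ℕ) < tailRank h k})
  isGLF := by
    convert (isGLF_std h B).map_equiv
      (LinearMap.GeneralLinearGroup.generalLinearEquiv B _ (Matrix.GeneralLinearGroup.toLin M))
      using 2 with k
    rw [Submodule.map_span, Set.image_image]
    congr 1
    refine Set.image_congr fun i _ => ?_
    exact (Matrix.mulVec_single_one (M : Matrix (Fin (totalRank h)) (Fin (totalRank h)) B) i).symm

/-! ### Infinitesimal disks and jets -/

/-- The ring `A^d_{r, A} = A[t₁, …, t_d] / (t₁, …, t_d)^(r+1)`; its spectrum is the disk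
`𝔻^d_{r, A}`. -/
abbrev DiskRing (d r : ℕ) (A : Type u) [CommRing A] : Type u :=
  MvPolynomial (Fin d) A ⧸ (MvPolynomial.idealOfVars (Fin d) A) ^ (r + 1)

section Disk

variable (d r : ℕ) {A B : Type u} [CommRing A] [CommRing B]

/-- The inclusion of constants `A → A^d_{r, A}`. -/
abbrev diskConst (A : Type u) [CommRing A] : A →+* DiskRing d r A :=
  (Ideal.Quotient.mk _).comp MvPolynomial.C

/-- The coordinate functions `tᵢ`. -/
abbrev diskVar (A : Type u) [CommRing A] (i : Fin d) : DiskRing d r A :=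
  Ideal.Quotient.mk _ (MvPolynomial.X i)

theorem span_diskVar_pow (A : Type u) [CommRing A] :
    (Ideal.span (Set.range (diskVar d r A))) ^ (r + 1) = ⊥ := by
  have : Ideal.span (Set.range (diskVar d r A)) =
      (MvPolynomial.idealOfVars (Fin d) A).map
        (Ideal.Quotient.mk ((MvPolynomial.idealOfVars (Fin d) A) ^ (r + 1))) := by
    unfold MvPolynomial.idealOfVars
    rw [Ideal.map_span, ← Set.range_comp]
    rfl
  rw [this, ← Ideal.map_pow, Ideal.map_quotient_self]

variable {d r} in
/-- A ring homomorphism out of `A^d_{r, A}` given by the images of constants and coordinates. -/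
def diskLift (f : A →+* B) (x : Fin d → B) (hx : (Ideal.span (Set.range x)) ^ (r + 1) = ⊥) :
    DiskRing d r A →+* B :=
  Ideal.Quotient.lift _ (MvPolynomial.eval₂Hom f x) fun a ha => by
    have h1 : (MvPolynomial.idealOfVars (Fin d) A).map (MvPolynomial.eval₂Hom f x) =
        Ideal.span (Set.range x) := by
      unfold MvPolynomial.idealOfVars
      rw [Ideal.map_span, ← Set.range_comp]
      congr 2
      ext i
      simp
    have h2 := Ideal.mem_map_of_mem (MvPolynomial.eval₂Hom f x) ha
    rwa [Ideal.map_pow, h1, hx, Ideal.mem_bot] at h2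

variable {d r} in
theorem disk_hom_ext {f g : DiskRing d r A →+* B}
    (h1 : f.comp (diskConst d r A) = g.comp (diskConst d r A))
    (h2 : ∀ i, f (diskVar d r A i) = g (diskVar d r A i)) : f = g := by
  apply Ideal.Quotient.ringHom_ext
  apply MvPolynomial.ringHom_ext
  · intro a
    exact RingHom.congr_fun h1 a
  · exact h2

variable {d r} in
@[simp]
theorem diskLift_const (f : A →+* B) (x : Fin d → B)
    (hx : (Ideal.span (Set.range x)) ^ (r + 1) = ⊥) :
    (diskLift f x hx).comp (diskConst d r A) = f := by
  ext a
  simp [diskLift]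

variable {d r} in
@[simp]
theorem diskLift_var (f : A →+* B) (x : Fin d → B)
    (hx : (Ideal.span (Set.range x)) ^ (r + 1) = ⊥) (i : Fin d) :
    diskLift f x hx (diskVar d r A i) = x i := by
  simp [diskLift]

/-- The map `A^d_{r, A} → A^d_{r, B}` induced by `f : A → B`. -/
def diskMap (f : A →+* B) : DiskRing d r A →+* DiskRing d r B :=
  diskLift ((diskConst d r B).comp f) (diskVar d r B) (span_diskVar_pow d r B)

@[simp]
theorem diskMap_const (f : A →+* B) :
    (diskMap d r f).comp (diskConst d r A) = (diskConst d r B).comp f :=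
  diskLift_const _ _ _

@[simp]
theorem diskMap_var (f : A →+* B) (i : Fin d) :
    diskMap d r f (diskVar d r A i) = diskVar d r B i :=
  diskLift_var _ _ _ _

/-- Evaluation at the base point `t = 0` of the disk. -/
def diskEval (A : Type u) [CommRing A] : DiskRing d r A →+* A :=
  diskLift (RingHom.id A) (fun _ => 0) (by
    have : Ideal.span (Set.range fun _ : Fin d => (0 : A)) = ⊥ := by
      rw [Ideal.span_eq_bot]
      rintro _ ⟨_, rfl⟩
      rfl
    rw [this, Ideal.bot_pow (Nat.succ_ne_zero r)])

theorem mem_span_diskVar {x : DiskRing d r A} (hx : diskEval d r A x = 0) :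
    x ∈ Ideal.span (Set.range (diskVar d r A)) := by
  have key : ∀ y : DiskRing d r A, y - diskConst d r A (diskEval d r A y) ∈
      Ideal.span (Set.range (diskVar d r A)) := by
    intro y
    obtain ⟨p, rfl⟩ := Ideal.Quotient.mk_surjective y
    induction p using MvPolynomial.induction_on with
    | C a =>
      have := RingHom.congr_fun (diskLift_const (d := d) (r := r) (RingHom.id A) (fun _ => 0) (by
        have : Ideal.span (Set.range fun _ : Fin d => (0 : A)) = ⊥ := by
          rw [Ideal.span_eq_bot]
          rintro _ ⟨_, rfl⟩
          rfl
        rw [this, Ideal.bot_pow (Nat.succ_ne_zero r)])) a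
      have h2 : diskEval d r A (Ideal.Quotient.mk _ (MvPolynomial.C a)) = a := this
      rw [h2]
      simp
    | add p q hp hq =>
      simp only [map_add]
      convert Ideal.add_mem _ hp hq using 1
      ring
    | mul_X p i hp =>
      have h2 : diskEval d r A (Ideal.Quotient.mk _ (MvPolynomial.X i)) = 0 :=
        diskLift_var _ _ _ _
      rw [map_mul, map_mul, h2, mul_zero, map_zero, sub_zero]
      exact Ideal.mul_mem_left _ _ (Ideal.subset_span ⟨i, rfl⟩)
  have := key x
  rwa [hx, map_zero, sub_zero] at this

end Disk

theorem diskMap_id (d r : ℕ) (A : Type u) [CommRing A] :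
    diskMap d r (RingHom.id A) = RingHom.id _ := by
  apply disk_hom_ext
  · simp
  · simp

theorem diskMap_comp (d r : ℕ) {A B C : Type u} [CommRing A] [CommRing B] [CommRing C]
    (f : A →+* B) (g : B →+* C) : diskMap d r (g.comp f) = (diskMap d r g).comp (diskMap d r f) := by
  apply disk_hom_ext
  · rw [RingHom.comp_assoc, diskMap_const, diskMap_const, ← RingHom.comp_assoc _ _ (diskMap d r g),
      diskMap_const]
    rfl
  · simp

/-- The map `A^{d'}_{r', A} → A^d_{r, A}` obtained by base change from a homomorphism
`A^{d'}_{r', R} → A^d_{r, R}` of `R`-algebras, for an `R`-algebra `A`. -/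
def diskBaseChange {d r d' r' : ℕ} {R : CommRingCat.{u}}
    (φ : DiskRing d' r' R →ₐ[R] DiskRing d r R) (A : Under R) :
    DiskRing d' r' A.right →+* DiskRing d r A.right :=
  diskLift (diskConst d r A.right) (fun i => diskMap d r A.hom.hom (φ (diskVar d' r' R i))) (by
    have h1 : Ideal.span (Set.range fun i => diskMap d r A.hom.hom (φ (diskVar d' r' R i))) =
        ((Ideal.span (Set.range (diskVar d' r' R))).map φ.toRingHom).map
          (diskMap d r A.hom.hom) := by
      rw [Ideal.map_span, Ideal.map_span, ← Set.range_comp, ← Set.range_comp]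
      rfl
    rw [h1, ← Ideal.map_pow, ← Ideal.map_pow, span_diskVar_pow, Ideal.map_bot, Ideal.map_bot])

theorem diskBaseChange_const {d r d' r' : ℕ} {R : CommRingCat.{u}}
    (φ : DiskRing d' r' R →ₐ[R] DiskRing d r R) (A : Under R) :
    (diskBaseChange φ A).comp (diskConst d' r' A.right) = diskConst d r A.right :=
  diskLift_const _ _ _

theorem diskBaseChange_natural {d r d' r' : ℕ} {R : CommRingCat.{u}}
    (φ : DiskRing d' r' R →ₐ[R] DiskRing d r R) {A B : Under R} (u : A ⟶ B) :
    (diskBaseChange φ B).comp (diskMap d' r' u.right.hom) =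
      (diskMap d r u.right.hom).comp (diskBaseChange φ A) := by
  apply disk_hom_ext
  · rw [RingHom.comp_assoc, diskMap_const, ← RingHom.comp_assoc _ _ (diskBaseChange φ B),
      diskBaseChange_const, RingHom.comp_assoc _ _ (diskMap d r _), diskBaseChange_const,
      diskMap_const]
  · intro i
    simp only [RingHom.comp_apply, diskMap_var, diskBaseChange, diskLift_var]
    rw [← Under.w u, CommRingCat.hom_comp, diskMap_comp, RingHom.comp_apply]

section Jets

variable {R : CommRingCat.{u}} {S : Scheme.{u}}

/-- The jet space `J^d_r S` of an `R`-scheme `π : S ⟶ Spec R`, through its functor of points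
on affine `R`-schemes: the points over `Spec A` are the morphisms
`Spec A ×_R 𝔻^d_{r, R} = Spec A^d_{r, A} ⟶ S` over `R`. -/
def jetSpace (π : S ⟶ Spec R) (d r : ℕ) : Under R ⥤ Type u where
  obj A := {j : Spec (.of (DiskRing d r A.right)) ⟶ S //
    j ≫ π = Spec.map (A.hom ≫ CommRingCat.ofHom (diskConst d r A.right))}
  map {A B} u := ↾fun j => ⟨Spec.map (CommRingCat.ofHom (diskMap d r u.right.hom)) ≫ j.1, by
    rw [Category.assoc, j.2, ← Spec.map_comp]
    congr 1
    rw [Category.assoc, ← Under.w u, Category.assoc]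
    congr 1
    ext1
    exact diskMap_const d r u.right.hom⟩
  map_id A := by
    refine ConcreteCategory.hom_ext _ _ fun j => Subtype.ext ?_
    change Spec.map (CommRingCat.ofHom (diskMap d r (RingHom.id _))) ≫ j.1 = j.1
    rw [diskMap_id, CommRingCat.ofHom_id, Spec.map_id, Category.id_comp]
  map_comp u v := by
    refine ConcreteCategory.hom_ext _ _ fun j => Subtype.ext ?_
    change Spec.map (CommRingCat.ofHom (diskMap d r (v.right.hom.comp u.right.hom))) ≫ j.1 =
      Spec.map _ ≫ Spec.map _ ≫ j.1
    rw [diskMap_comp, CommRingCat.ofHom_comp, Spec.map_comp, Category.assoc]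

/-- For a morphism `g : S' ⟶ S` over `Spec f : Spec R' ⟶ Spec R`, the map `J^d_r S' ⟶ J^d_r S`
over `Spec f` given by `j ↦ g ∘ j`. -/
def jetMapOver {R' : CommRingCat.{u}} {S' : Scheme.{u}} {π : S ⟶ Spec R} {π' : S' ⟶ Spec R'}
    (f : R ⟶ R') (g : S' ⟶ S) (w : g ≫ π = π' ≫ Spec.map f) (d r : ℕ) :
    jetSpace π' d r ⟶ Under.map f ⋙ jetSpace π d r where
  app A := ↾fun (j : (jetSpace π' d r).obj A) => ⟨j.1 ≫ g, by
    change (j.1 ≫ g) ≫ π =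
      Spec.map ((f ≫ A.hom) ≫ CommRingCat.ofHom (diskConst d r A.right))
    rw [Category.assoc, w, reassoc_of% j.2, ← Spec.map_comp, Category.assoc]⟩
  naturality A B u := by
    refine ConcreteCategory.hom_ext _ _ fun j => Subtype.ext ?_
    exact Category.assoc _ _ _

/-- The map `J^d_r g : J^d_r S' ⟶ J^d_r S` induced by a morphism `g` of `R`-schemes. -/
def jetMap {S' : Scheme.{u}} {π : S ⟶ Spec R} {π' : S' ⟶ Spec R}
    (g : S' ⟶ S) (w : g ≫ π = π') (d r : ℕ) : jetSpace π' d r ⟶ jetSpace π d r where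
  app A := ↾fun (j : (jetSpace π' d r).obj A) => ⟨j.1 ≫ g, by
    rw [Category.assoc, w, j.2]⟩
  naturality A B u := by
    refine ConcreteCategory.hom_ext _ _ fun j => Subtype.ext ?_
    exact Category.assoc _ _ _

/-- The map `(-) ∘ v : J^{d'}_{r'} S ⟶ J^d_r S`, where `v : 𝔻^d_{r, R} ⟶ 𝔻^{d'}_{r', R}` is the
morphism of `R`-schemes given by the homomorphism `φ` of `R`-algebras. -/
def jetPrecomp (π : S ⟶ Spec R) {d r d' r' : ℕ} (φ : DiskRing d' r' R →ₐ[R] DiskRing d r R) :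
    jetSpace π d' r' ⟶ jetSpace π d r where
  app A := ↾fun (j : (jetSpace π d' r').obj A) =>
    ⟨Spec.map (CommRingCat.ofHom (diskBaseChange φ A)) ≫ j.1, by
      rw [Category.assoc, j.2, ← Spec.map_comp, Category.assoc]
      congr 2
      ext1
      exact diskBaseChange_const φ A⟩
  naturality A B u := by
    refine ConcreteCategory.hom_ext _ _ fun j => Subtype.ext ?_
    change Spec.map (CommRingCat.ofHom _) ≫ Spec.map (CommRingCat.ofHom _) ≫ j.1 =
      Spec.map (CommRingCat.ofHom _) ≫ Spec.map (CommRingCat.ofHom _) ≫ j.1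
    rw [← Spec.map_comp_assoc, ← Spec.map_comp_assoc, ← CommRingCat.ofHom_comp,
      ← CommRingCat.ofHom_comp, diskBaseChange_natural φ u]

variable (R) in
/-- The jet space `J^d_r Ľ_R`: its points over `Spec A` are the points of `Ľ` over
`Spec A ×_R 𝔻^d_{r, R} = Spec A^d_{r, A}`. -/
def jetFlag (h : ℤ →₀ ℕ) (d r : ℕ) : Under R ⥤ Type u where
  obj A := Flag h (DiskRing d r A.right)
  map u := ↾fun x => x.baseChange (diskMap d r u.right.hom)
  map_id A := by
    refine ConcreteCategory.hom_ext _ _ fun (x : Flag h (DiskRing d r A.right)) => ?_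
    change x.baseChange (diskMap d r (RingHom.id _)) = x
    rw [diskMap_id, Flag.baseChange_id]
  map_comp {A B C} u v := by
    refine ConcreteCategory.hom_ext _ _ fun (x : Flag h (DiskRing d r A.right)) => ?_
    change x.baseChange (diskMap d r (v.right.hom.comp u.right.hom)) =
      (x.baseChange (diskMap d r u.right.hom)).baseChange (diskMap d r v.right.hom)
    rw [diskMap_comp, Flag.baseChange_comp]

/-- The action of `GL_m` on `J^d_r Ľ_R` induced by the action on `Ľ`. -/
def jetFlagAct {h : ℤ →₀ ℕ} {d r : ℕ} {A : Under R} (g : GL (Fin (totalRank h)) A.right)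
    (x : (jetFlag R h d r).obj A) : (jetFlag R h d r).obj A :=
  Flag.act (B := DiskRing d r A.right)
    (Matrix.GeneralLinearGroup.map (diskConst d r A.right) g) x

/-- The map `(-) ∘ v : J^{d'}_{r'} Ľ_R ⟶ J^d_r Ľ_R`, where `v : 𝔻^d_{r, R} ⟶ 𝔻^{d'}_{r', R}` is the
morphism of `R`-schemes given by the homomorphism `φ` of `R`-algebras. -/
def jetFlagPrecomp (h : ℤ →₀ ℕ) {d r d' r' : ℕ} (φ : DiskRing d' r' R →ₐ[R] DiskRing d r R) :
    jetFlag R h d' r' ⟶ jetFlag R h d r where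
  app A := ↾fun (x : Flag h (DiskRing d' r' A.right)) => x.baseChange (diskBaseChange φ A)
  naturality A B u := by
    refine ConcreteCategory.hom_ext _ _ fun (x : Flag h (DiskRing d' r' A.right)) => ?_
    change (x.baseChange (diskMap d' r' u.right.hom)).baseChange (diskBaseChange φ B) =
      (x.baseChange (diskBaseChange φ A)).baseChange (diskMap d r u.right.hom)
    rw [← Flag.baseChange_comp, ← Flag.baseChange_comp, diskBaseChange_natural]

end Jets

/-! ### Maps to the quotient stack `GL_m \ J^d_r Ľ` -/

section Stacks

variable {R : CommRingCat.{u}}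

/-- The basic open subscheme `Spec A_f` of an affine `R`-scheme `Spec A`. -/
def away (A : Under R) (f : A.right) : Under R :=
  Under.mk (A.hom ≫ CommRingCat.ofHom (algebraMap A.right (Localization.Away f)))

/-- The restriction homomorphism `A → A_f`. -/
def toAway (A : Under R) (f : A.right) : A ⟶ away A f :=
  Under.homMk (CommRingCat.ofHom (algebraMap A.right (Localization.Away f)))

/-- `P` is a sheaf for the Zariski topology on affine `R`-schemes. -/
def IsZariskiSheaf (P : Under R ⥤ Type u) : Prop :=
  ∀ (A : Under R) (s : Set A.right), Ideal.span s = ⊤ →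
    ∀ p : (f : s) → P.obj (away A f.1),
      (∀ (f g : s) (B : Under R) (a : away A f.1 ⟶ B) (b : away A g.1 ⟶ B),
        toAway A f.1 ≫ a = toAway A g.1 ≫ b → P.map a (p f) = P.map b (p g)) →
      ∃! q : P.obj A, ∀ f : s, P.map (toAway A f.1) q = p f

/-- A map of stacks over `R` from (the stack associated with) a sheaf `X` of sets to the quotient
stack `GL_{m, R} \ J^d_r Ľ_R`: a `GL_m`-torsor `γ : P ⟶ X` together with a `GL_m`-equivariant map
`α : P ⟶ J^d_r Ľ_R`. -/
structure ToFlagQuotient (X : Under R ⥤ Type u) (h : ℤ →₀ ℕ) (d r : ℕ) where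
  /-- The total space of the torsor. -/
  P : Under R ⥤ Type u
  [act : ∀ A : Under R, MulAction (GL (Fin (totalRank h)) A.right) (P.obj A)]
  map_smul : ∀ {A B : Under R} (u : A ⟶ B) (g : GL (Fin (totalRank h)) A.right) (p : P.obj A),
    P.map u (g • p) = Matrix.GeneralLinearGroup.map u.right.hom g • P.map u p
  isSheaf : IsZariskiSheaf P
  /-- The projection of the torsor. -/
  γ : P ⟶ X
  γ_smul : ∀ {A : Under R} (g : GL (Fin (totalRank h)) A.right) (p : P.obj A),
    γ.app A (g • p) = γ.app A p
  existsUnique_smul : ∀ {A : Under R} (p q : P.obj A), γ.app A p = γ.app A q →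
    ∃! g : GL (Fin (totalRank h)) A.right, g • p = q
  locally_nonempty : ∀ {A : Under R} (x : X.obj A), ∃ s : Set A.right, Ideal.span s = ⊤ ∧
    ∀ f ∈ s, ∃ p : P.obj (away A f), γ.app (away A f) p = X.map (toAway A f) x
  /-- The equivariant map. -/
  α : P ⟶ jetFlag R h d r
  α_smul : ∀ {A : Under R} (g : GL (Fin (totalRank h)) A.right) (p : P.obj A),
    α.app A (g • p) = jetFlagAct g (α.app A p)

attribute [instance] ToFlagQuotient.act

/-- For `w : J^{d'}_{r'} Ľ_R ⟶ J^d_r Ľ_R` equivariant, the square of stacks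
```
X' --η'--> GL_m \ J^{d'}_{r'} Ľ_R
| t                 | w
X  --η --> GL_m \ J^d_r Ľ_R
```
commutes (up to a 2-isomorphism). An isomorphism between the pairs `(γ', w ∘ α')` and `t^*(γ, α)`
over `X'` is the same as a `GL_m`-equivariant map `ξ` of total spaces over `t` with
`α ∘ ξ = w ∘ α'`. -/
def Commutes {X X' : Under R ⥤ Type u} {h : ℤ →₀ ℕ} {d r d' r' : ℕ}
    (η' : ToFlagQuotient X' h d' r') (η : ToFlagQuotient X h d r) (t : X' ⟶ X)
    (w : jetFlag R h d' r' ⟶ jetFlag R h d r) : Prop :=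
  ∃ ξ : η'.P ⟶ η.P,
    (∀ {A : Under R} (g : GL (Fin (totalRank h)) A.right) (p : η'.P.obj A),
      ξ.app A (g • p) = g • ξ.app A p) ∧
    ξ ≫ η.γ = η'.γ ≫ t ∧ ξ ≫ η.α = η'.α ≫ w

/-- For `f : R ⟶ R'`, the square of stacks
```
X' --η'--> GL_{m, R'} \ J^d_r Ľ_{R'}
| t                 |
X  --η --> GL_{m, R} \ J^d_r Ľ_R
```
over `Spec f : Spec R' ⟶ Spec R` commutes (up to a 2-isomorphism). Here an affine `R'`-scheme is
seen as an affine `R`-scheme through `Under.map f`, and `J^d_r Ľ_{R'}` and `GL_{m, R'}` have the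
same points as `J^d_r Ľ_R` and `GL_{m, R}` on it. -/
def CommutesOver {R' : CommRingCat.{u}} (f : R ⟶ R') {X : Under R ⥤ Type u}
    {X' : Under R' ⥤ Type u} {h : ℤ →₀ ℕ} {d r : ℕ}
    (η' : ToFlagQuotient X' h d r) (η : ToFlagQuotient X h d r)
    (t : X' ⟶ Under.map f ⋙ X) : Prop :=
  ∃ ξ : ∀ A : Under R', η'.P.obj A → η.P.obj ((Under.map f).obj A),
    (∀ {A B : Under R'} (u : A ⟶ B) (p : η'.P.obj A),
      ξ B (η'.P.map u p) = η.P.map ((Under.map f).map u) (ξ A p)) ∧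
    (∀ (A : Under R') (g : GL (Fin (totalRank h)) A.right) (p : η'.P.obj A),
      ξ A (g • p) = (show GL (Fin (totalRank h)) ((Under.map f).obj A).right from g) • ξ A p) ∧
    (∀ (A : Under R') (p : η'.P.obj A),
      η.γ.app ((Under.map f).obj A) (ξ A p) = t.app A (η'.γ.app A p)) ∧
    (∀ (A : Under R') (p : η'.P.obj A),
      (show Flag h (DiskRing d r A.right) from η.α.app ((Under.map f).obj A) (ξ A p)) =
        η'.α.app A p)

end Stacks

/-! ### Filtered bundles with flat connection -/

section Connections

/-- The map on Kähler differentials induced by a commutative square, as a semilinear map. -/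
def formMap {A B A' B' : CommRingCat.{u}} {f : A ⟶ B} {f' : A' ⟶ B'} {g : A ⟶ A'} {g' : B ⟶ B'}
    (fac : g ≫ f' = f ≫ g') :
    CommRingCat.KaehlerDifferential f →ₛₗ[g'.hom] CommRingCat.KaehlerDifferential f' where
  toFun x := (CommRingCat.KaehlerDifferential.map fac).hom x
  map_add' x y := map_add _ x y
  map_smul' a x := (CommRingCat.KaehlerDifferential.map fac).hom.map_smul a x

/-- For a `B`-module `M` and an `A`-algebra `B`, the map
`∇ : M → Ω_{B/A} ⊗ M` is a flat connection: it satisfies the Leibniz rule, and its curvature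
`∇¹ ∘ ∇ : M → Ω²_{B/A} ⊗ M` vanishes, where `∇¹(ω ⊗ e) = dω ⊗ e - ω ∧ ∇ e`. Every form is a sum of
forms `ω = a db`, with `dω = da ∧ db`. The module `Ω²` is seen as a direct summand of the exterior
algebra of `Ω`. -/
structure IsFlatConnection {A B : CommRingCat.{u}} (f : A ⟶ B) {M : Type u} [AddCommGroup M]
    [Module B M] (nabla : M →+ CommRingCat.KaehlerDifferential f ⊗[B] M) : Prop where
  leibniz : ∀ (a : B) (s : M),
    nabla (a • s) = CommRingCat.KaehlerDifferential.d (f := f) a ⊗ₜ[B] s + a • nabla s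
  flat : ∀ (s : M) (n : ℕ) (a b : Fin n → B) (e : Fin n → M),
    nabla s = ∑ i, (a i • CommRingCat.KaehlerDifferential.d (f := f) (b i)) ⊗ₜ[B] e i →
    ∑ i, (ExteriorAlgebra.ι B (CommRingCat.KaehlerDifferential.d (f := f) (a i)) *
        ExteriorAlgebra.ι B (CommRingCat.KaehlerDifferential.d (f := f) (b i))) ⊗ₜ[B] e i -
      ∑ i, LinearMap.rTensor M
        (LinearMap.mulLeft B (ExteriorAlgebra.ι B
            (a i • CommRingCat.KaehlerDifferential.d (f := f) (b i))) ∘ₗ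
          ExteriorAlgebra.ι B (M := CommRingCat.KaehlerDifferential f)) (nabla (e i)) = 0

end Connections

section Bundles

variable {R : CommRingCat.{u}} {S : Scheme.{u}}

/-- The `R`-algebra structure of the ring of functions on an open subscheme of an `R`-scheme. -/
def structMap (π : S ⟶ Spec R) (U : S.Opens) : R ⟶ Γ(S, U) :=
  (Scheme.ΓSpecIso R).inv ≫ π.appTop ≫ S.presheaf.map (homOfLE le_top).op

theorem structMap_res (π : S ⟶ Spec R) {U V : S.Opens} (i : V ≤ U) :
    𝟙 R ≫ structMap π V = structMap π U ≫ S.presheaf.map (homOfLE i).op := by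
  rw [structMap, structMap, Category.id_comp, Category.assoc, Category.assoc, ← Functor.map_comp]
  rfl

theorem structMap_appLE {R' : CommRingCat.{u}} {S' : Scheme.{u}} {π : S ⟶ Spec R}
    {π' : S' ⟶ Spec R'} {f : R ⟶ R'} {g : S' ⟶ S} (w : g ≫ π = π' ≫ Spec.map f)
    {U : S.Opens} {V : S'.Opens} (i : V ≤ g ⁻¹ᵁ U) :
    f ≫ structMap π' V = structMap π U ≫ g.appLE U V i := by
  have h1 : g.appTop ≫ S'.presheaf.map (homOfLE (le_top : V ≤ ⊤)).op =
      S.presheaf.map (homOfLE (le_top : U ≤ ⊤)).op ≫ g.appLE U V i :=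
    (Scheme.Hom.map_appLE g i (homOfLE (le_top : U ≤ ⊤)).op).symm
  have h2 : π.appTop ≫ g.appTop = (Spec.map f).appTop ≫ π'.appTop := by
    rw [← Scheme.Hom.comp_appTop, ← Scheme.Hom.comp_appTop, w]
  rw [structMap, structMap, Category.assoc, Category.assoc, ← h1, reassoc_of% h2,
    ← Category.assoc f, Scheme.ΓSpecIso_inv_naturality, Category.assoc]

/-- Restriction of sections of a sheaf of modules, as a semilinear map. -/
def resMap (H : S.Modules) {U V : S.Opens} (i : V ≤ U) :
    Γ(H, U) →ₛₗ[(S.presheaf.map (homOfLE i).op).hom] Γ(H, V) where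
  toFun s := H.presheaf.map (homOfLE i).op s
  map_add' x y := map_add _ x y
  map_smul' a x := Scheme.Modules.map_smul H (homOfLE i) a x

/-- For `φ : H ⟶ g_* H'`, the map `Γ(H, U) → Γ(H', V)` where `V ≤ g⁻¹ U`. -/
def pullMap {S' : Scheme.{u}} (g : S' ⟶ S) {H : S.Modules} {H' : S'.Modules}
    (φ : H ⟶ (Scheme.Modules.pushforward g).obj H') {U : S.Opens} {V : S'.Opens}
    (i : V ≤ g ⁻¹ᵁ U) : Γ(H, U) →ₛₗ[(g.appLE U V i).hom] Γ(H', V) where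
  toFun s := H'.presheaf.map (homOfLE i).op (φ.app U s)
  map_add' x y := by rw [map_add]; exact map_add _ _ _
  map_smul' a x := by
    rw [Scheme.Modules.Hom.app_smul]
    exact Scheme.Modules.map_smul H' (homOfLE i) (g.app U a) (φ.app U x)

/-- `v` is a filtration-compatible frame over `U` of the module `H` with filtration `F`: over every
open `V ≤ U` it restricts to a basis of `H(V)`, and `F^k(V)` is spanned by the first `j_k` sections
of this basis. -/
structure IsCompatibleFrame {H : S.Modules} {h : ℤ →₀ ℕ}
    (F : ℤ → ∀ U : S.Opens, Submodule Γ(S, U) Γ(H, U)) {U : S.Opens}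
    (v : Fin (totalRank h) → Γ(H, U)) : Prop where
  linearIndependent : ∀ (V : S.Opens) (i : V ≤ U),
    LinearIndependent Γ(S, V) (fun a => resMap H i (v a))
  span_eq_top : ∀ (V : S.Opens) (i : V ≤ U),
    Submodule.span Γ(S, V) (Set.range fun a => resMap H i (v a)) = ⊤
  span_eq_filtration : ∀ (k : ℤ) (V : S.Opens) (i : V ≤ U),
    F k V = Submodule.span Γ(S, V) ((fun a => resMap H i (v a)) '' {a | (a : ℕ) < tailRank h k})

/-- A triple `(H, F, ∇)` on the `R`-scheme `π : S ⟶ Spec R`: a vector bundle `H` of rank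
`m = ∑ hⁱ`, a decreasing filtration `F` of `H` by subbundles with graded pieces `Fⁱ / Fⁱ⁺¹` locally
free of rank `hⁱ`, and a flat connection `∇ : H → Ω¹_{S/R} ⊗ H`. -/
structure FlatFilteredBundle (π : S ⟶ Spec R) (h : ℤ →₀ ℕ) where
  /-- The sheaf of sections of the bundle. -/
  H : S.Modules
  /-- The filtration, on sections over open subsets. -/
  F : ℤ → ∀ U : S.Opens, Submodule Γ(S, U) Γ(H, U)
  antitone : ∀ U, Antitone (F · U)
  res_mem : ∀ (k : ℤ) {U V : S.Opens} (i : V ≤ U) (s : Γ(H, U)), s ∈ F k U → resMap H i s ∈ F k V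
  mem_of_locally : ∀ (k : ℤ) (U : S.Opens) (s : Γ(H, U)),
    (∀ x ∈ U, ∃ (V : S.Opens) (i : V ≤ U), x ∈ V ∧ resMap H i s ∈ F k V) → s ∈ F k U
  exists_frame : ∀ x : S, ∃ (U : S.Opens) (v : Fin (totalRank h) → Γ(H, U)),
    x ∈ U ∧ IsCompatibleFrame (h := h) F v
  /-- The connection, on sections over affine open subsets; over these, the sections of
  `Ω¹_{S/R} ⊗ H` are given by the tensor product below. -/
  nabla : ∀ U : S.affineOpens,
    Γ(H, U.1) →+ CommRingCat.KaehlerDifferential (structMap π U.1) ⊗[Γ(S, U.1)] Γ(H, U.1)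
  nabla_res : ∀ {U V : S.affineOpens} (i : V.1 ≤ U.1) (s : Γ(H, U.1)),
    nabla V (resMap H i s) =
      TensorProduct.map (formMap (structMap_res π i)) (resMap H i) (nabla U s)
  isFlatConnection : ∀ U : S.affineOpens, IsFlatConnection (structMap π U.1) (nabla U)

/-- `E'` is the pullback of the triple `E` along `g : S' ⟶ S` over `Spec f : Spec R' ⟶ Spec R`, by
means of `φ : H ⟶ g_* H'`. That `φ` induces an isomorphism from `g^* H` to `H'`, and from `g^* F` to
`F'`, is expressed by saying that the pullback of a filtration-compatible frame is
filtration-compatible. -/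
structure IsPullbackTriple {R' : CommRingCat.{u}} {S' : Scheme.{u}} {π : S ⟶ Spec R}
    {π' : S' ⟶ Spec R'} {h : ℤ →₀ ℕ} (f : R ⟶ R') (g : S' ⟶ S) (w : g ≫ π = π' ≫ Spec.map f)
    (E : FlatFilteredBundle π h) (E' : FlatFilteredBundle π' h)
    (φ : E.H ⟶ (Scheme.Modules.pushforward g).obj E'.H) : Prop where
  frame : ∀ {U : S.Opens} (v : Fin (totalRank h) → Γ(E.H, U)), IsCompatibleFrame (h := h) E.F v →
    IsCompatibleFrame (h := h) E'.F (U := g ⁻¹ᵁ U) (fun a => pullMap g φ le_rfl (v a))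
  nabla : ∀ {U : S.affineOpens} {V : S'.affineOpens} (i : V.1 ≤ g ⁻¹ᵁ U.1) (s : Γ(E.H, U.1)),
    E'.nabla V (pullMap g φ i s) =
      TensorProduct.map (formMap (structMap_appLE w i)) (pullMap g φ i) (E.nabla U s)

attribute [local instance] MvPolynomial.gradedAlgebra in
variable (R) in
/-- The projective space `ℙⁿ_R`, with its structure morphism. -/
def projectiveSpace (n : ℕ) : Over (Spec R) :=
  Over.mk (Proj.toSpecZero (MvPolynomial.homogeneousSubmodule (Fin (n + 1)) R) ≫
    Spec.map (CommRingCat.ofHom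
      (algebraMap R (MvPolynomial.homogeneousSubmodule (Fin (n + 1)) R 0))))

/-- `π : S ⟶ Spec R` is quasi-projective: `S` is isomorphic over `R` to a quasi-compact locally
closed subscheme of some `ℙⁿ_R`. -/
def IsQuasiProjective (π : S ⟶ Spec R) : Prop :=
  ∃ (n : ℕ) (i : S ⟶ (projectiveSpace R n).left),
    i ≫ (projectiveSpace R n).hom = π ∧ IsImmersion i ∧ QuasiCompact i

end Bundles

/-! ### Étale local infinitesimal period maps -/

section Elimps

/-- The change-of-basis matrix from `v` to `b`: its `i`-th column holds the coordinates of `v i` in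
the basis `b`. -/
def changeOfBasis {A M : Type u} [CommRing A] [AddCommGroup M] [Module A M] {n : ℕ}
    (v b : Module.Basis (Fin n) A M) : GL (Fin n) A where
  val := b.toMatrix v
  inv := v.toMatrix b
  val_inv := b.toMatrix_mul_toMatrix_flip v
  inv_val := v.toMatrix_mul_toMatrix_flip b

variable {R : CommRingCat.{u}} {S : Scheme.{u}} {π : S ⟶ Spec R} {h : ℤ →₀ ℕ}

/-- The data defining an étale local infinitesimal period map `ψ = q ∘ M` of order `r` (an
`r`-elimp). Here `U` is an affine open subscheme with an étale map `δ = (z₁, …, z_n) : U ⟶ 𝔸ⁿ_R`,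
`I = (z₁, …, z_n)`, and `v` and `b` are frames of `H^r_δ = H(U) / I^(r+1) H(U)` over
`𝒪^r_{S, δ} = 𝒪(U) / I^(r+1)`. As `∇` maps `I^(r+1) H` to `I^r (Ω¹ ⊗ H)`, it induces a map
`∇ : H^r_δ → (Ω¹ ⊗ H) / I^r`; this is the map for which `b` is flat. -/
structure Elimp (E : FlatFilteredBundle π h) (r : ℕ) where
  U : S.affineOpens
  n : ℕ
  z : Fin n → Γ(S, U.1)
  etale : (MvPolynomial.eval₂Hom (structMap π U.1).hom z).Etale
  /-- A filtration-compatible frame. -/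
  v : Module.Basis (Fin (totalRank h)) (Γ(S, U.1) ⧸ Ideal.span (Set.range z) ^ (r + 1))
    (Γ(E.H, U.1) ⧸ (Ideal.span (Set.range z) ^ (r + 1) • ⊤ : Submodule Γ(S, U.1) Γ(E.H, U.1)))
  /-- A flat frame. -/
  b : Module.Basis (Fin (totalRank h)) (Γ(S, U.1) ⧸ Ideal.span (Set.range z) ^ (r + 1))
    (Γ(E.H, U.1) ⧸ (Ideal.span (Set.range z) ^ (r + 1) • ⊤ : Submodule Γ(S, U.1) Γ(E.H, U.1)))
  compatible : ∀ k, Submodule.span Γ(S, U.1) (v '' {i | (i : ℕ) < tailRank h k}) =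
    (E.F k U.1).map
      (Ideal.span (Set.range z) ^ (r + 1) • ⊤ : Submodule Γ(S, U.1) Γ(E.H, U.1)).mkQ
  flat : ∀ i, ∃ s : Γ(E.H, U.1), Submodule.Quotient.mk s = b i ∧
    E.nabla U s ∈ (Ideal.span (Set.range z) ^ r • ⊤ : Submodule Γ(S, U.1)
      (CommRingCat.KaehlerDifferential (structMap π U.1) ⊗[Γ(S, U.1)] Γ(E.H, U.1)))

namespace Elimp

variable {E : FlatFilteredBundle π h} {r d : ℕ}

/-- The matrix `M ∈ GL_m(𝒪^r_{S, δ})`. -/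
def M (ψ : Elimp E r) :
    GL (Fin (totalRank h)) (Γ(S, ψ.U.1) ⧸ Ideal.span (Set.range ψ.z) ^ (r + 1)) :=
  changeOfBasis ψ.v ψ.b

/-- `ψ` is defined at the base point of the jet in `(J^d_r U)(R)` given by `j`, that is, `δ` maps
this base point to `0`. -/
def IsDefinedAt (ψ : Elimp E r) (j : Γ(S, ψ.U.1) →+* DiskRing d r R) : Prop :=
  ∀ i, diskEval d r R (j (ψ.z i)) = 0

/-- The jet `ψ ∘ j = q ∘ (M ∘ j)` in `(J^d_r Ľ)(R)`; the jet `j` factors through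
`Spec 𝒪^r_{S, δ}`. -/
def comp (ψ : Elimp E r) (j : Γ(S, ψ.U.1) →+* DiskRing d r R) (hj : ψ.IsDefinedAt j) :
    Flag h (DiskRing d r R) :=
  flagOfMatrix h (Matrix.GeneralLinearGroup.map
    (Ideal.Quotient.lift (Ideal.span (Set.range ψ.z) ^ (r + 1)) j fun a ha => by
      have h1 : (Ideal.span (Set.range ψ.z)).map j ≤ Ideal.span (Set.range (diskVar d r R)) := by
        rw [Ideal.map_span, Ideal.span_le]
        rintro _ ⟨_, ⟨i, rfl⟩, rfl⟩
        exact mem_span_diskVar d r (hj i)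
      have h2 := Ideal.mem_map_of_mem j ha
      rw [Ideal.map_pow] at h2
      have h3 := Ideal.pow_right_mono h1 (r + 1) h2
      rwa [span_diskVar_pow, Ideal.mem_bot] at h3) ψ.M)

end Elimp

end Elimps

end

end PeriodJets

open PeriodJets

/-! The torsor over `J^d_r S` is the sheaf of flat frames. A point over `Spec A` is a jet `j : 𝔻_A ⟶
S` with a frame of `j^* H` that is horizontal for the pulled-back connection, and the equivariant
map writes the filtration `j^* F` in the coordinates of this frame. A constant matrix in `GL_m(A)`
changes the frame and moves the flag by the same matrix, so the main point is that flat frames along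
a jet form a torsor under constant matrices.

A derivative maps `A[t]/(t)^(r+1)` only to `A[t]/(t)^r`, so horizontality is an equation modulo
`(t)^r`. In a local frame of the bundle it reads `∂ᵢ G = Θᵢ G` for the connection matrices `Θᵢ`. The
vanishing of the curvature is the integrability condition (`curvature_identity`). The system is
solved order by order with the Poincaré lemma, dividing by `1, …, r`
(`exists_flat_matrix_polynomial`, `exists_horizontal_matrix`). Two solutions differ by a matrix with
vanishing derivatives (`truncDeriv_eq_zero_of_horizontal`), which is constant, again because `r!` is
invertible (`eq_const_of_truncDeriv_eq_zero`). Zariski descent for jets, frames, invertible matrices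
and filtrations makes this global (`FramedJet.isSheaf`, `exists_glue_GL`, `Flag.exists_glue`).

A frame is recorded dually, by the coordinates of the sections of `H` (`FrameCoords`), so that the
module `j^* H` never has to be formed. Equalities of coordinates are tested on the disks over all
`A`-algebras `B`. In this form (i) and (ii) are nearly tautological: a section of `H` and its
pullback have the same coordinates.

For (iii), horizontality has to survive composition with a morphism `v` of disks of different
orders. The chain rule involves elements known modulo `(t')^r'`, pulled back by `v` and multiplied
by `∂ᵢ (v^* t'ₖ)`, and the ambiguity must vanish modulo `(t)^r`. As `(v^* t'ₖ)^(r'+1) = 0` and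
orders of vanishing are additive over a domain, `v^* t'ₖ` vanishes to order more than `r / (r' +
1)`, which is just enough (`exists_truncDeriv_diskBaseChange`).

For (iv), let `I` be the ideal of the coordinates of `δ`. A jet based at a zero of `δ` maps `I` into
`(t)`. It therefore kills `I^(r+1)`, and the derivatives of lifts of the flat frame `b`, which lie
in `I^r`, vanish modulo `(t)^r`. So the frame along the jet that is dual to these lifts is flat
(`Elimp.IsAdapted.isFlat`), and its flag is given by the matrix `M`
(`Elimp.IsAdapted.isPeriodFlag`). Since `H` is trivial only on smaller open subsets, this adapted
frame is built locally, by extending sections from basic open subsets up to a denominator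
(`FlatFilteredBundle.exists_pow_smul_eq_resMap`); it glues because it is unique. -/

namespace PeriodJets

noncomputable section

/-! ### Truncated polynomial rings -/

section TruncPoly

open MvPolynomial

/-- The ring `A[t₁, …, t_d] / (t₁, …, t_d)ⁿ`. -/
abbrev TruncPoly (d n : ℕ) (A : Type u) [CommRing A] : Type u :=
  MvPolynomial (Fin d) A ⧸ (idealOfVars (Fin d) A) ^ n

variable {d : ℕ} {A B C : Type u} [CommRing A] [CommRing B] [CommRing C]

theorem map_mem_pow_idealOfVars (f : A →+* B) {n : ℕ} {p : MvPolynomial (Fin d) A}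
    (hp : p ∈ idealOfVars (Fin d) A ^ n) : map f p ∈ idealOfVars (Fin d) B ^ n := by
  rw [mem_pow_idealOfVars_iff'] at hp ⊢
  intro x hx
  rw [coeff_map, hp x hx, map_zero]

theorem map_idealOfVars_pow (f : A →+* B) (n : ℕ) :
    (idealOfVars (Fin d) A ^ n).map (map (σ := Fin d) f) = idealOfVars (Fin d) B ^ n := by
  rw [Ideal.map_pow]
  congr 1
  unfold idealOfVars
  rw [Ideal.map_span, ← Set.range_comp]
  congr 2
  ext i
  simp

theorem pderiv_mem_pow_idealOfVars {n : ℕ} {p : MvPolynomial (Fin d) A} (i : Fin d)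
    (hp : p ∈ idealOfVars (Fin d) A ^ (n + 1)) : pderiv i p ∈ idealOfVars (Fin d) A ^ n := by
  rw [mem_pow_idealOfVars_iff'] at hp ⊢
  intro x hx
  rw [coeff_pderiv, hp _ (by simp; omega), zero_mul]

/-- The map `A[t] / (t)ⁿ → B[t] / (t)ⁿ` induced by `A → B`. -/
def truncMap (d n : ℕ) (f : A →+* B) : TruncPoly d n A →+* TruncPoly d n B :=
  Ideal.quotientMap _ (map f) fun _ hp => map_mem_pow_idealOfVars f hp

@[simp]
theorem truncMap_mk {n : ℕ} (f : A →+* B) (p : MvPolynomial (Fin d) A) :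
    truncMap d n f (Ideal.Quotient.mk _ p) = Ideal.Quotient.mk _ (map f p) :=
  Ideal.quotientMap_mk

@[simp]
theorem diskMap_mk {r : ℕ} (f : A →+* B) (p : MvPolynomial (Fin d) A) :
    diskMap d r f (Ideal.Quotient.mk _ p) = Ideal.Quotient.mk _ (map f p) := by
  have : diskMap d r f = truncMap d (r + 1) f := by
    apply disk_hom_ext
    · rw [diskMap_const]
      ext a
      simp
    · intro i
      simp
  rw [this, truncMap_mk]

/-- The truncation `A[t] / (t)ⁿ⁺¹ → A[t] / (t)ⁿ`. -/
def truncSucc (d n : ℕ) (A : Type u) [CommRing A] : TruncPoly d (n + 1) A →+* TruncPoly d n A :=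
  Ideal.Quotient.factor (Ideal.pow_le_pow_right n.le_succ)

@[simp]
theorem truncSucc_mk {n : ℕ} (p : MvPolynomial (Fin d) A) :
    truncSucc d n A (Ideal.Quotient.mk _ p) = Ideal.Quotient.mk _ p :=
  rfl

/-- The partial derivative `∂ᵢ : A[t] / (t)ⁿ⁺¹ → A[t] / (t)ⁿ`. -/
def truncDeriv (n : ℕ) (i : Fin d) : TruncPoly d (n + 1) A →+ TruncPoly d n A :=
  QuotientAddGroup.map _ _ (pderiv (R := A) i).toLinearMap.toAddMonoidHom fun _ hp =>
    pderiv_mem_pow_idealOfVars i hp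

@[simp]
theorem truncDeriv_mk {n : ℕ} (i : Fin d) (p : MvPolynomial (Fin d) A) :
    truncDeriv n i (Ideal.Quotient.mk _ p) = Ideal.Quotient.mk _ (pderiv i p) :=
  rfl

theorem truncDeriv_mul {n : ℕ} (i : Fin d) (x y : TruncPoly d (n + 1) A) :
    truncDeriv n i (x * y) =
      truncSucc d n A x * truncDeriv n i y + truncSucc d n A y * truncDeriv n i x := by
  obtain ⟨p, rfl⟩ := Ideal.Quotient.mk_surjective x
  obtain ⟨q, rfl⟩ := Ideal.Quotient.mk_surjective y
  have h : truncDeriv n i (Ideal.Quotient.mk _ (p * q)) =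
      Ideal.Quotient.mk (idealOfVars (Fin d) A ^ n) (pderiv i (p * q)) := rfl
  rw [map_mul, pderiv_mul] at h
  rw [h]
  simp only [truncDeriv_mk, truncSucc_mk, map_mul, map_add]
  ring

theorem truncDeriv_const {n : ℕ} (i : Fin d) (a : A) :
    truncDeriv n i (Ideal.Quotient.mk _ (MvPolynomial.C a)) = 0 := by
  simp

theorem truncDeriv_comm {n : ℕ} (i k : Fin d) (x : TruncPoly d (n + 2) A) :
    truncDeriv n i (truncDeriv (n + 1) k x) = truncDeriv n k (truncDeriv (n + 1) i x) := by
  obtain ⟨p, rfl⟩ := Ideal.Quotient.mk_surjective x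
  simp only [truncDeriv_mk]
  congr 1
  have : ⁅pderiv (R := A) i, pderiv (R := A) k⁆ = 0 := by
    apply MvPolynomial.derivation_ext
    intro j
    classical
    simp [Derivation.commutator_apply, pderiv_X, Pi.single_apply, apply_ite]
  have := DFunLike.congr_fun this p
  rwa [Derivation.commutator_apply, Derivation.zero_apply, sub_eq_zero] at this

theorem truncSucc_truncDeriv {n : ℕ} (i : Fin d) (x : TruncPoly d (n + 2) A) :
    truncSucc d n A (truncDeriv (n + 1) i x) = truncDeriv n i (truncSucc d (n + 1) A x) := by
  obtain ⟨p, rfl⟩ := Ideal.Quotient.mk_surjective x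
  simp

theorem truncDeriv_diskMap {r : ℕ} (f : A →+* B) (i : Fin d) (x : DiskRing d r A) :
    truncDeriv r i (diskMap d r f x) = truncMap d r f (truncDeriv r i x) := by
  obtain ⟨p, rfl⟩ := Ideal.Quotient.mk_surjective x
  rw [diskMap_mk, truncDeriv_mk, truncDeriv_mk, truncMap_mk, pderiv_map]

theorem truncSucc_diskMap {r : ℕ} (f : A →+* B) (x : DiskRing d r A) :
    truncSucc d r B (diskMap d r f x) = truncMap d r f (truncSucc d r A x) := by
  obtain ⟨p, rfl⟩ := Ideal.Quotient.mk_surjective x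
  simp

theorem diskEval_diskConst {r : ℕ} (a : A) : diskEval d r A (diskConst d r A a) = a := by
  have : (diskEval d r A).comp (diskConst d r A) = RingHom.id A := diskLift_const _ _ _
  exact RingHom.congr_fun this a

/-- An element of `A[t] / (t)ʳ⁺¹` whose derivatives vanish is constant, if `r!` is invertible. -/
theorem eq_const_of_truncDeriv_eq_zero {r : ℕ} (hr : IsUnit ((r.factorial : ℕ) : A))
    {x : DiskRing d r A} (hx : ∀ i, truncDeriv r i x = 0) :
    x = diskConst d r A (diskEval d r A x) := by
  obtain ⟨p, rfl⟩ := Ideal.Quotient.mk_surjective x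
  have key : p - MvPolynomial.C (coeff 0 p) ∈ idealOfVars (Fin d) A ^ (r + 1) := by
    rw [mem_pow_idealOfVars_iff']
    intro m hm
    by_cases h0 : m = 0
    · simp [h0]
    rw [coeff_sub, coeff_C, if_neg (Ne.symm h0), sub_zero]
    obtain ⟨i, hi⟩ : ∃ i, m i ≠ 0 := by
      by_contra! h
      exact h0 (Finsupp.ext h)
    have h1 := hx i
    rw [truncDeriv_mk, Ideal.Quotient.eq_zero_iff_mem, mem_pow_idealOfVars_iff'] at h1
    have hm' : m - Finsupp.single i 1 + Finsupp.single i 1 = m :=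
      tsub_add_cancel_of_le (by simpa [Nat.one_le_iff_ne_zero] using hi)
    have hdeg : (m - Finsupp.single i 1).degree + 1 = m.degree := by
      conv_rhs => rw [← hm']
      simp
    have h2 := h1 (m - Finsupp.single i 1) (by omega)
    rw [coeff_pderiv, hm'] at h2
    have h3 : ((m - Finsupp.single i 1 : Fin d →₀ ℕ) i : A) + 1 = ((m i : ℕ) : A) := by
      rw [← Nat.cast_succ]
      congr 1
      simp
      omega
    rw [h3] at h2
    -- The coefficient of `t^m` appears in `∂ᵢ p` multiplied by `m i`, and `1 ≤ m i ≤ |m| ≤ r`, so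
    -- `m i` divides `r!`.
    have h4 : IsUnit ((m i : ℕ) : A) := by
      refine isUnit_of_dvd_unit ?_ hr
      refine Nat.cast_dvd_cast (Nat.dvd_factorial (Nat.pos_of_ne_zero hi) ?_)
      have := Finsupp.le_degree i m
      omega
    exact (h4.mul_left_eq_zero).mp h2
  have h1 : (Ideal.Quotient.mk _ p : DiskRing d r A) = diskConst d r A (coeff 0 p) := by
    rw [RingHom.comp_apply, Ideal.Quotient.eq]
    exact key
  rw [h1, diskEval_diskConst]

theorem truncDeriv_diskConst {r : ℕ} (i : Fin d) (a : A) :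
    truncDeriv r i (diskConst d r A a) = 0 :=
  truncDeriv_const i a

/-- Euler's identity is exact on the homogeneous component of degree `n`. What remains of `p` has
order at least `n + 1`, and the Euler operator does not lower the order. -/
theorem euler_sub_mem {n : ℕ} {p : MvPolynomial (Fin d) A}
    (hp : p ∈ idealOfVars (Fin d) A ^ n) :
    ∑ i, X i * pderiv i p - n • p ∈ idealOfVars (Fin d) A ^ (n + 1) := by
  set q := homogeneousComponent n p
  have h1 : p - q ∈ idealOfVars (Fin d) A ^ (n + 1) := by
    rw [mem_pow_idealOfVars_iff'] at hp ⊢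
    intro x hx
    rw [coeff_sub, coeff_homogeneousComponent]
    split_ifs with h
    · simp
    · rw [hp x (by omega), sub_zero]
  have h2 := (homogeneousComponent_isHomogeneous n p).sum_X_mul_pderiv
  have h3 : ∑ i, X i * pderiv i p - n • p = ∑ i, X i * pderiv i (p - q) - n • (p - q) := by
    simp only [map_sub, mul_sub, Finset.sum_sub_distrib, smul_sub]
    rw [h2]
    ring
  rw [h3]
  refine Ideal.sub_mem _ (Ideal.sum_mem _ fun i _ => ?_) (Submodule.smul_of_tower_mem _ n h1)
  rw [pow_succ']
  exact Ideal.mul_mem_mul (Ideal.subset_span ⟨i, rfl⟩) (pderiv_mem_pow_idealOfVars i h1)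

/-- The Poincaré lemma, for the lowest order terms of a `1`-form. -/
theorem exists_pderiv_sub_mem {n : ℕ} (hn : IsUnit ((n + 1 : ℕ) : A))
    (w : Fin d → MvPolynomial (Fin d) A) (hw : ∀ i, w i ∈ idealOfVars (Fin d) A ^ n)
    (hc : ∀ i k, pderiv k (w i) - pderiv i (w k) ∈ idealOfVars (Fin d) A ^ n) :
    ∃ p ∈ idealOfVars (Fin d) A ^ (n + 1),
      ∀ k, pderiv k p - w k ∈ idealOfVars (Fin d) A ^ (n + 1) := by
  obtain ⟨ν, hν⟩ := hn.exists_right_inv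
  have hX : ∀ (i : Fin d) {y : MvPolynomial (Fin d) A}, y ∈ idealOfVars (Fin d) A ^ n →
      X i * y ∈ idealOfVars (Fin d) A ^ (n + 1) := fun i y hy => by
    rw [pow_succ']
    exact Ideal.mul_mem_mul (Ideal.subset_span ⟨i, rfl⟩) hy
  -- The radial homotopy operator: contract the form with the Euler field and divide by `n + 1`.
  refine ⟨MvPolynomial.C ν * ∑ i, X i * w i,
    Ideal.mul_mem_left _ _ (Ideal.sum_mem _ fun i _ => hX i (hw i)), fun k => ?_⟩
  have h1 : pderiv k (∑ i, X i * w i) = w k + ∑ i, X i * pderiv k (w i) := by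
    classical
    simp only [map_sum, pderiv_mul, pderiv_X, Finset.sum_add_distrib]
    congr 1
    rw [Finset.sum_eq_single k]
    · simp
    · intro b _ hb
      simp [hb]
    · simp
  -- Closedness exchanges `∂ₖ wᵢ` for `∂ᵢ wₖ` at the cost of an error in `(t)^n`, which the factor
  -- `X i` raises to `(t)^(n+1)`. Euler's identity then gives `n wₖ`, and with the term `wₖ` from
  -- the product rule the total is `(n + 1) wₖ`.
  have h2 : ∑ i, X i * pderiv k (w i) - ∑ i, X i * pderiv i (w k) ∈
      idealOfVars (Fin d) A ^ (n + 1) := by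
    rw [← Finset.sum_sub_distrib]
    refine Ideal.sum_mem _ fun i _ => ?_
    rw [← mul_sub]
    exact hX i (hc i k)
  have h3 := Ideal.add_mem _ h2 (euler_sub_mem (hw k))
  have h4 : (MvPolynomial.C ν : MvPolynomial (Fin d) A) * ((n : MvPolynomial (Fin d) A) + 1) = 1 := by
    have := congrArg (MvPolynomial.C (σ := Fin d)) hν
    rw [map_mul, map_one, mul_comm] at this
    simpa using this
  rw [pderiv_C_mul, h1]
  convert Ideal.mul_mem_left _ (MvPolynomial.C ν) h3 using 1
  rw [nsmul_eq_mul]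
  linear_combination (w k) * h4

open Matrix in
/-- Integration of a flat connection on a trivial bundle over an infinitesimal disk. -/
theorem exists_flat_matrix_polynomial {m r : ℕ} (hr : IsUnit ((r.factorial : ℕ) : A))
    (Θ : Fin d → Matrix (Fin m) (Fin m) (MvPolynomial (Fin d) A))
    (hΘ : ∀ i k a b, (((Θ k).map (pderiv i) - (Θ i).map (pderiv k) -
      (Θ i * Θ k - Θ k * Θ i)) a b) ∈ idealOfVars (Fin d) A ^ (r - 1)) (n : ℕ) (hn : n ≤ r) :
    ∃ G : Matrix (Fin m) (Fin m) (MvPolynomial (Fin d) A),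
      (∀ a b, (G - 1) a b ∈ idealOfVars (Fin d) A) ∧
      ∀ i a b, (G.map (pderiv i) - Θ i * G) a b ∈ idealOfVars (Fin d) A ^ n := by
  -- The equation is solved modulo `(t)^n` for increasing `n`; each step corrects `G` by a term of
  -- order `n + 1`.
  induction n with
  | zero => exact ⟨1, by simp, by simp⟩
  | succ n ih =>
    obtain ⟨G, hG1, hG⟩ := ih (by omega)
    set J := idealOfVars (Fin d) A
    have hmap : ∀ (i : Fin d) (M N : Matrix (Fin m) (Fin m) (MvPolynomial (Fin d) A)),
        (M * N).map (pderiv i) = M.map (pderiv i) * N + M * N.map (pderiv i) := by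
      intro i M N
      ext1 a b
      simp only [Matrix.map_apply, Matrix.mul_apply, Matrix.add_apply, map_sum, pderiv_mul,
        Finset.sum_add_distrib]
    have hcomm : ∀ (i k : Fin d) (p : MvPolynomial (Fin d) A),
        pderiv i (pderiv k p) = pderiv k (pderiv i p) := by
      intro i k p
      have : ⁅pderiv (R := A) i, pderiv (R := A) k⁆ = 0 := by
        apply MvPolynomial.derivation_ext
        intro j
        classical
        simp [Derivation.commutator_apply, pderiv_X, Pi.single_apply, apply_ite]
      have := DFunLike.congr_fun this p
      rwa [Derivation.commutator_apply, Derivation.zero_apply, sub_eq_zero] at this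
    have hmul : ∀ (I : Ideal (MvPolynomial (Fin d) A))
        (M N : Matrix (Fin m) (Fin m) (MvPolynomial (Fin d) A)),
        (∀ a b, N a b ∈ I) → ∀ a b, (M * N) a b ∈ I := fun I M N h a b => by
      rw [Matrix.mul_apply]
      exact Ideal.sum_mem _ fun c _ => Ideal.mul_mem_left _ _ (h c b)
    have hmul' : ∀ (I : Ideal (MvPolynomial (Fin d) A))
        (M N : Matrix (Fin m) (Fin m) (MvPolynomial (Fin d) A)),
        (∀ a b, M a b ∈ I) → ∀ a b, (M * N) a b ∈ I := fun I M N h a b => by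
      rw [Matrix.mul_apply]
      exact Ideal.sum_mem _ fun c _ => Ideal.mul_mem_right _ _ (h a c)
    set W : Fin d → Matrix (Fin m) (Fin m) (MvPolynomial (Fin d) A) :=
      fun i => G.map (pderiv i) - Θ i * G with hW
    have hWk : ∀ k, G.map (pderiv k) = Θ k * G + W k := fun k => by simp [hW]
    -- The error `W` is closed to lowest order. The antisymmetrized derivative of `W` is the
    -- curvature times `G`, which lies in `(t)^(r-1) ⊆ (t)^n` because `n < r`, plus terms linear in
    -- `W`, which lie in `(t)^n` by induction.
    have hclosed : ∀ i k a b, pderiv k (W i a b) - pderiv i (W k a b) ∈ J ^ n := by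
      intro i k a b
      have h1 : (W i).map (pderiv k) - (W k).map (pderiv i) =
          ((Θ k).map (pderiv i) - (Θ i).map (pderiv k) - (Θ i * Θ k - Θ k * Θ i)) * G +
            (Θ k * W i - Θ i * W k) := by
        have e : ∀ i k, (W i).map (pderiv k) = (G.map (pderiv i)).map (pderiv k) -
            ((Θ i).map (pderiv k) * G + Θ i * (Θ k * G + W k)) := by
          intro i k
          rw [← hWk, ← hmap]
          ext1 a b
          simp [hW]
        rw [e i k, e k i]
        have : (G.map (pderiv i)).map (pderiv k) = (G.map (pderiv k)).map (pderiv i) := by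
          ext1 a b
          exact hcomm _ _ _
        rw [this]
        noncomm_ring
      have h2 := congrFun (congrFun h1 a) b
      simp only [Matrix.sub_apply, Matrix.map_apply] at h2
      rw [h2, Matrix.add_apply]
      refine Ideal.add_mem _ ?_ (Ideal.sub_mem _ (hmul _ _ _ (hG i) a b) (hmul _ _ _ (hG k) a b))
      exact hmul' _ _ _ (fun a b => Ideal.pow_le_pow_right (by omega) (hΘ i k a b)) a b
    have hunit : IsUnit ((n + 1 : ℕ) : A) := isUnit_of_dvd_unit
      (Nat.cast_dvd_cast (Nat.dvd_factorial n.succ_pos hn)) hr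
    choose p hp1 hp2 using fun a b => exists_pderiv_sub_mem hunit (fun i => W i a b)
      (fun i => hG i a b) (fun i k => hclosed i k a b)
    -- The primitive `p` of the error is subtracted. The new term `Θ p` is harmless, as `p` already
    -- has order `n + 1`.
    refine ⟨G - Matrix.of p, fun a b => ?_, fun i a b => ?_⟩
    · have : (G - Matrix.of p - 1) a b = (G - 1) a b - p a b := by
        simp only [Matrix.sub_apply, Matrix.of_apply]
        ring
      rw [this]
      exact Ideal.sub_mem _ (hG1 a b) (Ideal.pow_le_self (by omega) (hp1 a b))
    · have : ((G - Matrix.of p).map (pderiv i) - Θ i * (G - Matrix.of p)) a b =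
          (Θ i * Matrix.of p) a b - (pderiv i (p a b) - W i a b) := by
        rw [mul_sub]
        simp only [Matrix.sub_apply, Matrix.map_apply, Matrix.of_apply, map_sub, hW]
        ring
      rw [this]
      exact Ideal.sub_mem _ (hmul _ _ _ hp1 a b) (hp2 a b i)

end TruncPoly

/-! ### Orders of vanishing, the chain rule for disks, and localization -/

section TruncPolyLocal

open MvPolynomial

variable {d : ℕ} {A B C : Type u} [CommRing A] [CommRing B] [CommRing C]

theorem diskMap_eq_truncMap {r : ℕ} (f : A →+* B) : diskMap d r f = truncMap d (r + 1) f := by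
  refine RingHom.ext fun x => ?_
  obtain ⟨p, rfl⟩ := Ideal.Quotient.mk_surjective x
  rw [diskMap_mk, truncMap_mk]

/-- Over a domain, a root of a polynomial of high order has high order. -/
theorem mem_pow_idealOfVars_of_pow_mem [IsDomain A] {p : MvPolynomial (Fin d) A} {n N e : ℕ}
    (hp : p ^ n ∈ idealOfVars (Fin d) A ^ N) (he : n * e < N) :
    p ∈ idealOfVars (Fin d) A ^ (e + 1) := by
  -- Membership in `(t)^k` is a bound on the order of the associated power series, and over a domain
  -- this order is additive under multiplication.
  have order_iff : ∀ (q : MvPolynomial (Fin d) A) (k : ℕ),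
      q ∈ idealOfVars (Fin d) A ^ k ↔ (k : ℕ∞) ≤ (q : MvPowerSeries (Fin d) A).order := by
    intro q k
    rw [mem_pow_idealOfVars_iff']
    constructor
    · intro h
      refine MvPowerSeries.nat_le_order fun x hx => ?_
      rw [coeff_coe]
      exact h x hx
    · intro h x hx
      rw [← coeff_coe]
      exact MvPowerSeries.coeff_of_lt_order (lt_of_lt_of_le (by exact_mod_cast hx) h)
  have hpow : ∀ k : ℕ, ((p ^ k : MvPolynomial (Fin d) A) : MvPowerSeries (Fin d) A).order =
      k • (p : MvPowerSeries (Fin d) A).order := by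
    intro k
    rw [coe_pow]
    induction k with
    | zero =>
      rw [pow_zero, zero_smul, ← MvPowerSeries.monomial_zero_one,
        MvPowerSeries.order_monomial_of_ne_zero one_ne_zero]
      simp
    | succ k ih => rw [pow_succ, MvPowerSeries.order_mul, ih, succ_nsmul]
  rw [order_iff] at hp ⊢
  rw [hpow] at hp
  by_contra hlt
  rw [not_le] at hlt
  obtain ⟨o, ho⟩ := ENat.ne_top_iff_exists.mp (ne_top_of_lt hlt)
  rw [← ho] at hp hlt
  have h1 : o < e + 1 := by exact_mod_cast hlt
  have h2 : N ≤ n * o := by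
    rw [nsmul_eq_mul] at hp
    exact_mod_cast hp
  have h3 : n * o ≤ n * e := Nat.mul_le_mul_left _ (by omega)
  omega

theorem pderiv_aeval_eq_sum {d' : ℕ} (q : Fin d' → MvPolynomial (Fin d) A) (i : Fin d)
    (x : MvPolynomial (Fin d') A) :
    pderiv i (aeval q x) = ∑ k, aeval q (pderiv k x) * pderiv i (q k) := by
  induction x using MvPolynomial.induction_on with
  | C a => simp
  | add x y hx hy => simp only [map_add, hx, hy, add_mul, Finset.sum_add_distrib]
  | mul_X x l hx =>
    have h1 : ∀ k, aeval q (pderiv k (x * X l)) * pderiv i (q k) =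
        aeval q (pderiv k x) * pderiv i (q k) * q l +
          aeval q x * (aeval q (pderiv k (X l : MvPolynomial (Fin d') A)) * pderiv i (q k)) := by
      intro k
      rw [pderiv_mul, map_add, map_mul, map_mul, aeval_X]
      ring
    have h2 : ∑ k, aeval q (pderiv k (X l : MvPolynomial (Fin d') A)) * pderiv i (q k) =
        pderiv i (q l) := by
      rw [Finset.sum_eq_single l]
      · simp
      · intro k _ hk
        rw [pderiv_X_of_ne hk.symm]
        simp
      · simp
    rw [map_mul, pderiv_mul, hx, aeval_X, Finset.sum_mul, Finset.sum_congr rfl fun k _ => h1 k,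
      Finset.sum_add_distrib, ← Finset.mul_sum, h2]

/-- The chain rule for a morphism of infinitesimal disks over a domain. -/
theorem exists_truncDeriv_diskBaseChange {d r d' r' : ℕ} {R : CommRingCat.{u}} [IsDomain R]
    (φ : DiskRing d' r' R →ₐ[R] DiskRing d r R) (A : Under R) (i : Fin d) :
    ∃ ψ : Fin d' → TruncPoly d' r' A.right →+ TruncPoly d r A.right,
      (∀ k x y, ψ k (truncSucc d' r' A.right x * y) =
        truncSucc d r A.right (diskBaseChange φ A x) * ψ k y) ∧
      ∀ x, truncDeriv r i (diskBaseChange φ A x) = ∑ k, ψ k (truncDeriv r' k x) := by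
  choose p hp using fun k => Ideal.Quotient.mk_surjective (φ (diskVar d' r' R k))
  -- The largest `e` with `(r' + 1) e ≤ r`. Since the image of `t'ₖ` has vanishing `(r' + 1)`-st
  -- power modulo `(t)^(r+1)`, its order exceeds `e`.
  set e := r / (r' + 1)
  have hpe : ∀ k, p k ∈ idealOfVars (Fin d) R ^ (e + 1) := by
    intro k
    refine mem_pow_idealOfVars_of_pow_mem (n := r' + 1) (N := r + 1) ?_ ?_
    · rw [← Ideal.Quotient.eq_zero_iff_mem, map_pow, hp, ← map_pow]
      have h1 : diskVar d' r' R k ^ (r' + 1) ∈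
          (Ideal.span (Set.range (diskVar d' r' R))) ^ (r' + 1) :=
        Ideal.pow_mem_pow (Ideal.subset_span (Set.mem_range_self k)) _
      rw [span_diskVar_pow, Ideal.mem_bot] at h1
      rw [h1, map_zero]
    · exact Nat.lt_succ_of_le (Nat.mul_div_le r (r' + 1))
  let q : Fin d' → MvPolynomial (Fin d) A.right := fun k => map A.hom.hom (p k)
  have hq : ∀ k, q k ∈ idealOfVars (Fin d) A.right ^ (e + 1) := fun k =>
    map_mem_pow_idealOfVars _ (hpe k)
  let Φ : MvPolynomial (Fin d') A.right →ₐ[A.right] MvPolynomial (Fin d) A.right := aeval q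
  have hΦ : ∀ y : MvPolynomial (Fin d') A.right,
      diskBaseChange φ A (Ideal.Quotient.mk _ y) = Ideal.Quotient.mk _ (Φ y) := by
    intro y
    have : (diskBaseChange φ A).comp (Ideal.Quotient.mk _) =
        (Ideal.Quotient.mk (idealOfVars (Fin d) A.right ^ (r + 1))).comp Φ.toRingHom := by
      apply MvPolynomial.ringHom_ext
      · intro a
        have := RingHom.congr_fun (diskBaseChange_const φ A) a
        simpa [Φ] using this
      · intro k
        have h1 : diskBaseChange φ A (diskVar d' r' A.right k) =
          diskMap d r A.hom.hom (φ (diskVar d' r' R k)) := diskLift_var _ _ _ _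
        rw [← hp, diskMap_mk] at h1
        simpa [Φ] using h1
    exact RingHom.congr_fun this y
  have hΦJ : ∀ n, ∀ y ∈ idealOfVars (Fin d') A.right ^ n,
      Φ y ∈ idealOfVars (Fin d) A.right ^ ((e + 1) * n) := by
    intro n y hy
    have h1 : (idealOfVars (Fin d') A.right).map Φ ≤ idealOfVars (Fin d) A.right ^ (e + 1) := by
      unfold idealOfVars
      rw [Ideal.map_span, Ideal.span_le]
      rintro _ ⟨_, ⟨k, rfl⟩, rfl⟩
      simpa [Φ] using hq k
    have h2 := Ideal.mem_map_of_mem Φ hy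
    rw [Ideal.map_pow] at h2
    rw [pow_mul]
    exact Ideal.pow_right_mono h1 n h2
  -- Pullback takes `(t')^r'` into `(t)^((e+1) r')` and `∂ᵢ qₖ` has order at least `e`. The sum `(e
  -- + 1) r' + e = (r' + 1) e + r'` is at least `r`, because the remainder of `r` modulo `r' + 1` is
  -- at most `r'`.
  have hwd : ∀ k, ∀ y ∈ idealOfVars (Fin d') A.right ^ r',
      Φ y * pderiv i (q k) ∈ idealOfVars (Fin d) A.right ^ r := by
    intro k y hy
    have h1 := Ideal.mul_mem_mul (hΦJ r' y hy) (pderiv_mem_pow_idealOfVars i (hq k))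
    rw [← pow_add] at h1
    refine Ideal.pow_le_pow_right ?_ h1
    have h2 := Nat.div_add_mod r (r' + 1)
    have h3 := Nat.mod_lt r (Nat.succ_pos r')
    have h4 : (e + 1) * r' + e = (r' + 1) * e + r' := by ring
    change r ≤ _
    rw [h4]
    change (r' + 1) * e + _ = r at h2
    change r % (r' + 1) < r' + 1 at h3
    omega
  -- The map `ψ k` is `y ↦ Φ y * ∂ᵢ qₖ`, the `k`-th term of the chain rule. The factor `∂ᵢ qₖ` is
  -- included because pullback alone need not be defined between the truncations.
  refine ⟨fun k => QuotientAddGroup.map _ _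
    ((AddMonoidHom.mulRight (pderiv i (q k))).comp Φ.toRingHom.toAddMonoidHom)
    (fun y hy => hwd k y hy), ?_, ?_⟩
  · intro k x y
    obtain ⟨x, rfl⟩ := Ideal.Quotient.mk_surjective x
    obtain ⟨y, rfl⟩ := Ideal.Quotient.mk_surjective y
    rw [truncSucc_mk, ← map_mul, hΦ, truncSucc_mk]
    change Ideal.Quotient.mk (idealOfVars (Fin d) A.right ^ r) (Φ (x * y) * pderiv i (q k)) =
      Ideal.Quotient.mk _ (Φ x) * Ideal.Quotient.mk _ (Φ y * pderiv i (q k))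
    rw [← map_mul, map_mul Φ, mul_assoc]
  · intro x
    obtain ⟨x, rfl⟩ := Ideal.Quotient.mk_surjective x
    rw [hΦ, truncDeriv_mk]
    rw [show Φ x = aeval q x from rfl, pderiv_aeval_eq_sum, map_sum]
    rfl

theorem eq_zero_of_forall_away {s : Set A} (hs : Ideal.span s = ⊤) {a : A}
    (h : ∀ f ∈ s, algebraMap A (Localization.Away f) a = 0) : a = 0 := by
  apply Localization.algebraMap_injective_of_span_eq_top s hs
  ext f
  simpa using h f.1 f.2

theorem truncPoly_ext_of_away {n : ℕ} {s : Set A} (hs : Ideal.span s = ⊤) {x y : TruncPoly d n A}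
    (h : ∀ f ∈ s, truncMap d n (algebraMap A (Localization.Away f)) x =
      truncMap d n (algebraMap A (Localization.Away f)) y) : x = y := by
  obtain ⟨p, rfl⟩ := Ideal.Quotient.mk_surjective x
  obtain ⟨q, rfl⟩ := Ideal.Quotient.mk_surjective y
  rw [Ideal.Quotient.eq, mem_pow_idealOfVars_iff']
  intro m hm
  refine eq_zero_of_forall_away hs fun f hf => ?_
  have h1 := h f hf
  rw [truncMap_mk, truncMap_mk, Ideal.Quotient.eq, mem_pow_idealOfVars_iff', ← map_sub] at h1
  simpa only [coeff_map] using h1 m hm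

theorem diskRing_ext_of_away {r : ℕ} {s : Set A} (hs : Ideal.span s = ⊤) {x y : DiskRing d r A}
    (h : ∀ f ∈ s, diskMap d r (algebraMap A (Localization.Away f)) x =
      diskMap d r (algebraMap A (Localization.Away f)) y) : x = y := by
  refine truncPoly_ext_of_away hs fun f hf => ?_
  rw [← diskMap_eq_truncMap]
  exact h f hf

-- Localization at constants commutes with forming polynomials and with the quotient by the extended
-- ideal, and the ideal `(t)^(r+1)` over `Af` is extended from `A`.
attribute [local instance] MvPolynomial.algebraMvPolynomial in
theorem isLocalization_diskRing (r : ℕ) (f : A) (Af : Type u) [CommRing Af] [Algebra A Af]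
    [IsLocalization.Away f Af] :
    letI := (diskMap d r (algebraMap A Af)).toAlgebra
    IsLocalization.Away (diskConst d r A f) (DiskRing d r Af) := by
  let _ := (diskMap d r (algebraMap A Af)).toAlgebra
  have h := IsLocalization.of_surjective
    (M := (Submonoid.powers f).map (MvPolynomial.C (σ := Fin d)))
    (S := MvPolynomial (Fin d) Af) (S' := DiskRing d r Af)
    (Ideal.Quotient.mk (idealOfVars (Fin d) A ^ (r + 1))) Ideal.Quotient.mk_surjective
    (Ideal.Quotient.mk (idealOfVars (Fin d) Af ^ (r + 1))) Ideal.Quotient.mk_surjective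
    (by
      refine RingHom.ext fun p => ?_
      exact (diskMap_mk (algebraMap A Af) p).symm)
    (by
      rw [Ideal.mk_ker, Ideal.mk_ker]
      exact (map_idealOfVars_pow (algebraMap A Af) (r + 1)).ge)
  rw [Submonoid.map_powers, Submonoid.map_powers] at h
  exact h

end TruncPolyLocal

/-! ### Connections and infinitesimal disks -/

section Contraction

variable {R C : CommRingCat.{u}} {f : R ⟶ C} {M N T : Type u} [AddCommGroup M] [Module C M]
  [AddCommGroup N] [Module C N] [CommRing T] {σ : C →+* T}

/-- The map `θ ⊗ κ : N ⊗ M → T`. -/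
def contract (θ : N →ₛₗ[σ] T) (κ : M →ₛₗ[σ] T) : N ⊗[C] M →+ T :=
  TensorProduct.liftAddHom
    (AddMonoidHom.mk' (fun x => (AddMonoidHom.mulLeft (θ x)).comp κ.toAddMonoidHom) fun x y => by
      ext z
      simp [add_mul])
    fun c x z => by
      simp only [AddMonoidHom.mk'_apply, AddMonoidHom.comp_apply, AddMonoidHom.coe_mulLeft,
        LinearMap.toAddMonoidHom_coe, LinearMap.map_smulₛₗ, smul_eq_mul]
      ring

@[simp]
theorem contract_tmul (θ : N →ₛₗ[σ] T) (κ : M →ₛₗ[σ] T) (x : N) (y : M) :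
    contract θ κ (x ⊗ₜ y) = θ x * κ y :=
  rfl

theorem contract_smul (θ : N →ₛₗ[σ] T) (κ : M →ₛₗ[σ] T) (c : C) (x : N ⊗[C] M) :
    contract θ κ (c • x) = σ c * contract θ κ x := by
  induction x using TensorProduct.induction_on with
  | zero => simp
  | tmul x y =>
    rw [TensorProduct.smul_tmul', contract_tmul, contract_tmul, LinearMap.map_smulₛₗ, smul_eq_mul,
      mul_assoc]
  | add x y hx hy => rw [smul_add, map_add, hx, hy, map_add, mul_add]

variable (M) in
/-- Elements of `Ω ⊗ M` are sums of terms `a db ⊗ e`, with `e` in a set of generators of `M`. -/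
theorem exists_eq_sum_smul_d_tmul {ι : Type*} (v : ι → M) (hv : Submodule.span C (Set.range v) = ⊤)
    (x : CommRingCat.KaehlerDifferential f ⊗[C] M) :
    ∃ (n : ℕ) (a b : Fin n → C) (β : Fin n → ι),
      x = ∑ k, (a k • CommRingCat.KaehlerDifferential.d (f := f) (b k)) ⊗ₜ[C] v (β k) := by
  let s : Set (CommRingCat.KaehlerDifferential f ⊗[C] M) :=
    {x | ∃ (a b : C) (i : ι), x = (a • CommRingCat.KaehlerDifferential.d (f := f) b) ⊗ₜ[C] v i}
  -- Scalars are absorbed into the coefficient `a`, so the additive closure of these terms is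
  -- already a submodule.
  have hsmul : ∀ (c : C), ∀ x ∈ AddSubmonoid.closure s, c • x ∈ AddSubmonoid.closure s := by
    intro c x hx
    induction hx using AddSubmonoid.closure_induction with
    | mem x hx =>
      obtain ⟨a, b, i, rfl⟩ := hx
      exact AddSubmonoid.subset_closure ⟨c * a, b, i, by rw [TensorProduct.smul_tmul', smul_smul]⟩
    | zero => rw [smul_zero]; exact zero_mem _
    | add x y _ _ hx hy => rw [smul_add]; exact add_mem hx hy
  have key : x ∈ AddSubmonoid.closure s := by
    induction x using TensorProduct.induction_on with
    | zero => exact zero_mem _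
    | tmul ω e =>
      have he : e ∈ Submodule.span C (Set.range v) := hv ▸ Submodule.mem_top
      have hω : ω ∈ Submodule.span C
          (Set.range (CommRingCat.KaehlerDifferential.d (f := f))) := by
        let := f.hom.toAlgebra
        exact (KaehlerDifferential.span_range_derivation R C).ge Submodule.mem_top
      induction he using Submodule.span_induction with
      | mem e he =>
        obtain ⟨i, rfl⟩ := he
        induction hω using Submodule.span_induction with
        | mem ω hω =>
          obtain ⟨b, rfl⟩ := hω
          exact AddSubmonoid.subset_closure ⟨1, b, i, by rw [one_smul]⟩
        | zero => rw [TensorProduct.zero_tmul]; exact zero_mem _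
        | add x y _ _ hx hy => rw [TensorProduct.add_tmul]; exact add_mem hx hy
        | smul c x _ hx => rw [← TensorProduct.smul_tmul']; exact hsmul c _ hx
      | zero => rw [TensorProduct.tmul_zero]; exact zero_mem _
      | add x y _ _ hx hy => rw [TensorProduct.tmul_add]; exact add_mem hx hy
      | smul c x _ hx => rw [TensorProduct.tmul_smul]; exact hsmul c _ hx
    | add x y hx hy => exact add_mem hx hy
  obtain ⟨l, hl, hx⟩ := AddSubmonoid.exists_list_of_mem_closure key
  choose a b i h using fun k : Fin l.length => hl l[k] (List.getElem_mem _)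
  refine ⟨l.length, a, b, i, ?_⟩
  rw [← hx, ← Fin.sum_univ_getElem]
  exact Finset.sum_congr rfl fun k _ => h k

end Contraction

/-! ### Horizontal functionals along a disk -/

section Horizontal

variable {R C : CommRingCat.{u}} {f : R ⟶ C} {M : Type u} [AddCommGroup M] [Module C M]
  {d r : ℕ} {A : Type u} [CommRing A]

/-- The contraction of differentials, pulled back along `φ : C → A[t]/(t)ʳ⁺¹`, with `∂ᵢ`. -/
def diskContract (φ : C →+* DiskRing d r A) (hφ : ∀ a i, truncDeriv r i (φ (f.hom a)) = 0)
    (i : Fin d) :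
    CommRingCat.KaehlerDifferential f →ₛₗ[(truncSucc d r A).comp φ] TruncPoly d r A :=
  -- The composite `∂ᵢ ∘ φ` is a derivation over `R` because `φ` sends `R` to elements killed by
  -- every `∂ᵢ`; the universal property of differentials does the rest.
  let D : ((ModuleCat.restrictScalars ((truncSucc d r A).comp φ)).obj
      (ModuleCat.of _ (TruncPoly d r A))).Derivation f :=
    ModuleCat.Derivation.mk (fun c => truncDeriv r i (φ c))
      (fun b c => by rw [map_add]; exact map_add _ _ _)
      (fun b c => by rw [map_mul]; exact truncDeriv_mul _ _ _)
      (fun a => hφ a i)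
  { toFun := D.desc.hom
    map_add' := map_add D.desc.hom
    map_smul' := D.desc.hom.map_smul }

@[simp]
theorem diskContract_d (φ : C →+* DiskRing d r A)
    (hφ : ∀ a i, truncDeriv r i (φ (f.hom a)) = 0) (i : Fin d) (c : C) :
    diskContract φ hφ i (CommRingCat.KaehlerDifferential.d c) = truncDeriv r i (φ c) :=
  ModuleCat.Derivation.desc_d _ _

/-- The map `ℓ : M → A[t]/(t)ʳ⁺¹` is horizontal at `s`, where `∇` is seen as a connection along the
disk `φ : C → A[t]/(t)ʳ⁺¹`. -/
def IsHorizontalAt (nabla : M → CommRingCat.KaehlerDifferential f ⊗[C] M)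
    (φ : C →+* DiskRing d r A) (l : M → DiskRing d r A) (s : M) : Prop :=
  ∀ (n : ℕ) (a b : Fin n → C) (e : Fin n → M),
    nabla s = ∑ k, (a k • CommRingCat.KaehlerDifferential.d (f := f) (b k)) ⊗ₜ[C] e k →
    ∀ i, truncDeriv r i (l s) =
      ∑ k, truncSucc d r A (φ (a k) * l (e k)) * truncDeriv r i (φ (b k))

/-- The truncation of a semilinear map. -/
def truncLinear {φ : C →+* DiskRing d r A} (l : M →ₛₗ[φ] DiskRing d r A) :
    M →ₛₗ[(truncSucc d r A).comp φ] TruncPoly d r A where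
  toFun s := truncSucc d r A (l s)
  map_add' x y := by rw [map_add, map_add]
  map_smul' c x := by
    rw [LinearMap.map_smulₛₗ, smul_eq_mul, map_mul]
    rfl

@[simp]
theorem truncLinear_apply {φ : C →+* DiskRing d r A} (l : M →ₛₗ[φ] DiskRing d r A) (s : M) :
    truncLinear l s = truncSucc d r A (l s) :=
  rfl

/-- The definition quantifies over all presentations of `∇ s` as a sum of terms `a db ⊗ e`. Every
such sum computes the same contraction of `∇ s`, and at least one presentation exists. -/
theorem isHorizontalAt_iff {nabla : M → CommRingCat.KaehlerDifferential f ⊗[C] M}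
    {φ : C →+* DiskRing d r A} (hφ : ∀ a i, truncDeriv r i (φ (f.hom a)) = 0)
    (l : M →ₛₗ[φ] DiskRing d r A) (s : M) :
    IsHorizontalAt nabla φ l s ↔
      ∀ i, truncDeriv r i (l s) = contract (diskContract φ hφ i) (truncLinear l) (nabla s) := by
  have key : ∀ (n : ℕ) (a b : Fin n → C) (e : Fin n → M),
      nabla s = ∑ k, (a k • CommRingCat.KaehlerDifferential.d (f := f) (b k)) ⊗ₜ[C] e k →
      ∀ i, contract (diskContract φ hφ i) (truncLinear l) (nabla s) =
        ∑ k, truncSucc d r A (φ (a k) * l (e k)) * truncDeriv r i (φ (b k)) := by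
    intro n a b e h i
    rw [h, map_sum]
    refine Finset.sum_congr rfl fun k _ => ?_
    rw [contract_tmul, LinearMap.map_smulₛₗ, diskContract_d, truncLinear_apply, map_mul,
      RingHom.comp_apply, smul_eq_mul]
    ring
  constructor
  · intro h i
    obtain ⟨n, a, b, β, hx⟩ := exists_eq_sum_smul_d_tmul M (f := f) (id : M → M)
      (by simp) (nabla s)
    rw [h n a b β hx i, key n a b β hx i]
  · intro h n a b e hx i
    rw [h i, key n a b e hx i]

/-- The failure of `ℓ` to be horizontal is semilinear. -/
def horizontalDefect {nabla : M →+ CommRingCat.KaehlerDifferential f ⊗[C] M}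
    (hn : IsFlatConnection f nabla) {φ : C →+* DiskRing d r A}
    (hφ : ∀ a i, truncDeriv r i (φ (f.hom a)) = 0) (l : M →ₛₗ[φ] DiskRing d r A) (i : Fin d) :
    M →ₛₗ[(truncSucc d r A).comp φ] TruncPoly d r A where
  toFun s := truncDeriv r i (l s) - contract (diskContract φ hφ i) (truncLinear l) (nabla s)
  map_add' x y := by
    simp only [map_add]
    ring
  map_smul' c x := by
    rw [LinearMap.map_smulₛₗ, hn.leibniz, map_add, contract_smul, contract_tmul, diskContract_d,
      smul_eq_mul, truncDeriv_mul, truncLinear_apply, smul_eq_mul, RingHom.comp_apply]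
    ring

theorem isHorizontalAt_iff_defect {nabla : M →+ CommRingCat.KaehlerDifferential f ⊗[C] M}
    (hn : IsFlatConnection f nabla) {φ : C →+* DiskRing d r A}
    (hφ : ∀ a i, truncDeriv r i (φ (f.hom a)) = 0) (l : M →ₛₗ[φ] DiskRing d r A) (s : M) :
    IsHorizontalAt nabla φ l s ↔ ∀ i, horizontalDefect hn hφ l i s = 0 := by
  rw [isHorizontalAt_iff hφ]
  exact forall_congr' fun i => sub_eq_zero.symm

/-- By the Leibniz rule the defect of horizontality is semilinear, so it vanishes as soon as it
vanishes on generators. -/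
theorem isHorizontalAt_of_span {nabla : M →+ CommRingCat.KaehlerDifferential f ⊗[C] M}
    (hn : IsFlatConnection f nabla) {φ : C →+* DiskRing d r A}
    (hφ : ∀ a i, truncDeriv r i (φ (f.hom a)) = 0) (l : M →ₛₗ[φ] DiskRing d r A) {ι : Type*}
    {v : ι → M} (hv : Submodule.span C (Set.range v) = ⊤)
    (h : ∀ a, IsHorizontalAt nabla φ l (v a)) (s : M) : IsHorizontalAt nabla φ l s := by
  rw [isHorizontalAt_iff_defect hn hφ]
  intro i
  have hs : s ∈ Submodule.span C (Set.range v) := hv ▸ Submodule.mem_top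
  induction hs using Submodule.span_induction with
  | mem x hx =>
    obtain ⟨a, rfl⟩ := hx
    exact (isHorizontalAt_iff_defect hn hφ l _).mp (h a) i
  | zero => exact map_zero _
  | add x y _ _ hx hy => rw [map_add, hx, hy, add_zero]
  | smul c x _ hx => rw [LinearMap.map_smulₛₗ, hx, smul_zero]

end Horizontal

/-! ### Curvature and integration of the connection along a disk -/

section Curvature

variable {R C : CommRingCat.{u}} {f : R ⟶ C} {M : Type u} [AddCommGroup M] [Module C M]
  {d : ℕ} {A : Type u} [CommRing A]

/-- A functional on the exterior algebra that evaluates products of two elements by means of two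
semilinear forms. -/
theorem exists_exteriorAlgebra_functional {T N : Type u} [CommRing T] [AddCommGroup N] [Module C N]
    {σ : C →+* T} (θ₁ θ₂ : N →ₛₗ[σ] T) :
    ∃ Ψ : ExteriorAlgebra C N →ₛₗ[σ] T, ∀ x y : N,
      Ψ (ExteriorAlgebra.ι C x * ExteriorAlgebra.ι C y) = θ₁ x * θ₂ y - θ₂ x * θ₁ y := by
  let _ : Module C T := Module.compHom T σ
  have hs : ∀ (c : C) (t : T), c • t = σ c * t := fun _ _ => rfl
  let B : N [⋀^Fin 2]→ₗ[C] T :=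
    { toFun := fun x => θ₁ (x 0) * θ₂ (x 1) - θ₂ (x 0) * θ₁ (x 1)
      map_update_add' := by
        intro _ x i y z
        fin_cases i
        · simp
          ring
        · simp
          ring
      map_update_smul' := by
        intro _ x i c z
        fin_cases i
        · simp [hs]
          ring
        · simp [hs]
          ring
      map_eq_zero_of_eq' := by
        intro x i j hij hne
        have : x 0 = x 1 := by
          fin_cases i <;> fin_cases j <;> simp_all
        rw [this]
        ring }
  -- A functional on the whole exterior algebra is a family of alternating maps, one in each degree;
  -- only degree `2` is given a nonzero one.
  let F : ∀ i : ℕ, N [⋀^Fin i]→ₗ[C] T := fun i => if h : i = 2 then h ▸ B else 0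
  let Ψ : ExteriorAlgebra C N →ₗ[C] T := ExteriorAlgebra.liftAlternating F
  refine ⟨{ toFun := Ψ, map_add' := map_add Ψ, map_smul' := fun c x => map_smul Ψ c x },
    fun x y => ?_⟩
  have h1 : ExteriorAlgebra.ι C x * ExteriorAlgebra.ι C y =
      ExteriorAlgebra.ιMulti C 2 ![x, y] := by
    simp [ExteriorAlgebra.ιMulti_apply]
  change Ψ _ = _
  rw [h1, ExteriorAlgebra.liftAlternating_apply_ιMulti]
  rfl

/-- The curvature identity for the connection matrices along a disk. -/
theorem curvature_identity {n m : ℕ} {nabla : M →+ CommRingCat.KaehlerDifferential f ⊗[C] M}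
    (hn : IsFlatConnection f nabla) {φ : C →+* DiskRing d (n + 1) A}
    (hφ : ∀ a i, truncDeriv (n + 1) i (φ (f.hom a)) = 0)
    (v : Fin m → M) (hv : Submodule.span C (Set.range v) = ⊤) (κ : Fin m → M →ₛₗ[φ] DiskRing d (n + 1) A)
    (hκ : ∀ a b, κ b (v a) = if a = b then 1 else 0) (i k : Fin d) (a c : Fin m) :
    truncDeriv n i (contract (diskContract φ hφ k) (truncLinear (κ c)) (nabla (v a))) -
      truncDeriv n k (contract (diskContract φ hφ i) (truncLinear (κ c)) (nabla (v a))) =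
    truncSucc d n A (∑ b, (contract (diskContract φ hφ i) (truncLinear (κ b)) (nabla (v a)) *
        contract (diskContract φ hφ k) (truncLinear (κ c)) (nabla (v b)) -
      contract (diskContract φ hφ k) (truncLinear (κ b)) (nabla (v a)) *
        contract (diskContract φ hφ i) (truncLinear (κ c)) (nabla (v b)))) := by
  -- Contractions live in `A[t]/(t)^(n+1)` and their derivatives in `A[t]/(t)^n`, so the two sides
  -- are compared after this second truncation.
  set τ := truncSucc d n A
  set σ := (truncSucc d (n + 1) A).comp φ
  let θ : Fin d → CommRingCat.KaehlerDifferential f →ₛₗ[τ.comp σ] TruncPoly d n A := fun i =>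
    { toFun := fun x => τ (diskContract φ hφ i x)
      map_add' := fun x y => by rw [map_add, map_add]
      map_smul' := fun c x => by
        rw [LinearMap.map_smulₛₗ, smul_eq_mul, map_mul]
        rfl }
  let κ' : Fin m → M →ₛₗ[τ.comp σ] TruncPoly d n A := fun c =>
    { toFun := fun x => τ (truncLinear (κ c) x)
      map_add' := fun x y => by rw [map_add, map_add]
      map_smul' := fun c x => by
        rw [LinearMap.map_smulₛₗ, smul_eq_mul, map_mul]
        rfl }
  have hκ' : ∀ a b, κ' b (v a) = if a = b then 1 else 0 := by
    intro a b
    change τ (truncSucc d (n + 1) A (κ b (v a))) = _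
    rw [hκ]
    split_ifs <;> simp
  have hτ : ∀ i c x, τ (contract (diskContract φ hφ i) (truncLinear (κ c)) x) =
      contract (θ i) (κ' c) x := by
    intro i c x
    induction x using TensorProduct.induction_on with
    | zero => simp
    | tmul x y =>
      rw [contract_tmul, contract_tmul, map_mul]
      rfl
    | add x y hx hy => simp only [map_add, hx, hy]
  -- Taking members of the frame as second factors makes `κ c` evaluate to a Kronecker delta on
  -- every term.
  obtain ⟨N, x, y, β, hx⟩ := exists_eq_sum_smul_d_tmul M v hv (nabla (v a))
  obtain ⟨Ψ, hΨ⟩ := exists_exteriorAlgebra_functional (θ i) (θ k)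
  have hflat := congrArg (contract Ψ (κ' c)) (hn.flat (v a) N x y (fun l => v (β l)) hx)
  rw [map_sub, map_zero, sub_eq_zero, map_sum, map_sum] at hflat
  have hθd : ∀ j z, θ j (CommRingCat.KaehlerDifferential.d z) =
      truncDeriv n j (truncSucc d (n + 1) A (φ z)) := by
    intro j z
    change τ (diskContract φ hφ j _) = _
    rw [diskContract_d, truncSucc_truncDeriv]
  -- the left-hand side
  have hL : ∀ p q : Fin d,
      truncDeriv n p (contract (diskContract φ hφ q) (truncLinear (κ c)) (nabla (v a))) =
      ∑ l, (if β l = c then (1 : TruncPoly d n A) else 0) *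
        (θ p (CommRingCat.KaehlerDifferential.d (x l)) *
          θ q (CommRingCat.KaehlerDifferential.d (y l)) +
        τ (σ (x l)) * truncDeriv n p (truncDeriv (n + 1) q (φ (y l)))) := by
    intro p q
    rw [hx, map_sum, map_sum]
    refine Finset.sum_congr rfl fun l _ => ?_
    rw [contract_tmul, LinearMap.map_smulₛₗ, diskContract_d, truncLinear_apply, hκ, smul_eq_mul]
    split_ifs with h
    · rw [map_one, mul_one, one_mul, truncDeriv_mul, hθd p, hθd q, truncSucc_truncDeriv]
      simp only [τ, σ, RingHom.comp_apply]
      ring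
    · simp
  have hL' : ∀ l, contract Ψ (κ' c) ((ExteriorAlgebra.ι C
      (CommRingCat.KaehlerDifferential.d (f := f) (x l)) * ExteriorAlgebra.ι C
      (CommRingCat.KaehlerDifferential.d (f := f) (y l))) ⊗ₜ[C] v (β l)) =
      (if β l = c then (1 : TruncPoly d n A) else 0) *
        (θ i (CommRingCat.KaehlerDifferential.d (x l)) *
          θ k (CommRingCat.KaehlerDifferential.d (y l)) -
        θ k (CommRingCat.KaehlerDifferential.d (x l)) *
          θ i (CommRingCat.KaehlerDifferential.d (y l))) := by
    intro l
    rw [contract_tmul, hΨ, hκ', mul_comm]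
  have hR : ∀ (ω : CommRingCat.KaehlerDifferential f)
      (t : CommRingCat.KaehlerDifferential f ⊗[C] M),
      contract Ψ (κ' c) (LinearMap.rTensor M (LinearMap.mulLeft C (ExteriorAlgebra.ι C ω) ∘ₗ
        ExteriorAlgebra.ι C (M := CommRingCat.KaehlerDifferential f)) t) =
      θ i ω * contract (θ k) (κ' c) t - θ k ω * contract (θ i) (κ' c) t := by
    intro ω t
    induction t using TensorProduct.induction_on with
    | zero => simp
    | tmul x y =>
      rw [LinearMap.rTensor_tmul, contract_tmul, contract_tmul, contract_tmul, LinearMap.comp_apply,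
        LinearMap.mulLeft_apply, hΨ]
      ring
    | add x y hx hy =>
      simp only [map_add, hx, hy]
      ring
  have hθx : ∀ j b, contract (θ j) (κ' b) (nabla (v a)) =
      ∑ l, θ j (x l • CommRingCat.KaehlerDifferential.d (y l)) * if β l = b then 1 else 0 := by
    intro j b
    rw [hx, map_sum]
    refine Finset.sum_congr rfl fun l _ => ?_
    rw [contract_tmul, hκ']
  rw [hL i k, hL k i, ← Finset.sum_sub_distrib]
  simp only [map_sum, map_sub, map_mul, hτ, hθx _ _]
  rw [Finset.sum_congr rfl fun l _ => hL' l, Finset.sum_congr rfl fun l _ => hR _ _] at hflat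
  trans ∑ l, (if β l = c then (1 : TruncPoly d n A) else 0) *
        (θ i (CommRingCat.KaehlerDifferential.d (x l)) *
          θ k (CommRingCat.KaehlerDifferential.d (y l)) -
        θ k (CommRingCat.KaehlerDifferential.d (x l)) *
          θ i (CommRingCat.KaehlerDifferential.d (y l)))
  · refine Finset.sum_congr rfl fun l _ => ?_
    rw [truncDeriv_comm i k]
    ring
  rw [hflat]
  simp only [Finset.sum_mul, ← Finset.sum_sub_distrib]
  -- The matrix product sums over all members of the frame, but the `l`-th term of `∇ (v a)`
  -- involves only `v (β l)`.
  rw [Finset.sum_comm]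
  refine Finset.sum_congr rfl fun l _ => ?_
  rw [Finset.sum_eq_single (β l)]
  · simp
  · intro b _ hb
    rw [if_neg hb.symm]
    simp
  · simp

/-- Local existence of flat frames along infinitesimal disks. -/
theorem exists_horizontal_matrix {r m : ℕ} (hr : IsUnit ((r.factorial : ℕ) : A))
    {nabla : M →+ CommRingCat.KaehlerDifferential f ⊗[C] M}
    (hn : IsFlatConnection f nabla) {φ : C →+* DiskRing d r A}
    (hφ : ∀ a i, truncDeriv r i (φ (f.hom a)) = 0)
    (v : Module.Basis (Fin m) C M) :
    ∃ G : Matrix (Fin m) (Fin m) (DiskRing d r A), IsUnit G ∧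
      ∀ (c : Fin m) (l : M →ₛₗ[φ] DiskRing d r A), (∀ a, l (v a) = G a c) →
        ∀ a, IsHorizontalAt nabla φ l (v a) := by
  let κ : Fin m → M →ₛₗ[φ] DiskRing d r A := fun b =>
    { toFun := fun s => φ (v.repr s b)
      map_add' := fun x y => by simp
      map_smul' := fun c x => by simp }
  have hκ : ∀ a b, κ b (v a) = if a = b then 1 else 0 := by
    intro a b
    change φ (v.repr (v a) b) = _
    rw [v.repr_self, Finsupp.single_apply]
    split_ifs <;> simp
  let Θ : Fin d → Matrix (Fin m) (Fin m) (TruncPoly d r A) := fun i => Matrix.of fun a b =>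
    contract (diskContract φ hφ i) (truncLinear (κ b)) (nabla (v a))
  choose Θ' hΘ' using fun i a b => Ideal.Quotient.mk_surjective (Θ i a b)
  obtain ⟨G, hG1, hG⟩ := exists_flat_matrix_polynomial hr (fun i => Matrix.of (Θ' i)) (by
    intro i k a b
    -- For `r = 0` the required congruence is modulo `(t)^0`, hence empty. The curvature identity is
    -- needed only for `r = n + 1`.
    cases r with
    | zero => simp
    | succ n =>
      change _ ∈ MvPolynomial.idealOfVars (Fin d) A ^ n
      rw [← Ideal.Quotient.eq_zero_iff_mem]
      have h := curvature_identity hn hφ v v.span_eq κ hκ i k a b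
      have e : ∀ i a b, contract (diskContract φ hφ i) (truncLinear (κ b)) (nabla (v a)) =
        Ideal.Quotient.mk _ (Θ' i a b) := fun i a b => (hΘ' i a b).symm
      simp only [e] at h
      simp only [truncDeriv_mk, ← map_mul, ← map_sub, ← map_sum, truncSucc_mk] at h
      rw [← sub_eq_zero, ← map_sub] at h
      convert h using 2
      simp [Matrix.mul_apply]) r le_rfl
  refine ⟨G.map (Ideal.Quotient.mk _), ?_, ?_⟩
  · have h0 : IsUnit ((G.map (Ideal.Quotient.mk
        (MvPolynomial.idealOfVars (Fin d) A ^ (r + 1)))).det) := by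
      rw [← RingHom.mapMatrix_apply, ← RingHom.map_det]
      have h1 : G.det - 1 ∈ MvPolynomial.idealOfVars (Fin d) A := by
        rw [← Ideal.Quotient.eq, RingHom.map_det]
        have : (Ideal.Quotient.mk (MvPolynomial.idealOfVars (Fin d) A)).mapMatrix G = 1 := by
          ext1 a b
          have := Ideal.Quotient.eq.mpr (hG1 a b)
          rw [RingHom.mapMatrix_apply, Matrix.map_apply, this]
          by_cases hab : a = b
          · subst hab
            exact (congrArg _ (Matrix.one_apply_eq a)).trans
              ((map_one _).trans (Matrix.one_apply_eq a).symm)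
          · exact (congrArg _ (Matrix.one_apply_ne hab)).trans
              ((map_zero _).trans (Matrix.one_apply_ne hab).symm)
        rw [this, Matrix.det_one, map_one]
      have h2 : IsNilpotent (Ideal.Quotient.mk (MvPolynomial.idealOfVars (Fin d) A ^ (r + 1))
          (G.det - 1)) := by
        refine ⟨r + 1, ?_⟩
        rw [← map_pow, Ideal.Quotient.eq_zero_iff_mem]
        exact Ideal.pow_mem_pow h1 _
      have h3 := h2.isUnit_add_one
      rwa [map_sub, map_one, sub_add_cancel] at h3
    exact (Matrix.isUnit_iff_isUnit_det _).mpr h0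
  · intro c l hl a
    rw [isHorizontalAt_iff hφ]
    intro i
    -- Expanding `l` in the dual frame `κ` turns horizontality at `v a` into row `a` of the system
    -- `∂ᵢ G = Θᵢ G`.
    have hκl : ∀ x, contract (diskContract φ hφ i) (truncLinear l) x =
        ∑ b, contract (diskContract φ hφ i) (truncLinear (κ b)) x *
          truncSucc d r A (l (v b)) := by
      intro x
      induction x using TensorProduct.induction_on with
      | zero => simp
      | tmul x y =>
        simp only [contract_tmul, truncLinear_apply, mul_assoc, ← map_mul]
        rw [← Finset.mul_sum, ← map_sum]
        congr 2
        conv_lhs => rw [← v.sum_repr y]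
        simp only [map_sum, LinearMap.map_smulₛₗ, smul_eq_mul]
        rfl
      | add x y hx hy => simp only [map_add, hx, hy, add_mul, Finset.sum_add_distrib]
    rw [hκl, hl]
    have h1 := Ideal.Quotient.eq.mpr (hG i a c)
    simp only [Matrix.map_apply, hl] at h1 ⊢
    rw [truncDeriv_mk, h1, Matrix.mul_apply, map_sum]
    refine Finset.sum_congr rfl fun b _ => ?_
    rw [map_mul, Matrix.of_apply, hΘ', truncSucc_mk]
    rfl

end Curvature

/-! ### Evaluation of sections at ring-valued points -/

section EvalAt

open Opposite TopologicalSpace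

variable {X Y : Scheme.{u}} {T T' : CommRingCat.{u}}

/-- The value of sections over `U` at a `T`-valued point that factors through `U`. -/
def evalAt (q : Spec T ⟶ X) (U : X.Opens) (h : ⊤ ≤ q ⁻¹ᵁ U) : Γ(X, U) →+* T :=
  (q.appLE U ⊤ h ≫ (Scheme.ΓSpecIso T).hom).hom

theorem evalAt_appLE (q : Spec T ⟶ X) (g : X ⟶ Y) {U : Y.Opens} {V : X.Opens} (h : ⊤ ≤ q ⁻¹ᵁ V)
    (e : V ≤ g ⁻¹ᵁ U) (x : Γ(Y, U)) :
    evalAt q V h (g.appLE U V e x) =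
      evalAt (q ≫ g) U (h.trans fun _ hx => e hx) x := by
  have : g.appLE U V e ≫ q.appLE V ⊤ h = (q ≫ g).appLE U ⊤ (h.trans fun _ hx => e hx) :=
    Scheme.Hom.appLE_comp_appLE _ _ _ _ _ _ _
  simp only [evalAt, ← this]
  rfl

theorem evalAt_app (q : Spec T ⟶ X) (g : X ⟶ Y) {U : Y.Opens} (h : ⊤ ≤ q ⁻¹ᵁ g ⁻¹ᵁ U)
    (x : Γ(Y, U)) : evalAt q (g ⁻¹ᵁ U) h (g.app U x) = evalAt (q ≫ g) U h x := by
  rw [Scheme.Hom.app_eq_appLE, evalAt_appLE]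

theorem evalAt_map (q : Spec T ⟶ X) {U V : X.Opens} (i : V ≤ U) (h : ⊤ ≤ q ⁻¹ᵁ V) (x : Γ(X, U)) :
    evalAt q V h (X.presheaf.map (homOfLE i).op x) =
      evalAt q U (h.trans fun _ hx => i hx) x := by
  simp only [evalAt, ← Scheme.Hom.map_appLE q h (homOfLE i).op]
  rfl

theorem evalAt_SpecMap (t : T ⟶ T') (q : Spec T ⟶ X) {U : X.Opens} (h : ⊤ ≤ q ⁻¹ᵁ U)
    (h' : ⊤ ≤ (Spec.map t ≫ q) ⁻¹ᵁ U) (x : Γ(X, U)) :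
    evalAt (Spec.map t ≫ q) U h' x = t.hom (evalAt q U h x) := by
  have h1 : q.appLE U ⊤ h ≫ (Spec.map t).appLE ⊤ ⊤ le_rfl = (Spec.map t ≫ q).appLE U ⊤ h' :=
    Scheme.Hom.appLE_comp_appLE _ _ _ _ _ _ _
  have h2 : (Spec.map t).appLE ⊤ ⊤ le_rfl ≫ (Scheme.ΓSpecIso T').hom =
      (Scheme.ΓSpecIso T).hom ≫ t := by
    have : (Spec.map t).appLE ⊤ ⊤ le_rfl = (Spec.map t).appTop := Scheme.Hom.appLE_eq_app _
    rw [this]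
    exact Scheme.ΓSpecIso_naturality t
  change _ = ((q.appLE U ⊤ h ≫ (Scheme.ΓSpecIso T).hom) ≫ t).hom x
  rw [Category.assoc, ← h2, ← Category.assoc, h1]
  rfl

theorem evalAt_congr {q q' : Spec T ⟶ X} (hq : q = q') {U : X.Opens} (h : ⊤ ≤ q ⁻¹ᵁ U)
    (h' : ⊤ ≤ q' ⁻¹ᵁ U) (x : Γ(X, U)) : evalAt q U h x = evalAt q' U h' x := by
  subst hq
  rfl

theorem evalAt_fromSpec {U : X.Opens} (hU : IsAffineOpen U) (t : Γ(X, U) ⟶ T)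
    (h : ⊤ ≤ (Spec.map t ≫ hU.fromSpec) ⁻¹ᵁ U) (x : Γ(X, U)) :
    evalAt (Spec.map t ≫ hU.fromSpec) U h x = t.hom x := by
  have h1 : ⊤ ≤ hU.fromSpec ⁻¹ᵁ U := by rw [hU.fromSpec_preimage_self]
  rw [evalAt_SpecMap t hU.fromSpec h1]
  congr 1
  have : hU.fromSpec.appLE U ⊤ h1 ≫ (Scheme.ΓSpecIso _).hom = 𝟙 _ := by
    rw [Scheme.Hom.appLE, hU.fromSpec_app_self, Category.assoc, Category.assoc,
      ← Functor.map_comp_assoc]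
    have h2 : ∀ i : Opposite.op (⊤ : (Spec Γ(X, U)).Opens) ⟶ Opposite.op ⊤,
        (Spec Γ(X, U)).presheaf.map i = 𝟙 _ := fun i => by
      rw [Subsingleton.elim i (𝟙 _), CategoryTheory.Functor.map_id]
    rw [h2, Category.id_comp, Iso.inv_hom_id]
  exact congrArg (fun g => g.hom x) this

/-- A section is a unit exactly where its basic open is everything, and basic opens are compatible
with pullback to the members of the cover. -/
theorem isUnit_of_app_isUnit (𝒰 : X.OpenCover) {W : X.Opens} (x : Γ(X, W))
    (h : ∀ i, IsUnit ((𝒰.f i).app W x)) : IsUnit x := by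
  have hW : X.basicOpen x = W := by
    refine le_antisymm (X.basicOpen_le x) fun p hp => ?_
    obtain ⟨p', hp'⟩ := 𝒰.covers p
    have h1 : p' ∈ (𝒰.f _) ⁻¹ᵁ (X.basicOpen x) := by
      rw [Scheme.preimage_basicOpen, Scheme.basicOpen_of_isUnit _ (h _)]
      change 𝒰.f _ p' ∈ W
      rwa [hp']
    change 𝒰.f _ p' ∈ X.basicOpen x at h1
    rwa [hp'] at h1
  have h1 := X.toRingedSpace.isUnit_res_basicOpen x
  have h2 : ∀ (V : X.Opens) (i : V ⟶ W), V = W → IsUnit (X.presheaf.map i.op x) → IsUnit x := by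
    rintro V i rfl hi
    have : i = 𝟙 _ := Subsingleton.elim _ _
    rw [this, op_id, X.presheaf.map_id] at hi
    exact hi
  exact h2 _ _ hW h1

theorem exists_glue_sections (𝒰 : X.OpenCover) (W : X.Opens)
    (y : ∀ i, Γ(𝒰.X i, (𝒰.f i) ⁻¹ᵁ W))
    (hy : ∀ i j, X.presheaf.map (homOfLE (inf_le_left :
        ((𝒰.f i).opensRange ⊓ W) ⊓ ((𝒰.f j).opensRange ⊓ W) ≤ _)).op
          ((IsOpenImmersion.ΓIso (𝒰.f i) W).hom (y i)) =
      X.presheaf.map (homOfLE (inf_le_right :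
        ((𝒰.f i).opensRange ⊓ W) ⊓ ((𝒰.f j).opensRange ⊓ W) ≤ _)).op
          ((IsOpenImmersion.ΓIso (𝒰.f j) W).hom (y j))) :
    ∃ z : Γ(X, W), ∀ i, (𝒰.f i).app W z = y i := by
  obtain ⟨z, hz, -⟩ := TopCat.Sheaf.existsUnique_gluing' X.sheaf
    (fun i => (𝒰.f i).opensRange ⊓ W) W (fun _ => homOfLE inf_le_right) (by
      intro x hx
      simp only [Opens.iSup_mk, Opens.carrier_eq_coe, Opens.coe_inf, Scheme.Hom.coe_opensRange,
        Opens.mem_mk, Set.mem_iUnion, Set.mem_inter_iff, Set.mem_range, SetLike.mem_coe]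
      exact ⟨𝒰.idx x, 𝒰.covers x, hx⟩)
    (fun i => (IsOpenImmersion.ΓIso (𝒰.f i) W).hom (y i)) hy
  refine ⟨z, fun i => ?_⟩
  rw [← IsOpenImmersion.map_ΓIso_inv]
  exact (congrArg (IsOpenImmersion.ΓIso (𝒰.f i) W).inv (hz i)).trans
    (ConcreteCategory.congr_hom (IsOpenImmersion.ΓIso (𝒰.f i) W).hom_inv_id (y i))

theorem evalAt_ΓIso_hom {Z : Scheme.{u}} (f : Z ⟶ X) [IsOpenImmersion f] (W : X.Opens)
    (q : Spec T ⟶ Z) (h : ⊤ ≤ (q ≫ f) ⁻¹ᵁ (f.opensRange ⊓ W)) (h' : ⊤ ≤ q ⁻¹ᵁ f ⁻¹ᵁ W)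
    (y : Γ(Z, f ⁻¹ᵁ W)) :
    evalAt (q ≫ f) _ h ((IsOpenImmersion.ΓIso f W).hom y) = evalAt q _ h' y := by
  have h1 : y = (IsOpenImmersion.ΓIso f W).inv ((IsOpenImmersion.ΓIso f W).hom y) :=
    (ConcreteCategory.congr_hom (IsOpenImmersion.ΓIso f W).hom_inv_id y).symm
  conv_rhs => rw [h1]
  rw [IsOpenImmersion.ΓIso_inv, evalAt_appLE]

end EvalAt

/-! ### Disks over affine schemes -/

section DiskSpec

open Limits

variable (d r : ℕ) {A B C : Type u} [CommRing A] [CommRing B] [CommRing C]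

/-- The disk `𝔻^d_{r, A}`. -/
abbrev diskSpec (A : Type u) [CommRing A] : Scheme.{u} := Spec (.of (DiskRing d r A))

/-- The map `𝔻^d_{r, B} ⟶ 𝔻^d_{r, A}` induced by `A → B`. -/
def diskSpecMap (u : A →+* B) : diskSpec d r B ⟶ diskSpec d r A :=
  Spec.map (CommRingCat.ofHom (diskMap d r u))

theorem diskSpecMap_comp (u : A →+* B) (v : B →+* C) :
    diskSpecMap d r (v.comp u) = diskSpecMap d r v ≫ diskSpecMap d r u := by
  rw [diskSpecMap, diskMap_comp, CommRingCat.ofHom_comp, Spec.map_comp]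
  rfl

theorem diskSpecMap_id : diskSpecMap d r (RingHom.id A) = 𝟙 _ := by
  rw [diskSpecMap, diskMap_id, CommRingCat.ofHom_id, Spec.map_id]

instance isOpenImmersion_diskSpecMap (f : A) :
    IsOpenImmersion (diskSpecMap d r (algebraMap A (Localization.Away f))) := by
  let _ := (diskMap d r (algebraMap A (Localization.Away f))).toAlgebra
  have := isLocalization_diskRing (d := d) r f (Localization.Away f)
  exact IsOpenImmersion.of_isLocalization (R := DiskRing d r A)
    (S := DiskRing d r (Localization.Away f)) (diskConst d r A f)

variable {d r} in
theorem mem_opensRange_diskSpecMap (f : A) (p : diskSpec d r A) :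
    p ∈ (diskSpecMap d r (algebraMap A (Localization.Away f))).opensRange ↔
      diskConst d r A f ∉ p.asIdeal := by
  let _ := (diskMap d r (algebraMap A (Localization.Away f))).toAlgebra
  have := isLocalization_diskRing (d := d) r f (Localization.Away f)
  have := PrimeSpectrum.localization_away_comap_range
    (DiskRing d r (Localization.Away f)) (diskConst d r A f)
  exact (eq_iff_iff.mp congr(p ∈ $this))

/-- The cover of a disk defined by a cover of the base by basic open subsets. -/
def diskCover (s : Set A) (hs : Ideal.span s = ⊤) : (diskSpec d r A).OpenCover :=
  Scheme.AffineOpenCover.openCover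
  { I₀ := s
    X := fun f => .of (DiskRing d r (Localization.Away f.1))
    f := fun f => diskSpecMap d r (algebraMap A (Localization.Away f.1))
    idx := fun x => by
      have : ∃ f : s, diskConst d r A f.1 ∉ x.asIdeal := by
        by_contra! h
        have h1 : Ideal.span s ≤ x.asIdeal.comap (diskConst d r A) :=
          Ideal.span_le.mpr fun f hf => h ⟨f, hf⟩
        rw [hs, top_le_iff] at h1
        have := x.2
        exact (Ideal.IsPrime.comap (diskConst d r A) (K := x.asIdeal)).ne_top h1
      exact this.choose
    covers := fun x => by
      generalize_proofs _ H
      exact (mem_opensRange_diskSpecMap H.choose.1 x).mpr H.choose_spec }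

theorem isNilpotent_of_diskEval_eq_zero {x : DiskRing d r A} (hx : diskEval d r A x = 0) :
    IsNilpotent x := by
  refine ⟨r + 1, ?_⟩
  have := Ideal.pow_mem_pow (mem_span_diskVar d r hx) (r + 1)
  rwa [span_diskVar_pow, Ideal.mem_bot] at this

variable {d r} in
/-- The images of basic open subsets of `Spec A` form a basis of the topology of a disk. -/
theorem exists_diskSpecMap_opensRange_le {W : (diskSpec d r A).Opens} {p : diskSpec d r A}
    (hp : p ∈ W) : ∃ f : A, diskConst d r A f ∉ p.asIdeal ∧
      (diskSpecMap d r (algebraMap A (Localization.Away f))).opensRange ≤ W := by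
  obtain ⟨_, ⟨_, ⟨e, rfl⟩, rfl⟩, hpe, heW⟩ :=
    (PrimeSpectrum.isBasis_basic_opens (R := DiskRing d r A)).exists_subset_of_mem_open hp W.2
  -- An element of the disk ring differs from its constant term by a nilpotent element, so the two
  -- lie in the same prime ideals.
  have hmem : ∀ q : diskSpec d r A, diskConst d r A (diskEval d r A e) ∈ q.asIdeal ↔
      e ∈ q.asIdeal := by
    intro q
    have h1 : e - diskConst d r A (diskEval d r A e) ∈ q.asIdeal := by
      obtain ⟨n, hn⟩ := isNilpotent_of_diskEval_eq_zero d r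
        (x := e - diskConst d r A (diskEval d r A e)) (by
          rw [map_sub, diskEval_diskConst, sub_self])
      exact q.2.mem_of_pow_mem n (hn ▸ Ideal.zero_mem _)
    exact ⟨fun h => by simpa using Ideal.add_mem _ h1 h, fun h => by
      simpa using Ideal.sub_mem _ h h1⟩
  refine ⟨diskEval d r A e, fun h => hpe ((hmem p).mp h), fun q hq => heW ?_⟩
  rw [mem_opensRange_diskSpecMap, hmem] at hq
  exact hq

variable {d r} in
theorem top_le_preimage_of_opensRange_le {X Y : Scheme.{u}} (q : X ⟶ Y) [IsOpenImmersion q]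
    {W : Y.Opens} (h : q.opensRange ≤ W) : ⊤ ≤ q ⁻¹ᵁ W :=
  fun x _ => h ⟨x, rfl⟩

-- If these elements lay in a maximal ideal `𝔪`, the point of the disk over `𝔪` would belong to some
-- `W i`, and hence to a neighbourhood inside `W i` that comes from a basic open of `Spec A`; its
-- equation is then outside `𝔪` although it is one of the elements. This turns open covers of a disk
-- into covers of its base.
variable {d r} in
theorem span_eq_top_of_iSup_opens {ι : Type*} (W : ι → (diskSpec d r A).Opens)
    (hW : ∀ p, ∃ i, p ∈ W i) :
    Ideal.span {f : A | ∃ i, ⊤ ≤ diskSpecMap d r (algebraMap A (Localization.Away f)) ⁻¹ᵁ W i} =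
      ⊤ := by
  by_contra hne
  obtain ⟨𝔪, h𝔪, hle⟩ := Ideal.exists_le_maximal _ hne
  let p : diskSpec d r A := ⟨𝔪.comap (diskEval d r A), Ideal.IsPrime.comap _⟩
  obtain ⟨i, hi⟩ := hW p
  obtain ⟨f, hf, hfW⟩ := exists_diskSpecMap_opensRange_le hi
  refine hf ?_
  change diskEval d r A _ ∈ 𝔪
  rw [diskEval_diskConst]
  exact hle (Ideal.subset_span ⟨i, top_le_preimage_of_opensRange_le _ hfW⟩)

/-- If `u f` lay in a maximal ideal of `B`, the corresponding point of the disk over `B` would map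
outside the disk over the localization. -/
theorem isUnit_of_top_le_preimage (u : A →+* B) (f : A) (h : ⊤ ≤ diskSpecMap d r u ⁻¹ᵁ
    (diskSpecMap d r (algebraMap A (Localization.Away f))).opensRange) : IsUnit (u f) := by
  by_contra hne
  obtain ⟨𝔪, h𝔪, hle⟩ := exists_max_ideal_of_mem_nonunits hne
  let p : diskSpec d r B := ⟨𝔪.comap (diskEval d r B), Ideal.IsPrime.comap _⟩
  have h1 : diskSpecMap d r u p ∈
    (diskSpecMap d r (algebraMap A (Localization.Away f))).opensRange := h (Set.mem_univ p)
  rw [mem_opensRange_diskSpecMap] at h1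
  refine h1 ?_
  change diskEval d r B (diskMap d r u (diskConst d r A f)) ∈ 𝔪
  rw [← RingHom.comp_apply (diskMap d r u), diskMap_const, RingHom.comp_apply, diskEval_diskConst]
  exact hle

variable {d r} in
/-- Sections on a disk are determined by their values on the disks over open subsets. -/
theorem section_ext {W : (diskSpec d r A).Opens} {x y : Γ(diskSpec d r A, W)}
    (h : ∀ (B : CommRingCat.{u}) (u : A →+* B) (hu : ⊤ ≤ diskSpecMap d r u ⁻¹ᵁ W),
      evalAt (diskSpecMap d r u) W hu x = evalAt (diskSpecMap d r u) W hu y) : x = y := by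
  choose f hf hfW using fun p : W => exists_diskSpecMap_opensRange_le p.2
  let q := fun p : W => diskSpecMap d r (algebraMap A (Localization.Away (f p)))
  refine TopCat.Sheaf.eq_of_locally_eq' (diskSpec d r A).sheaf (fun p => (q p).opensRange) W
    (fun p => homOfLE (hfW p)) (fun p hp => ?_) x y fun p => ?_
  · simp only [TopologicalSpace.Opens.mem_iSup]
    exact ⟨⟨p, hp⟩, (mem_opensRange_diskSpecMap _ _).mpr (hf ⟨p, hp⟩)⟩
  · have h1 := h (.of (Localization.Away (f p))) (algebraMap A (Localization.Away (f p)))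
      (top_le_preimage_of_opensRange_le _ (hfW p))
    have h2 : ⊤ ≤ q p ⁻¹ᵁ (q p).opensRange := top_le_preimage_of_opensRange_le _ le_rfl
    -- The disk over the localization is an open subscheme, and evaluation identifies the sections
    -- over its image with its ring of functions.
    have h3 : Function.Injective (evalAt (q p) (q p).opensRange h2) := by
      have : IsIso ((q p).app (q p).opensRange) := (q p).isIso_app _ le_rfl
      have : IsIso ((q p).appLE (q p).opensRange ⊤ h2) := by
        rw [Scheme.Hom.appLE]
        have : (homOfLE h2) = eqToHom (q p).preimage_opensRange.symm := Subsingleton.elim _ _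
        rw [this]
        infer_instance
      exact ((ConcreteCategory.bijective_of_isIso
        ((q p).appLE (q p).opensRange ⊤ h2 ≫ (Scheme.ΓSpecIso _).hom))).1
    apply h3
    refine (evalAt_map _ (hfW p) h2 x).trans (h1.trans (evalAt_map _ (hfW p) h2 y).symm)

-- The descent condition is stated for pairs of homomorphisms to an arbitrary test ring `B`, as in
-- `IsZariskiSheaf`. It gives equality on overlaps because sections there are detected by such
-- points, and a point of the overlap factors through both localizations.
variable {d r} in
theorem exists_glue_disk_sections {s : Set A} (hs : Ideal.span s = ⊤) (W : (diskSpec d r A).Opens)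
    (y : ∀ f : s, Γ(diskSpec d r (Localization.Away f.1),
      diskSpecMap d r (algebraMap A (Localization.Away f.1)) ⁻¹ᵁ W))
    (hy : ∀ (f g : s) (B : CommRingCat.{u}) (a : Localization.Away f.1 →+* B)
      (b : Localization.Away g.1 →+* B), a.comp (algebraMap A _) = b.comp (algebraMap A _) →
      ∀ (h : ⊤ ≤ diskSpecMap d r a ⁻¹ᵁ (diskSpecMap d r (algebraMap A (Localization.Away f.1)) ⁻¹ᵁ W))
        (h' : ⊤ ≤ diskSpecMap d r b ⁻¹ᵁ (diskSpecMap d r (algebraMap A (Localization.Away g.1)) ⁻¹ᵁ W)),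
      evalAt (diskSpecMap d r a) _ h (y f) = evalAt (diskSpecMap d r b) _ h' (y g)) :
    ∃ z : Γ(diskSpec d r A, W), ∀ f : s,
      (diskSpecMap d r (algebraMap A (Localization.Away f.1))).app W z = y f := by
  refine exists_glue_sections (diskCover d r s hs) W y fun f g => section_ext fun B u hu => ?_
  have key : ∀ f : s, IsUnit (u f.1) →
      ∃ a : Localization.Away f.1 →+* B, a.comp (algebraMap A _) = u := fun f hf =>
    ⟨IsLocalization.Away.lift f.1 hf, IsLocalization.Away.lift_comp _ _⟩
  obtain ⟨a, ha⟩ := key f (isUnit_of_top_le_preimage d r u f.1 fun x hx => (hu hx).1.1)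
  obtain ⟨b, hb⟩ := key g (isUnit_of_top_le_preimage d r u g.1 fun x hx => (hu hx).2.1)
  rw [evalAt_map, evalAt_map]
  have hqa : diskSpecMap d r u = diskSpecMap d r a ≫
      diskSpecMap d r (algebraMap A (Localization.Away f.1)) := by rw [← diskSpecMap_comp, ha]
  have hqb : diskSpecMap d r u = diskSpecMap d r b ≫
      diskSpecMap d r (algebraMap A (Localization.Away g.1)) := by rw [← diskSpecMap_comp, hb]
  have hua : ⊤ ≤ (diskSpecMap d r a ≫ diskSpecMap d r (algebraMap A (Localization.Away f.1))) ⁻¹ᵁ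
      ((diskSpecMap d r (algebraMap A (Localization.Away f.1))).opensRange ⊓ W) :=
    hqa ▸ fun x hx => (hu hx).1
  have hub : ⊤ ≤ (diskSpecMap d r b ≫ diskSpecMap d r (algebraMap A (Localization.Away g.1))) ⁻¹ᵁ
      ((diskSpecMap d r (algebraMap A (Localization.Away g.1))).opensRange ⊓ W) :=
    hqb ▸ fun x hx => (hu hx).2
  refine (evalAt_congr hqa _ hua _).trans (Eq.trans ?_ (evalAt_congr hqb _ hub _).symm)
  refine (evalAt_ΓIso_hom _ W _ hua (fun x hx => (hua hx).2) _).trans (Eq.trans ?_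
    (evalAt_ΓIso_hom _ W _ hub (fun x hx => (hub hx).2) _).symm)
  exact hy f g B a b (ha.trans hb.symm) _ _

variable {d r} in
theorem disk_section_ext_of_away {s : Set A} (hs : Ideal.span s = ⊤) {W : (diskSpec d r A).Opens}
    {x y : Γ(diskSpec d r A, W)}
    (h : ∀ f ∈ s, (diskSpecMap d r (algebraMap A (Localization.Away f))).app W x =
      (diskSpecMap d r (algebraMap A (Localization.Away f))).app W y) : x = y :=
  Scheme.OpenCover.ext_elem x y (diskCover d r s hs) fun f => h f.1 f.2

variable {d r} in
theorem disk_hom_ext_of_away {X : Scheme.{u}} {s : Set A} (hs : Ideal.span s = ⊤)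
    {j k : diskSpec d r A ⟶ X}
    (h : ∀ f ∈ s, diskSpecMap d r (algebraMap A (Localization.Away f)) ≫ j =
      diskSpecMap d r (algebraMap A (Localization.Away f)) ≫ k) : j = k :=
  Scheme.Cover.hom_ext (diskCover d r s hs) _ _ fun f => h f.1 f.2

-- The fibre product of two members of the cover factors through the disk over the localization at
-- the product `f g`, so the compatibility for this one test ring is enough.
variable {d r} in
theorem exists_glue_disk_hom {X : Scheme.{u}} {s : Set A} (hs : Ideal.span s = ⊤)
    (y : ∀ f : s, diskSpec d r (Localization.Away f.1) ⟶ X)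
    (hy : ∀ (f g : s) (B : CommRingCat.{u}) (a : Localization.Away f.1 →+* B)
      (b : Localization.Away g.1 →+* B), a.comp (algebraMap A _) = b.comp (algebraMap A _) →
      diskSpecMap d r a ≫ y f = diskSpecMap d r b ≫ y g) :
    ∃ z : diskSpec d r A ⟶ X, ∀ f : s,
      diskSpecMap d r (algebraMap A (Localization.Away f.1)) ≫ z = y f := by
  let q := fun f : A => diskSpecMap d r (algebraMap A (Localization.Away f))
  refine ⟨Scheme.Cover.glueMorphisms (diskCover d r s hs) y fun f g => ?_, fun f =>
    Scheme.Cover.ι_glueMorphisms (diskCover d r s hs) y _ f⟩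
  change pullback.fst (q f.1) (q g.1) ≫ y f = pullback.snd (q f.1) (q g.1) ≫ y g
  set π := pullback.fst (q f.1) (q g.1) ≫ q f.1
  have hπ : π = pullback.snd (q f.1) (q g.1) ≫ q g.1 := pullback.condition
  -- A prime that contains neither `f` nor `g` does not contain `f g`.
  have hrange : Set.range π ⊆ Set.range (q (f.1 * g.1)) := by
    rintro _ ⟨x, rfl⟩
    have h1 : π x ∈ (q f.1).opensRange := ⟨pullback.fst (q f.1) (q g.1) x, rfl⟩
    have h2 : π x ∈ (q g.1).opensRange := by
      rw [hπ]
      exact ⟨pullback.snd (q f.1) (q g.1) x, rfl⟩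
    rw [mem_opensRange_diskSpecMap] at h1 h2
    have h3 : π x ∈ (q (f.1 * g.1)).opensRange := by
      rw [mem_opensRange_diskSpecMap, map_mul]
      exact fun h => ((π x).2.mem_or_mem h).elim h1 h2
    exact h3
  let l := IsOpenImmersion.lift (q (f.1 * g.1)) π hrange
  have hl : l ≫ q (f.1 * g.1) = π := IsOpenImmersion.lift_fac _ _ _
  let B : CommRingCat.{u} := .of (Localization.Away (f.1 * g.1))
  have hu : IsUnit (algebraMap A B (f.1 * g.1)) := IsLocalization.Away.algebraMap_isUnit _
  rw [map_mul] at hu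
  let a : Localization.Away f.1 →+* B :=
    IsLocalization.Away.lift f.1 (isUnit_of_mul_isUnit_left hu)
  let b : Localization.Away g.1 →+* B :=
    IsLocalization.Away.lift g.1 (isUnit_of_mul_isUnit_right hu)
  have ha : a.comp (algebraMap A _) = algebraMap A B := IsLocalization.Away.lift_comp _ _
  have hb : b.comp (algebraMap A _) = algebraMap A B := IsLocalization.Away.lift_comp _ _
  have h1 : pullback.fst (q f.1) (q g.1) = l ≫ diskSpecMap d r a := by
    rw [← cancel_mono (q f.1), Category.assoc, ← diskSpecMap_comp, ha]
    exact hl.symm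
  have h2 : pullback.snd (q f.1) (q g.1) = l ≫ diskSpecMap d r b := by
    rw [← cancel_mono (q g.1), Category.assoc, ← diskSpecMap_comp, hb, ← hπ]
    exact hl.symm
  rw [h1, h2, Category.assoc, Category.assoc, hy f g B a b (ha.trans hb.symm)]

end DiskSpec

/-! ### Flat frames along jets -/

section DiskPt

variable {d r : ℕ} {A B C : Type u} [CommRing A] [CommRing B] [CommRing C] {X Y : Scheme.{u}}

/-- The value of sections over `U` along a jet that factors through `U`. -/
def diskPt (q : diskSpec d r A ⟶ X) (U : X.Opens) (h : ⊤ ≤ q ⁻¹ᵁ U) : Γ(X, U) →+* DiskRing d r A :=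
  evalAt q U h

theorem diskPt_app (q : diskSpec d r A ⟶ X) (g : X ⟶ Y) {U : Y.Opens} (h : ⊤ ≤ q ⁻¹ᵁ g ⁻¹ᵁ U)
    (x : Γ(Y, U)) : diskPt q (g ⁻¹ᵁ U) h (g.app U x) = diskPt (q ≫ g) U h x :=
  evalAt_app q g h x

theorem diskPt_appLE (q : diskSpec d r A ⟶ X) (g : X ⟶ Y) {U : Y.Opens} {V : X.Opens}
    (h : ⊤ ≤ q ⁻¹ᵁ V) (e : V ≤ g ⁻¹ᵁ U) (x : Γ(Y, U)) :
    diskPt q V h (g.appLE U V e x) = diskPt (q ≫ g) U (h.trans fun _ hx => e hx) x :=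
  evalAt_appLE q g h e x

theorem diskPt_map (q : diskSpec d r A ⟶ X) {U V : X.Opens} (i : V ≤ U) (h : ⊤ ≤ q ⁻¹ᵁ V)
    (x : Γ(X, U)) :
    diskPt q V h (X.presheaf.map (homOfLE i).op x) = diskPt q U (h.trans fun _ hx => i hx) x :=
  evalAt_map q i h x

theorem diskPt_diskSpecMap (v : A →+* B) (q : diskSpec d r A ⟶ X) {U : X.Opens} (h : ⊤ ≤ q ⁻¹ᵁ U)
    (h' : ⊤ ≤ (diskSpecMap d r v ≫ q) ⁻¹ᵁ U) (x : Γ(X, U)) :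
    diskPt (diskSpecMap d r v ≫ q) U h' x = diskMap d r v (diskPt q U h x) :=
  evalAt_SpecMap (CommRingCat.ofHom (diskMap d r v)) q h h' x

theorem diskPt_congr {q q' : diskSpec d r A ⟶ X} (hq : q = q') {U : X.Opens} (h : ⊤ ≤ q ⁻¹ᵁ U)
    (h' : ⊤ ≤ q' ⁻¹ᵁ U) (x : Γ(X, U)) : diskPt q U h x = diskPt q' U h' x :=
  evalAt_congr hq h h' x

theorem evalAt_SpecMap_ΓSpecIso_inv {T T' : CommRingCat.{u}} (t : T ⟶ T') (a : T) :
    evalAt (Spec.map t) ⊤ le_top ((Scheme.ΓSpecIso T).inv a) = t.hom a := by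
  have h2 := evalAt_SpecMap (X := Spec T) t (𝟙 _) (U := ⊤) le_top le_top
    ((Scheme.ΓSpecIso T).inv a)
  refine (evalAt_congr (Category.comp_id _).symm _ _ _).trans (h2.trans (congrArg _ ?_))
  have : (Scheme.ΓSpecIso T).inv ≫ (Scheme.Hom.appLE (𝟙 (Spec T)) ⊤ ⊤ le_top ≫
      (Scheme.ΓSpecIso T).hom) = 𝟙 _ := by
    have : Scheme.Hom.appLE (𝟙 (Spec T)) ⊤ ⊤ le_top = 𝟙 _ :=
      (Scheme.Hom.appLE_eq_app _).trans (Scheme.Hom.id_app _)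
    rw [this, Category.id_comp, Iso.inv_hom_id]
  exact ConcreteCategory.congr_hom this a

/-- Functions on a disk, as sections over open subschemes. -/
def diskSection (W : (diskSpec d r A).Opens) : DiskRing d r A →+* Γ(diskSpec d r A, W) :=
  ((Scheme.ΓSpecIso (.of (DiskRing d r A))).inv ≫
    (diskSpec d r A).presheaf.map (homOfLE le_top).op).hom

theorem map_diskSection {W W' : (diskSpec d r A).Opens} (i : W' ≤ W) (x : DiskRing d r A) :
    (diskSpec d r A).presheaf.map (homOfLE i).op (diskSection W x) = diskSection W' x := by
  have : (diskSpec d r A).presheaf.map (homOfLE le_top).op ≫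
      (diskSpec d r A).presheaf.map (homOfLE i).op =
      (diskSpec d r A).presheaf.map (homOfLE (le_top : W' ≤ ⊤)).op := by
    rw [← Functor.map_comp]
    rfl
  exact ConcreteCategory.congr_hom this _

theorem diskPt_diskSection (v : A →+* B) {W : (diskSpec d r A).Opens}
    (h : ⊤ ≤ diskSpecMap d r v ⁻¹ᵁ W) (x : DiskRing d r A) :
    diskPt (diskSpecMap d r v) W h (diskSection W x) = diskMap d r v x := by
  have h1 := evalAt_map (diskSpecMap d r v) (le_top : W ≤ ⊤) h
    ((Scheme.ΓSpecIso (.of (DiskRing d r A))).inv x)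
  have h2 : evalAt (diskSpecMap d r v) ⊤ le_top
      ((Scheme.ΓSpecIso (.of (DiskRing d r A))).inv x) = diskMap d r v x :=
    evalAt_SpecMap_ΓSpecIso_inv (CommRingCat.ofHom (diskMap d r v)) x
  exact h1.trans h2

/-- Constants, as sections over open subschemes of a disk. -/
def constSection (W : (diskSpec d r A).Opens) : A →+* Γ(diskSpec d r A, W) :=
  (diskSection W).comp (diskConst d r A)

theorem map_constSection {W W' : (diskSpec d r A).Opens} (i : W' ≤ W) (a : A) :
    (diskSpec d r A).presheaf.map (homOfLE i).op (constSection W a) = constSection W' a :=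
  map_diskSection i _

theorem diskPt_constSection (v : A →+* B) {W : (diskSpec d r A).Opens}
    (h : ⊤ ≤ diskSpecMap d r v ⁻¹ᵁ W) (a : A) :
    diskPt (diskSpecMap d r v) W h (constSection W a) = diskConst d r B (v a) :=
  (diskPt_diskSection v h _).trans (RingHom.congr_fun (diskMap_const d r v) a)

end DiskPt

/-! ### Horizontality under change of the base of the disk -/

section HorizontalLocal

variable {R C : CommRingCat.{u}} {f : R ⟶ C} {M : Type u} [AddCommGroup M] [Module C M]
  {d r : ℕ} {A B : Type u} [CommRing A] [CommRing B]

theorem IsHorizontalAt.diskMap {nabla : M → CommRingCat.KaehlerDifferential f ⊗[C] M}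
    {φ : C →+* DiskRing d r A} {l : M → DiskRing d r A} {s : M} (hs : IsHorizontalAt nabla φ l s)
    (u : A →+* B) : IsHorizontalAt nabla ((PeriodJets.diskMap d r u).comp φ)
      (fun t => PeriodJets.diskMap d r u (l t)) s := by
  intro n a b e hx i
  rw [truncDeriv_diskMap, hs n a b e hx i, map_sum]
  refine Finset.sum_congr rfl fun k _ => ?_
  simp only [RingHom.comp_apply, truncDeriv_diskMap, map_mul, truncSucc_diskMap]

theorem isHorizontalAt_of_away {nabla : M → CommRingCat.KaehlerDifferential f ⊗[C] M}
    {φ : C →+* DiskRing d r A} {l : M → DiskRing d r A} {s : M} {t : Set A}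
    (ht : Ideal.span t = ⊤)
    (h : ∀ g ∈ t, IsHorizontalAt nabla
      ((PeriodJets.diskMap d r (algebraMap A (Localization.Away g))).comp φ)
      (fun t => PeriodJets.diskMap d r (algebraMap A (Localization.Away g)) (l t)) s) :
    IsHorizontalAt nabla φ l s := by
  intro n a b e hx i
  refine truncPoly_ext_of_away ht fun g hg => ?_
  have := h g hg n a b e hx i
  rw [truncDeriv_diskMap] at this
  rw [this, map_sum]
  refine Finset.sum_congr rfl fun k _ => ?_
  simp only [RingHom.comp_apply, truncDeriv_diskMap, map_mul, truncSucc_diskMap]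

theorem isHorizontalAt_congr {nabla : M → CommRingCat.KaehlerDifferential f ⊗[C] M}
    {φ φ' : C →+* DiskRing d r A} {l l' : M → DiskRing d r A} {s : M}
    (h : IsHorizontalAt nabla φ l s) (hφ : ∀ c, φ c = φ' c) (hl : ∀ t, l t = l' t) :
    IsHorizontalAt nabla φ' l' s := by
  obtain rfl : φ = φ' := RingHom.ext hφ
  obtain rfl : l = l' := funext hl
  exact h

end HorizontalLocal

/-! ### Flat frames, framed jets, and the action of constant matrices -/

section FlatFrames

variable {R : CommRingCat.{u}} {S : Scheme.{u}} {π : S ⟶ Spec R} {h : ℤ →₀ ℕ}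

/-- A frame of the pullback of the bundle along the jet `j`, given by the coordinates, with respect
to this frame, of the sections of the bundle. -/
@[ext]
structure FrameCoords (E : FlatFilteredBundle π h) {d r : ℕ} {A : Type u} [CommRing A]
    (j : diskSpec d r A ⟶ S) where
  c : ∀ U : S.Opens, Γ(E.H, U) → Fin (totalRank h) → Γ(diskSpec d r A, j ⁻¹ᵁ U)
  map_add : ∀ U s t a, c U (s + t) a = c U s a + c U t a
  map_smul : ∀ U (x : Γ(S, U)) s a, c U (x • s) a = j.app U x * c U s a
  map_res : ∀ {U V : S.Opens} (i : V ≤ U) s a, c V (resMap E.H i s) a =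
    (diskSpec d r A).presheaf.map (homOfLE (fun _ hx => i hx : j ⁻¹ᵁ V ≤ j ⁻¹ᵁ U)).op (c U s a)
  isUnit : ∀ U v, IsCompatibleFrame (h := h) E.F v → IsUnit (Matrix.of fun a b => c U (v a) b)

namespace FrameCoords

variable {E : FlatFilteredBundle π h} {d r : ℕ} {A B C : Type u} [CommRing A] [CommRing B]
  [CommRing C] {j : diskSpec d r A ⟶ S}

/-- The coordinates of sections over `U` at a point of `j⁻¹ U`. -/
def ev {d' r' : ℕ} (F : FrameCoords E j) (q : diskSpec d' r' B ⟶ diskSpec d r A) (U : S.Opens)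
    (hU : ⊤ ≤ (q ≫ j) ⁻¹ᵁ U) (a : Fin (totalRank h)) :
    Γ(E.H, U) →ₛₗ[diskPt (q ≫ j) U hU] DiskRing d' r' B where
  toFun s := diskPt q (j ⁻¹ᵁ U) hU (F.c U s a)
  map_add' s t := (congrArg _ (F.map_add U s t a)).trans (_root_.map_add _ _ _)
  map_smul' x s := (congrArg _ (F.map_smul U x s a)).trans
    ((map_mul _ _ _).trans (congrArg (· * _) (diskPt_app q j hU x)))

theorem ev_resMap {d' r' : ℕ} (F : FrameCoords E j) (q : diskSpec d' r' B ⟶ diskSpec d r A)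
    {U V : S.Opens} (i : V ≤ U) (hV : ⊤ ≤ (q ≫ j) ⁻¹ᵁ V) (a : Fin (totalRank h)) (s : Γ(E.H, U)) :
    F.ev q V hV a (resMap E.H i s) = F.ev q U (hV.trans fun _ hx => i hx) a s := by
  exact (congrArg (diskPt q (j ⁻¹ᵁ V) hV) (F.map_res i s a)).trans
    (diskPt_map q (U := j ⁻¹ᵁ U) (V := j ⁻¹ᵁ V) (fun _ hx => i hx) hV (F.c U s a))

theorem isUnit_ev {d' r' : ℕ} (F : FrameCoords E j) (q : diskSpec d' r' B ⟶ diskSpec d r A)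
    {U : S.Opens} {v : Fin (totalRank h) → Γ(E.H, U)} (hv : IsCompatibleFrame (h := h) E.F v)
    (hU : ⊤ ≤ (q ≫ j) ⁻¹ᵁ U) : IsUnit (Matrix.of fun a b => F.ev q U hU b (v a)) :=
  (F.isUnit U v hv).map (diskPt q (j ⁻¹ᵁ U) hU).mapMatrix

theorem ev_diskSpecMap {d' r' : ℕ} (F : FrameCoords E j) (v : B →+* C)
    (q : diskSpec d' r' B ⟶ diskSpec d r A) {U : S.Opens} (hU : ⊤ ≤ (q ≫ j) ⁻¹ᵁ U)
    (hU' : ⊤ ≤ ((diskSpecMap d' r' v ≫ q) ≫ j) ⁻¹ᵁ U)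
    (a : Fin (totalRank h)) (s : Γ(E.H, U)) :
    F.ev (diskSpecMap d' r' v ≫ q) U hU' a s = diskMap d' r' v (F.ev q U hU a s) :=
  diskPt_diskSpecMap v q (U := j ⁻¹ᵁ U) hU hU' _

theorem ev_congr {d' r' : ℕ} (F : FrameCoords E j) {q q' : diskSpec d' r' B ⟶ diskSpec d r A}
    (hq : q = q') {U : S.Opens} (hU : ⊤ ≤ (q ≫ j) ⁻¹ᵁ U) (hU' : ⊤ ≤ (q' ≫ j) ⁻¹ᵁ U)
    (a : Fin (totalRank h)) (s : Γ(E.H, U)) : F.ev q U hU a s = F.ev q' U hU' a s := by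
  subst hq
  rfl

/-- Compatibility of a frame with the connection. -/
def IsFlat (F : FrameCoords E j) : Prop :=
  ∀ (B : CommRingCat.{u}) (u : A →+* B) (U : S.affineOpens)
    (hU : ⊤ ≤ (diskSpecMap d r u ≫ j) ⁻¹ᵁ U.1) (a : Fin (totalRank h)) (s : Γ(E.H, U.1)),
    IsHorizontalAt (E.nabla U) (diskPt (diskSpecMap d r u ≫ j) U.1 hU)
      (F.ev (diskSpecMap d r u) U.1 hU a) s

/-- The pullback of a frame along a morphism of disks. -/
def pull {d' r' : ℕ} (F : FrameCoords E j) (q : diskSpec d' r' B ⟶ diskSpec d r A) :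
    FrameCoords E (q ≫ j) where
  c U s a := q.app (j ⁻¹ᵁ U) (F.c U s a)
  map_add U s t a := (congrArg _ (F.map_add U s t a)).trans (_root_.map_add _ _ _)
  map_smul U x s a := by
    rw [F.map_smul, map_mul, Scheme.Hom.comp_app]
    rfl
  map_res {U V} i s a := by
    rw [F.map_res]
    exact ConcreteCategory.congr_hom (q.naturality (homOfLE _).op) (F.c U s a)
  isUnit U v hv := (F.isUnit U v hv).map (q.app (j ⁻¹ᵁ U)).hom.mapMatrix

theorem ev_pull {d' r' d'' r'' : ℕ} (F : FrameCoords E j) (q : diskSpec d' r' B ⟶ diskSpec d r A)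
    (q' : diskSpec d'' r'' C ⟶ diskSpec d' r' B) {U : S.Opens} (hU : ⊤ ≤ (q' ≫ q ≫ j) ⁻¹ᵁ U)
    (a : Fin (totalRank h)) (s : Γ(E.H, U)) :
    (F.pull q).ev q' U hU a s = F.ev (q' ≫ q) U hU a s :=
  diskPt_app q' q (U := j ⁻¹ᵁ U) hU (F.c U s a)

theorem IsFlat.pull_diskSpecMap {F : FrameCoords E j} (hF : F.IsFlat) (v : A →+* B) :
    (F.pull (diskSpecMap d r v)).IsFlat := by
  intro C u U hU a s
  have hq : diskSpecMap d r (u.comp v) = diskSpecMap d r u ≫ diskSpecMap d r v :=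
    diskSpecMap_comp d r v u
  have hU' : ⊤ ≤ (diskSpecMap d r (u.comp v) ≫ j) ⁻¹ᵁ U.1 := by rwa [hq, Category.assoc]
  refine isHorizontalAt_congr (hF C (u.comp v) U hU' a s) (fun x => ?_) (fun t => ?_)
  · exact diskPt_congr (by rw [hq, Category.assoc]) _ _ _
  · rw [ev_pull]
    exact F.ev_congr hq _ _ _ _

theorem ext_ev {F F' : FrameCoords E j} (hF : ∀ (B : CommRingCat.{u}) (u : A →+* B) (U : S.Opens)
    (hU : ⊤ ≤ (diskSpecMap d r u ≫ j) ⁻¹ᵁ U) (a : Fin (totalRank h)) (s : Γ(E.H, U)),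
    F.ev (diskSpecMap d r u) U hU a s = F'.ev (diskSpecMap d r u) U hU a s) : F = F' := by
  ext U s a
  exact section_ext fun B u hu => hF B u U hu a s

/-- The action of `GL_m` on frames. -/
def act (g : GL (Fin (totalRank h)) A) (F : FrameCoords E j) : FrameCoords E j where
  c U s a := ∑ b, constSection (j ⁻¹ᵁ U) (g.1 a b) * F.c U s b
  map_add U s t a := by simp only [F.map_add, mul_add, Finset.sum_add_distrib]
  map_smul U x s a := by
    rw [Finset.mul_sum]
    refine Finset.sum_congr rfl fun b _ => ?_
    rw [F.map_smul]
    ring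
  map_res {U V} i s a := by
    rw [map_sum]
    refine Finset.sum_congr rfl fun b _ => ?_
    exact (congrArg₂ (· * ·) (map_constSection _ _).symm (F.map_res i s b)).trans
      (map_mul _ _ _).symm
  isUnit U v hv := by
    have h1 := (F.isUnit U v hv).mul
      ((Matrix.isUnit_transpose _).mpr (g.isUnit.map (constSection (j ⁻¹ᵁ U)).mapMatrix))
    convert h1 using 1
    ext1 a b
    simp only [Matrix.of_apply, Matrix.mul_apply, Matrix.transpose_apply,
      RingHom.mapMatrix_apply, Matrix.map_apply]
    exact Finset.sum_congr rfl fun k _ => mul_comm _ _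

theorem ev_act (g : GL (Fin (totalRank h)) A) (F : FrameCoords E j) (u : A →+* B) {U : S.Opens}
    (hU : ⊤ ≤ (diskSpecMap d r u ≫ j) ⁻¹ᵁ U) (a : Fin (totalRank h)) (s : Γ(E.H, U)) :
    (F.act g).ev (diskSpecMap d r u) U hU a s =
      ∑ b, diskConst d r B (u (g.1 a b)) * F.ev (diskSpecMap d r u) U hU b s := by
  refine (map_sum (diskPt (diskSpecMap d r u) (j ⁻¹ᵁ U) hU) _ _).trans
    (Finset.sum_congr rfl fun b _ => ?_)
  exact (map_mul _ _ _).trans (congrArg (· * _) (diskPt_constSection u hU (g.1 a b)))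

theorem act_one (F : FrameCoords E j) : F.act 1 = F := by
  ext U s a
  change ∑ b, constSection (j ⁻¹ᵁ U) ((1 : Matrix _ _ A) a b) * F.c U s b = _
  rw [Finset.sum_eq_single a]
  · rw [Matrix.one_apply_eq, map_one, one_mul]
  · intro b _ hb
    rw [Matrix.one_apply_ne hb.symm, map_zero, zero_mul]
  · simp

theorem act_mul (g g' : GL (Fin (totalRank h)) A) (F : FrameCoords E j) :
    F.act (g * g') = (F.act g').act g := by
  ext U s a
  change ∑ b, constSection (j ⁻¹ᵁ U) ((g.1 * g'.1) a b) * F.c U s b =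
    ∑ b, constSection (j ⁻¹ᵁ U) (g.1 a b) * ∑ k, constSection (j ⁻¹ᵁ U) (g'.1 b k) * F.c U s k
  simp only [Matrix.mul_apply, map_sum, map_mul, Finset.sum_mul, Finset.mul_sum, mul_assoc]
  exact Finset.sum_comm

/-- Constants are killed by `∂ᵢ`, so a linear combination of horizontal functionals with constant
coefficients is horizontal. -/
theorem IsFlat.act {F : FrameCoords E j} (hF : F.IsFlat) (g : GL (Fin (totalRank h)) A) :
    (F.act g).IsFlat := by
  intro B u U hU a s n x y e hx i
  simp only [ev_act, map_sum, truncDeriv_mul, truncDeriv_diskConst, mul_zero, add_zero,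
    hF B u U hU _ s n x y e hx i, Finset.mul_sum, Finset.sum_mul]
  rw [Finset.sum_comm]
  refine Finset.sum_congr rfl fun k _ => Finset.sum_congr rfl fun b _ => ?_
  simp only [map_mul]
  ring

end FrameCoords

variable (E : FlatFilteredBundle π h) (d r : ℕ)

/-- A jet with a flat frame along it. -/
structure FramedJet (A : Under R) where
  jet : (jetSpace π d r).obj A
  frame : FrameCoords E jet.1
  isFlat : frame.IsFlat

variable {E d r}

namespace FramedJet

/-- Frames along jets that are equal only by a proof have different types. Their values at points
all lie in disk rings, so a comparison of values avoids transport. -/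
theorem ext_ev {A : Under R} {p p' : FramedJet E d r A} (hj : p.jet = p'.jet)
    (hp : ∀ (B : CommRingCat.{u}) (u : A.right →+* B) (U : S.Opens)
      (hU : ⊤ ≤ (diskSpecMap d r u ≫ p.jet.1) ⁻¹ᵁ U)
      (hU' : ⊤ ≤ (diskSpecMap d r u ≫ p'.jet.1) ⁻¹ᵁ U) (a : Fin (totalRank h)) (s : Γ(E.H, U)),
      p.frame.ev (diskSpecMap d r u) U hU a s = p'.frame.ev (diskSpecMap d r u) U hU' a s) :
    p = p' := by
  obtain ⟨x, F, hF⟩ := p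
  obtain ⟨x', F', hF'⟩ := p'
  obtain rfl : x = x' := hj
  obtain rfl : F = F' := FrameCoords.ext_ev fun B u U hU a s => hp B u U hU hU a s
  rfl

theorem mk_congr {A : Under R} (x : (jetSpace π d r).obj A) {F F' : FrameCoords E x.1}
    (h : F = F') (hF : F.IsFlat) (hF' : F'.IsFlat) : FramedJet.mk x F hF = ⟨x, F', hF'⟩ := by
  subst h
  rfl

theorem ev_congr {A : Under R} {p p' : FramedJet E d r A} (hp : p = p') {B : Type u} [CommRing B]
    (u : A.right →+* B) {U : S.Opens} (hU : ⊤ ≤ (diskSpecMap d r u ≫ p.jet.1) ⁻¹ᵁ U)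
    (hU' : ⊤ ≤ (diskSpecMap d r u ≫ p'.jet.1) ⁻¹ᵁ U) (a : Fin (totalRank h)) (s : Γ(E.H, U)) :
    p.frame.ev (diskSpecMap d r u) U hU a s = p'.frame.ev (diskSpecMap d r u) U hU' a s := by
  subst hp
  rfl

/-- The restriction of a jet with a flat frame. -/
def map {A B : Under R} (u : A ⟶ B) (p : FramedJet E d r A) : FramedJet E d r B where
  jet := (jetSpace π d r).map u p.jet
  frame := p.frame.pull (diskSpecMap d r u.right.hom)
  isFlat := p.isFlat.pull_diskSpecMap u.right.hom

theorem ev_map {A B : Under R} (u : A ⟶ B) (p : FramedJet E d r A) {C : Type u} [CommRing C]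
    (v : B.right →+* C) {U : S.Opens}
    (hU : ⊤ ≤ (diskSpecMap d r v ≫ (p.map u).jet.1) ⁻¹ᵁ U)
    (hU' : ⊤ ≤ (diskSpecMap d r (v.comp u.right.hom) ≫ p.jet.1) ⁻¹ᵁ U)
    (a : Fin (totalRank h)) (s : Γ(E.H, U)) :
    (p.map u).frame.ev (diskSpecMap d r v) U hU a s =
      p.frame.ev (diskSpecMap d r (v.comp u.right.hom)) U hU' a s :=
  (p.frame.ev_pull _ _ _ _ _).trans (p.frame.ev_congr (diskSpecMap_comp d r _ _).symm _ _ _ _)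

theorem top_le_of_map {A B : Under R} (u : A ⟶ B) (p : FramedJet E d r A) {C : Type u} [CommRing C]
    (v : B.right →+* C) {U : S.Opens}
    (hU : ⊤ ≤ (diskSpecMap d r v ≫ (p.map u).jet.1) ⁻¹ᵁ U) :
    ⊤ ≤ (diskSpecMap d r (v.comp u.right.hom) ≫ p.jet.1) ⁻¹ᵁ U := by
  rw [diskSpecMap_comp, Category.assoc]
  exact hU

theorem map_map {A B C : Under R} (u : A ⟶ B) (v : B ⟶ C) (p : FramedJet E d r A) :
    (p.map u).map v = p.map (u ≫ v) := by
  refine (FramedJet.ext_ev (p := p.map (u ≫ v)) (p' := (p.map u).map v) ?_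
    fun D w U hU hU' a s => ?_).symm
  · exact ConcreteCategory.congr_hom ((jetSpace π d r).map_comp u v) p.jet
  · have h1 := top_le_of_map v (p.map u) w hU'
    have h2 := top_le_of_map u p _ h1
    rw [ev_map v (p.map u) w hU' h1, ev_map u p _ h1 h2]
    exact ev_map (u ≫ v) p w hU h2 a s

/-- The functor of jets with a flat frame. -/
def functor (E : FlatFilteredBundle π h) (d r : ℕ) : Under R ⥤ Type u where
  obj A := FramedJet E d r A
  map u := ↾fun p => p.map u
  map_id A := by
    refine ConcreteCategory.hom_ext _ _ fun (p : FramedJet E d r A) => ?_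
    refine FramedJet.ext_ev (p := p.map (𝟙 A)) (p' := p) ?_ fun B u U hU hU' a s => ?_
    · exact ConcreteCategory.congr_hom ((jetSpace π d r).map_id A) p.jet
    · exact ev_map (𝟙 A) p u hU hU' a s
  map_comp u v := ConcreteCategory.hom_ext _ _ fun p => (map_map u v p).symm

/-- The action of `GL_m` on jets with a flat frame. -/
def act {A : Under R} (g : GL (Fin (totalRank h)) A.right) (p : FramedJet E d r A) :
    FramedJet E d r A :=
  ⟨p.jet, p.frame.act g, p.isFlat.act g⟩

theorem act_one {A : Under R} (p : FramedJet E d r A) : p.act 1 = p :=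
  mk_congr p.jet p.frame.act_one _ _

theorem act_mul {A : Under R} (g g' : GL (Fin (totalRank h)) A.right) (p : FramedJet E d r A) :
    p.act (g * g') = (p.act g').act g :=
  mk_congr p.jet (p.frame.act_mul g g') _ _

instance (A : Under R) : MulAction (GL (Fin (totalRank h)) A.right) (FramedJet E d r A) where
  smul g p := p.act g
  one_smul := act_one
  mul_smul := act_mul

theorem ev_smul {A : Under R} (g : GL (Fin (totalRank h)) A.right) (p : FramedJet E d r A)
    {B : Type u} [CommRing B] (u : A.right →+* B) {U : S.Opens}
    (hU : ⊤ ≤ (diskSpecMap d r u ≫ p.jet.1) ⁻¹ᵁ U) (a : Fin (totalRank h)) (s : Γ(E.H, U)) :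
    (g • p).frame.ev (diskSpecMap d r u) U hU a s =
      ∑ b, diskConst d r B (u (g.1 a b)) * p.frame.ev (diskSpecMap d r u) U hU b s :=
  FrameCoords.ev_act g p.frame u hU a s

theorem map_smul {A B : Under R} (u : A ⟶ B) (g : GL (Fin (totalRank h)) A.right)
    (p : FramedJet E d r A) :
    (g • p).map u = Matrix.GeneralLinearGroup.map u.right.hom g • p.map u := by
  refine FramedJet.ext_ev rfl fun C v U hU hU' a s => ?_
  have h1 := top_le_of_map u p v hU
  refine (ev_map u (g • p) v hU h1 a s).trans ?_
  refine (ev_smul g p _ h1 a s).trans (Eq.trans ?_ (ev_smul _ (p.map u) v hU a s).symm)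
  exact Finset.sum_congr rfl fun b _ => congrArg _ (ev_map u p v hU h1 b s).symm

end FramedJet

end FlatFrames

/-! ### Gluing of flat frames -/

section Gluing

variable {R : CommRingCat.{u}} {S : Scheme.{u}} {π : S ⟶ Spec R} {h : ℤ →₀ ℕ}
  {E : FlatFilteredBundle π h} {d r : ℕ} {A : Type u} [CommRing A]

theorem span_image_eq_top {A B : Type*} [CommRing A] [CommRing B] (u : A →+* B) {s : Set A}
    (hs : Ideal.span s = ⊤) : Ideal.span (u '' s) = ⊤ := by
  rw [← Ideal.map_span, hs, Ideal.map_top]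

namespace FrameCoords

variable {z : diskSpec d r A ⟶ S} {s : Set A}

theorem ext_of_away (hs : Ideal.span s = ⊤) {F F' : FrameCoords E z}
    (hF : ∀ f ∈ s, F.pull (diskSpecMap d r (algebraMap A (Localization.Away f))) =
      F'.pull (diskSpecMap d r (algebraMap A (Localization.Away f)))) : F = F' := by
  ext U t a
  exact disk_section_ext_of_away hs fun f hf => congr_fun (congr_fun (congr_fun
    (congrArg FrameCoords.c (hF f hf)) U) t) a

/-- A test ring `B` is covered by its localizations at the elements `u f`. Over each of them `u`
factors through the localization of `A` at `f`, where flatness is known. -/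
theorem isFlat_of_away (hs : Ideal.span s = ⊤) {F : FrameCoords E z}
    (hF : ∀ f ∈ s, (F.pull (diskSpecMap d r (algebraMap A (Localization.Away f)))).IsFlat) :
    F.IsFlat := by
  intro B u U hU i t
  refine isHorizontalAt_of_away (span_image_eq_top u hs) ?_
  rintro _ ⟨f, hf, rfl⟩
  let a : Localization.Away f →+* Localization.Away (u f) := Localization.awayMap u f
  have ha : a.comp (algebraMap A _) = (algebraMap B (Localization.Away (u f))).comp u :=
    IsLocalization.map_comp _
  have hq : diskSpecMap d r a ≫ diskSpecMap d r (algebraMap A (Localization.Away f)) =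
      diskSpecMap d r (algebraMap B (Localization.Away (u f))) ≫ diskSpecMap d r u := by
    rw [← diskSpecMap_comp, ha, diskSpecMap_comp]
  have hU1 : ⊤ ≤ ((diskSpecMap d r (algebraMap B (Localization.Away (u f))) ≫
      diskSpecMap d r u) ≫ z) ⁻¹ᵁ U.1 := fun x _ => hU (Set.mem_univ _)
  have hU2 : ⊤ ≤ (diskSpecMap d r a ≫ diskSpecMap d r (algebraMap A (Localization.Away f)) ≫ z)
      ⁻¹ᵁ U.1 := by rwa [← Category.assoc, hq]
  refine isHorizontalAt_congr (hF f hf (.of (Localization.Away (u f))) a U hU2 i t)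
    (fun x => ?_) fun x => ?_
  · refine (diskPt_congr (q' := diskSpecMap d r (algebraMap B (Localization.Away (u f))) ≫
      diskSpecMap d r u ≫ z) (by rw [← Category.assoc, hq, Category.assoc]) _
        (fun x _ => hU (Set.mem_univ _)) x).trans ?_
    exact diskPt_diskSpecMap _ _ hU _ x
  · rw [ev_pull]
    exact (F.ev_congr hq _ hU1 i x).trans (F.ev_diskSpecMap _ _ hU _ i x)

/-- The coordinates of each section are glued separately. The axioms of a frame are equations
between sections, or invertibility of a determinant, and these can be checked on the cover. -/
theorem exists_glue (hs : Ideal.span s = ⊤)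
    (F : ∀ f : s, FrameCoords E (diskSpecMap d r (algebraMap A (Localization.Away f.1)) ≫ z))
    (hF : ∀ (f g : s) (B : CommRingCat.{u}) (a : Localization.Away f.1 →+* B)
      (b : Localization.Away g.1 →+* B), a.comp (algebraMap A _) = b.comp (algebraMap A _) →
      ∀ (U : S.Opens) (hU hU') (i : Fin (totalRank h)) (t : Γ(E.H, U)),
      (F f).ev (diskSpecMap d r a) U hU i t = (F g).ev (diskSpecMap d r b) U hU' i t) :
    ∃ G : FrameCoords E z,
      ∀ f : s, G.pull (diskSpecMap d r (algebraMap A (Localization.Away f.1))) = F f := by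
  choose c hc using fun (U : S.Opens) (t : Γ(E.H, U)) (i : Fin (totalRank h)) =>
    exists_glue_disk_sections hs (z ⁻¹ᵁ U) (fun f => (F f).c U t i)
      fun f g B a b hab hU hU' => hF f g B a b hab U hU hU' i t
  have hc' : ∀ U t i (f : s), ((diskSpecMap d r (algebraMap A (Localization.Away f.1))).app
    (z ⁻¹ᵁ U)).hom (c U t i) = (F f).c U t i := hc
  refine ⟨⟨c, fun U t t' i => ?_, fun U x t i => ?_, fun {U V} j t i => ?_, fun U v hv => ?_⟩,
    fun f => ?_⟩
  · refine disk_section_ext_of_away hs fun f hf => ?_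
    refine (hc' U (t + t') i ⟨f, hf⟩).trans (((F ⟨f, hf⟩).map_add U t t' i).trans ?_)
    refine (congrArg₂ (· + ·) (hc' U t i ⟨f, hf⟩) (hc' U t' i ⟨f, hf⟩)).symm.trans ?_
    exact (_root_.map_add _ _ _).symm
  · refine disk_section_ext_of_away hs fun f hf => ?_
    refine (hc' U (x • t) i ⟨f, hf⟩).trans (((F ⟨f, hf⟩).map_smul U x t i).trans ?_)
    refine Eq.trans ?_ (map_mul _ _ _).symm
    refine congrArg₂ (fun a b : Γ(diskSpec d r (Localization.Away f),
      diskSpecMap d r (algebraMap A (Localization.Away f)) ⁻¹ᵁ z ⁻¹ᵁ U) => a * b) ?_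
      (hc' U t i ⟨f, hf⟩).symm
    rw [Scheme.Hom.comp_app]
    rfl
  · refine disk_section_ext_of_away hs fun f hf => ?_
    refine (hc' V _ i ⟨f, hf⟩).trans (((F ⟨f, hf⟩).map_res j t i).trans ?_)
    refine (congrArg _ (hc' U t i ⟨f, hf⟩)).symm.trans ?_
    exact (ConcreteCategory.congr_hom ((diskSpecMap d r (algebraMap A (Localization.Away f))
      ).naturality (homOfLE (fun _ hx => j hx : z ⁻¹ᵁ V ≤ z ⁻¹ᵁ U)).op) (c U t i)).symm
  · rw [Matrix.isUnit_iff_isUnit_det]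
    refine isUnit_of_app_isUnit (diskCover d r s hs) _ fun f => ?_
    have h1 := (Matrix.isUnit_iff_isUnit_det _).mp ((F f).isUnit U v hv)
    change IsUnit (((diskSpecMap d r (algebraMap A (Localization.Away f.1))).app
      (z ⁻¹ᵁ U)).hom (Matrix.det _))
    refine (congrArg IsUnit (RingHom.map_det _ _)).mpr ?_
    exact (congrArg (fun N => IsUnit (Matrix.det N))
      (Matrix.ext fun a b => hc' U (v a) b f)).mpr h1
  · ext U t i
    exact hc' U t i f

end FrameCoords

namespace FramedJet

theorem exists_eq_mk {A : Under R} {p : FramedJet E d r A} {x : (jetSpace π d r).obj A}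
    (hx : p.jet = x) : ∃ F hF, p = ⟨x, F, hF⟩ := by
  subst hx
  exact ⟨_, _, rfl⟩

/-- The jets are glued as morphisms of schemes; the given frames are then read as frames along the
restrictions of the glued jet, and their coordinates are glued. -/
theorem isSheaf (E : FlatFilteredBundle π h) (d r : ℕ) : IsZariskiSheaf (functor E d r) := by
  intro A s hs (p : (f : s) → FramedJet E d r (away A f.1)) hp
  -- The sheaf condition speaks of objects under `R`, the gluing lemmas of bare ring homomorphisms.
  -- Here `B` receives its `R`-algebra structure through `a`, and the two structures agree because
  -- `a` and `b` agree on `A`.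
  have hp' : ∀ (f g : s) (B : CommRingCat.{u}) (a : Localization.Away f.1 →+* B)
      (b : Localization.Away g.1 →+* B), a.comp (algebraMap A.right _) =
        b.comp (algebraMap A.right _) →
      ∃ (B' : Under R) (a' : away A f.1 ⟶ B') (b' : away A g.1 ⟶ B') (e : B'.right = B),
        a'.right ≫ eqToHom e = CommRingCat.ofHom a ∧ b'.right ≫ eqToHom e = CommRingCat.ofHom b ∧
        (p f).map a' = (p g).map b' := by
    intro f g B a b hab
    refine ⟨Under.mk ((away A f.1).hom ≫ CommRingCat.ofHom a), Under.homMk (CommRingCat.ofHom a),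
      Under.homMk (CommRingCat.ofHom b) ?_, rfl, ?_, ?_, ?_⟩
    · change (A.hom ≫ CommRingCat.ofHom (algebraMap _ _)) ≫ CommRingCat.ofHom b =
        (A.hom ≫ CommRingCat.ofHom (algebraMap _ _)) ≫ CommRingCat.ofHom a
      rw [Category.assoc, Category.assoc, ← CommRingCat.ofHom_comp, ← CommRingCat.ofHom_comp, hab]
    · exact Category.comp_id _
    · exact Category.comp_id _
    · refine hp f g _ _ _ ?_
      ext1
      exact congrArg CommRingCat.ofHom hab
  have hjet : ∀ (f g : s) (B : CommRingCat.{u}) (a : Localization.Away f.1 →+* B)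
      (b : Localization.Away g.1 →+* B), a.comp (algebraMap A.right _) =
        b.comp (algebraMap A.right _) →
      diskSpecMap d r a ≫ (p f).jet.1 = diskSpecMap d r b ≫ (p g).jet.1 := by
    intro f g B a b hab
    obtain ⟨B', a', b', rfl, ha, hb, he⟩ := hp' f g B a b hab
    obtain rfl : a'.right.hom = a := congrArg CommRingCat.Hom.hom ((Category.comp_id _).symm.trans ha)
    obtain rfl : b'.right.hom = b := congrArg CommRingCat.Hom.hom ((Category.comp_id _).symm.trans hb)
    exact congrArg (fun q => q.jet.1) he
  have hev : ∀ (f g : s) (B : CommRingCat.{u}) (a : Localization.Away f.1 →+* B)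
      (b : Localization.Away g.1 →+* B), a.comp (algebraMap A.right _) =
        b.comp (algebraMap A.right _) →
      ∀ (U : S.Opens) (hU hU') (i : Fin (totalRank h)) (t : Γ(E.H, U)),
      (p f).frame.ev (diskSpecMap d r a) U hU i t =
        (p g).frame.ev (diskSpecMap d r b) U hU' i t := by
    intro f g B a b hab U hU hU' i t
    obtain ⟨B', a', b', rfl, ha, hb, he⟩ := hp' f g B a b hab
    obtain rfl : a'.right.hom = a := congrArg CommRingCat.Hom.hom ((Category.comp_id _).symm.trans ha)
    obtain rfl : b'.right.hom = b := congrArg CommRingCat.Hom.hom ((Category.comp_id _).symm.trans hb)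
    have h1 : ⊤ ≤ (diskSpecMap d r (RingHom.id B'.right) ≫ ((p f).map a').jet.1) ⁻¹ᵁ U := by
      rw [diskSpecMap_id, Category.id_comp]
      exact hU
    have h2 : ⊤ ≤ (diskSpecMap d r (RingHom.id B'.right) ≫ ((p g).map b').jet.1) ⁻¹ᵁ U := by
      rw [diskSpecMap_id, Category.id_comp]
      exact hU'
    have h3 := ev_congr he (RingHom.id B'.right) h1 h2 i t
    exact ((ev_map a' (p f) (RingHom.id _) h1 hU i t).symm.trans h3).trans
      (ev_map b' (p g) (RingHom.id _) h2 hU' i t)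
  obtain ⟨z, hz⟩ := exists_glue_disk_hom hs (fun f => (p f).jet.1) hjet
  let x : (jetSpace π d r).obj A := ⟨z, by
    refine disk_hom_ext_of_away hs fun f hf => ?_
    refine (Category.assoc _ _ _).symm.trans ((congrArg (· ≫ π) (hz ⟨f, hf⟩)).trans
      ((p ⟨f, hf⟩).jet.2.trans ?_))
    rw [diskSpecMap, ← Spec.map_comp, Category.assoc, ← CommRingCat.ofHom_comp, diskMap_const]
    rfl⟩
  have hx : ∀ f : s, (p f).jet = (jetSpace π d r).map (toAway A f.1) x := fun f =>
    Subtype.ext (hz f).symm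
  -- The jet of `p f` is only propositionally the restriction of `x`; after this step its frame has
  -- the type of a frame along that restriction.
  choose F hF hpF using fun f => exists_eq_mk (hx f)
  obtain ⟨G, hG⟩ := FrameCoords.exists_glue (z := z) hs F (fun f g B a b hab U hU hU' i t => by
    have hU1 : ⊤ ≤ (diskSpecMap d r a ≫ (p f).jet.1) ⁻¹ᵁ U := by rw [hx]; exact hU
    have hU2 : ⊤ ≤ (diskSpecMap d r b ≫ (p g).jet.1) ⁻¹ᵁ U := by rw [hx]; exact hU'
    have := hev f g B a b hab U hU1 hU2 i t
    exact ((ev_congr (hpF f) a hU1 hU i t).symm.trans this).trans (ev_congr (hpF g) b hU2 hU' i t))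
  refine ⟨(⟨x, G, FrameCoords.isFlat_of_away hs fun f hf => by
    rw [hG ⟨f, hf⟩]
    exact hF ⟨f, hf⟩⟩ : FramedJet E d r A), fun f => ?_, ?_⟩
  · exact (mk_congr ((jetSpace π d r).map (toAway A f.1) x) (hG f) _ (hF f)).trans (hpF f).symm
  · intro (q : FramedJet E d r A) hq
    have hqx : q.jet = x := by
      refine Subtype.ext (disk_hom_ext_of_away hs fun f hf => ?_)
      exact (congrArg (fun q : FramedJet E d r _ => q.jet.1) (hq ⟨f, hf⟩)).trans
        (hz ⟨f, hf⟩).symm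
    obtain ⟨F', hF', rfl⟩ := exists_eq_mk hqx
    refine mk_congr x (FrameCoords.ext_of_away hs fun f hf => ?_) _ _
    have h1 : FramedJet.mk ((jetSpace π d r).map (toAway A f) x)
      (F'.pull (diskSpecMap d r (algebraMap A.right (Localization.Away f)))) _ = _ :=
      (hq ⟨f, hf⟩).trans (hpF ⟨f, hf⟩)
    rw [hG ⟨f, hf⟩]
    injection h1

end FramedJet

end Gluing

/-! ### Compatible frames and coordinates -/

section CompatibleFrames

variable {S : Scheme.{u}}

theorem resMap_resMap (H : S.Modules) {U V W : S.Opens} (i : V ≤ U) (k : W ≤ V) (s : Γ(H, U)) :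
    resMap H k (resMap H i s) = resMap H (k.trans i) s := by
  have : H.presheaf.map (homOfLE i).op ≫ H.presheaf.map (homOfLE k).op =
      H.presheaf.map (homOfLE (k.trans i)).op := by
    rw [← Functor.map_comp]
    rfl
  exact ConcreteCategory.congr_hom this s

theorem resMap_self (H : S.Modules) {U : S.Opens} (s : Γ(H, U)) : resMap H le_rfl s = s :=
  ConcreteCategory.congr_hom (H.presheaf.map_id (.op U)) s

theorem presheaf_map_map {X : Scheme.{u}} {U V W : X.Opens} (i : V ≤ U) (k : W ≤ V)
    (x : Γ(X, U)) : X.presheaf.map (homOfLE k).op (X.presheaf.map (homOfLE i).op x) =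
      X.presheaf.map (homOfLE (k.trans i)).op x := by
  have : X.presheaf.map (homOfLE i).op ≫ X.presheaf.map (homOfLE k).op =
      X.presheaf.map (homOfLE (k.trans i)).op := by
    rw [← Functor.map_comp]
    rfl
  exact ConcreteCategory.congr_hom this x

namespace IsCompatibleFrame

variable {H : S.Modules} {h : ℤ →₀ ℕ} {F : ℤ → ∀ U : S.Opens, Submodule Γ(S, U) Γ(H, U)}
  {U : S.Opens} {v : Fin (totalRank h) → Γ(H, U)}

theorem res (hv : IsCompatibleFrame F v) {V : S.Opens} (i : V ≤ U) :
    IsCompatibleFrame (h := h) F fun a => resMap H i (v a) where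
  linearIndependent W k := by
    simp only [resMap_resMap]
    exact hv.linearIndependent W _
  span_eq_top W k := by
    simp only [resMap_resMap]
    exact hv.span_eq_top W _
  span_eq_filtration k W l := by
    simp only [resMap_resMap]
    exact hv.span_eq_filtration k W _

/-- The basis over an open subset given by a compatible frame. -/
def basis (hv : IsCompatibleFrame F v) {V : S.Opens} (i : V ≤ U) :
    Module.Basis (Fin (totalRank h)) Γ(S, V) Γ(H, V) :=
  .mk (hv.linearIndependent V i) (hv.span_eq_top V i).ge

@[simp]
theorem basis_apply (hv : IsCompatibleFrame F v) {V : S.Opens} (i : V ≤ U)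
    (a : Fin (totalRank h)) : hv.basis i a = resMap H i (v a) :=
  Module.Basis.mk_apply _ _ _

theorem span_range (hv : IsCompatibleFrame F v) :
    Submodule.span Γ(S, U) (Set.range v) = ⊤ := by
  have := hv.span_eq_top U le_rfl
  simpa only [resMap_self] using this

theorem repr_res (hv : IsCompatibleFrame F v) {V W : S.Opens} (i : V ≤ U) (k : W ≤ V)
    (s : Γ(H, V)) (a : Fin (totalRank h)) :
    (hv.basis (k.trans i)).repr (resMap H k s) a =
      S.presheaf.map (homOfLE k).op ((hv.basis i).repr s a) := by
  conv_lhs => rw [← (hv.basis i).sum_repr s]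
  rw [map_sum, map_sum, Finset.sum_apply']
  rw [Finset.sum_eq_single a]
  · rw [LinearMap.map_smulₛₗ, basis_apply, resMap_resMap, ← basis_apply hv (k.trans i), map_smul,
      Module.Basis.repr_self]
    simp
  · intro b _ hb
    rw [LinearMap.map_smulₛₗ, basis_apply, resMap_resMap, ← basis_apply hv (k.trans i), map_smul,
      Module.Basis.repr_self]
    simp [hb]
  · simp

end IsCompatibleFrame

theorem FlatFilteredBundle.exists_affine_frame {R : CommRingCat.{u}} {π : S ⟶ Spec R}
    {h : ℤ →₀ ℕ} (E : FlatFilteredBundle π h) {U : S.Opens} {x : S} (hx : x ∈ U) :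
    ∃ (W : S.affineOpens) (v : Fin (totalRank h) → Γ(E.H, W.1)), W.1 ≤ U ∧ x ∈ W.1 ∧
      IsCompatibleFrame (h := h) E.F v := by
  obtain ⟨V, v, hxV, hv⟩ := E.exists_frame x
  obtain ⟨W, hW, hxW, hWU⟩ := S.isBasis_affineOpens.exists_subset_of_mem_open
    (show x ∈ ((U ⊓ V : S.Opens) : Set S) from ⟨hx, hxV⟩) (U ⊓ V).2
  obtain ⟨W, rfl⟩ : ∃ W' : S.Opens, (W' : Set S) = W := by
    obtain ⟨W', hW', rfl⟩ := hW
    exact ⟨W', rfl⟩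
  obtain ⟨W', hW', hWW⟩ := hW
  obtain rfl : W' = W := SetLike.coe_injective hWW
  exact ⟨⟨W', hW'⟩, _, fun y hy => (hWU hy).1, hxW, hv.res fun y hy => (hWU hy).2⟩

end CompatibleFrames

/-! ### Transfer of horizontality along restriction and pullback -/

section HorizontalTransfer

variable {d r : ℕ} {A : Type u} [CommRing A]

/-- All presentations of `∇ s` give the same contraction, so horizontality can be tested on a single
one. -/
theorem isHorizontalAt_iff_of_eq {R C : CommRingCat.{u}} {f : R ⟶ C} {M : Type u} [AddCommGroup M]
    [Module C M] {nabla : M → CommRingCat.KaehlerDifferential f ⊗[C] M}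
    {φ : C →+* DiskRing d r A} (hφ : ∀ a i, truncDeriv r i (φ (f.hom a)) = 0)
    (l : M →ₛₗ[φ] DiskRing d r A) {s : M} {n : ℕ} {a b : Fin n → C} {e : Fin n → M}
    (hx : nabla s = ∑ k, (a k • CommRingCat.KaehlerDifferential.d (f := f) (b k)) ⊗ₜ[C] e k) :
    IsHorizontalAt nabla φ l s ↔ ∀ i, truncDeriv r i (l s) =
      ∑ k, truncSucc d r A (φ (a k) * l (e k)) * truncDeriv r i (φ (b k)) := by
  refine ⟨fun hs => hs n a b e hx, fun hs => ?_⟩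
  rw [isHorizontalAt_iff hφ]
  intro i
  rw [hs i, hx, map_sum]
  refine Finset.sum_congr rfl fun k _ => ?_
  rw [contract_tmul, LinearMap.map_smulₛₗ, diskContract_d, truncLinear_apply, map_mul]
  simp only [RingHom.comp_apply, smul_eq_mul]
  ring

/-- The image of a presentation of `∇ s` is a presentation of `∇' (ρ s)`, and the two give literally
the same equation on the disk. This serves for restriction to a smaller open subset and for pullback
of bundles. -/
theorem isHorizontalAt_map_iff {R R' C C' : CommRingCat.{u}} {f : R ⟶ C} {f' : R' ⟶ C'}
    {g : R ⟶ R'} {g' : C ⟶ C'} (fac : g ≫ f' = f ≫ g') {M M' : Type u} [AddCommGroup M]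
    [Module C M] [AddCommGroup M'] [Module C' M'] (ρ : M →ₛₗ[g'.hom] M')
    {nabla : M → CommRingCat.KaehlerDifferential f ⊗[C] M}
    {nabla' : M' → CommRingCat.KaehlerDifferential f' ⊗[C'] M'}
    {φ : C →+* DiskRing d r A} {φ' : C' →+* DiskRing d r A}
    (hφ : ∀ a i, truncDeriv r i (φ (f.hom a)) = 0)
    (hφ' : ∀ a i, truncDeriv r i (φ' (f'.hom a)) = 0)
    (l : M →ₛₗ[φ] DiskRing d r A) (l' : M' →ₛₗ[φ'] DiskRing d r A)
    (hφφ' : ∀ c, φ c = φ' (g' c)) (hl : ∀ t, l t = l' (ρ t)) {s : M}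
    (hs : nabla' (ρ s) = TensorProduct.map (formMap fac) ρ (nabla s)) :
    IsHorizontalAt nabla φ l s ↔ IsHorizontalAt nabla' φ' l' (ρ s) := by
  obtain ⟨n, a, b, e, hx⟩ := exists_eq_sum_smul_d_tmul (f := f) M (id : M → M) (by simp) (nabla s)
  have hx' : nabla' (ρ s) = ∑ k, (g' (a k) • CommRingCat.KaehlerDifferential.d (f := f')
      (g' (b k))) ⊗ₜ[C'] ρ (e k) := by
    rw [hs, hx, map_sum]
    refine Finset.sum_congr rfl fun k _ => ?_
    rw [TensorProduct.map_tmul, LinearMap.map_smulₛₗ]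
    congr 2
    exact CommRingCat.KaehlerDifferential.map_d fac (b k)
  rw [isHorizontalAt_iff_of_eq hφ l hx, isHorizontalAt_iff_of_eq hφ' l' hx']
  simp only [hφφ', hl, id]

end HorizontalTransfer

/-! ### Functions from the base ring along a jet -/

section Jets

variable {R : CommRingCat.{u}} {S : Scheme.{u}} {π : S ⟶ Spec R} {h : ℤ →₀ ℕ} {d r : ℕ}

/-- A jet is a morphism over `R`, so functions coming from `R` are constant along the disk. This
provides the hypothesis under which differentials over `R` can be contracted with `∂ᵢ`. -/
theorem diskPt_structMap {A : Under R} (x : (jetSpace π d r).obj A) {B : Type u} [CommRing B]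
    (u : A.right →+* B) {U : S.Opens} (hU : ⊤ ≤ (diskSpecMap d r u ≫ x.1) ⁻¹ᵁ U) (a : R) :
    diskPt (diskSpecMap d r u ≫ x.1) U hU (structMap π U a) =
      diskConst d r B (u (A.hom.hom a)) := by
  have h1 : (diskSpecMap d r u ≫ x.1) ≫ π =
      Spec.map (A.hom ≫ CommRingCat.ofHom ((diskConst d r B).comp u)) := by
    rw [Category.assoc, x.2, diskSpecMap, ← Spec.map_comp, Category.assoc,
      ← CommRingCat.ofHom_comp, diskMap_const]
  refine (diskPt_map (diskSpecMap d r u ≫ x.1) (le_top : U ≤ ⊤) hU _).trans ?_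
  refine (diskPt_app (diskSpecMap d r u ≫ x.1) π (U := ⊤) le_top _).trans ?_
  exact (diskPt_congr h1 le_top le_top _).trans (evalAt_SpecMap_ΓSpecIso_inv _ a)

theorem truncDeriv_diskPt_structMap {A : Under R} (x : (jetSpace π d r).obj A) {B : Type u}
    [CommRing B] (u : A.right →+* B) {U : S.Opens} (hU : ⊤ ≤ (diskSpecMap d r u ≫ x.1) ⁻¹ᵁ U)
    (a : R) (i : Fin d) :
    truncDeriv r i (diskPt (diskSpecMap d r u ≫ x.1) U hU ((structMap π U).hom a)) = 0 :=
  (congrArg _ (diskPt_structMap x u hU a)).trans (truncDeriv_diskConst _ _)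

end Jets

/-! ### Existence of flat frames, and the torsor property -/

section FramesFromBundleFrames

variable {R : CommRingCat.{u}} {S : Scheme.{u}} {π : S ⟶ Spec R} {h : ℤ →₀ ℕ}
  {E : FlatFilteredBundle π h} {d r : ℕ}

namespace FrameCoords

section

variable {A B C : Type u} [CommRing A] [CommRing B] [CommRing C] {j : diskSpec d r A ⟶ S}

theorem ev_comp (F : FrameCoords E j) (u : A →+* B) (w : B →+* C) {U : S.Opens}
    (hU : ⊤ ≤ (diskSpecMap d r u ≫ j) ⁻¹ᵁ U) (hU' : ⊤ ≤ (diskSpecMap d r (w.comp u) ≫ j) ⁻¹ᵁ U)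
    (a : Fin (totalRank h)) (s : Γ(E.H, U)) :
    F.ev (diskSpecMap d r (w.comp u)) U hU' a s = diskMap d r w (F.ev (diskSpecMap d r u) U hU a s) :=
  (F.ev_congr (diskSpecMap_comp d r u w) hU' (fun _ _ => hU (Set.mem_univ _)) a s).trans
    (F.ev_diskSpecMap w _ hU _ a s)

theorem diskPt_comp (j : diskSpec d r A ⟶ S) (u : A →+* B) (w : B →+* C) {U : S.Opens}
    (hU : ⊤ ≤ (diskSpecMap d r u ≫ j) ⁻¹ᵁ U) (hU' : ⊤ ≤ (diskSpecMap d r (w.comp u) ≫ j) ⁻¹ᵁ U)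
    (x : Γ(S, U)) : diskPt (diskSpecMap d r (w.comp u) ≫ j) U hU' x =
      diskMap d r w (diskPt (diskSpecMap d r u ≫ j) U hU x) := by
  have hU'' : ⊤ ≤ (diskSpecMap d r w ≫ diskSpecMap d r u ≫ j) ⁻¹ᵁ U := fun _ _ =>
    hU (Set.mem_univ _)
  have h1 : diskSpecMap d r (w.comp u) ≫ j = diskSpecMap d r w ≫ diskSpecMap d r u ≫ j := by
    rw [diskSpecMap_comp, Category.assoc]
  exact (diskPt_congr h1 hU' hU'' x).trans
    (diskPt_diskSpecMap w (diskSpecMap d r u ≫ j) hU hU'' x)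

theorem ev_eq_sum (F : FrameCoords E j) {d' r' : ℕ} (q : diskSpec d' r' B ⟶ diskSpec d r A)
    {U V : S.Opens} {v : Fin (totalRank h) → Γ(E.H, U)} (hv : IsCompatibleFrame (h := h) E.F v)
    (i : V ≤ U) (hV : ⊤ ≤ (q ≫ j) ⁻¹ᵁ V) (hU : ⊤ ≤ (q ≫ j) ⁻¹ᵁ U) (a : Fin (totalRank h))
    (s : Γ(E.H, V)) : F.ev q V hV a s =
      ∑ b, diskPt (q ≫ j) V hV ((hv.basis i).repr s b) * F.ev q U hU a (v b) := by
  conv_lhs => rw [← (hv.basis i).sum_repr s, map_sum]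
  refine Finset.sum_congr rfl fun b _ => ?_
  rw [LinearMap.map_smulₛₗ, IsCompatibleFrame.basis_apply, ev_resMap]
  rfl

/-- When the jet lands in the domain of a frame of the bundle, any section, restricted to this
domain, is a combination of members of the frame, so their coordinates determine all others. -/
theorem ext_of_frame {F F' : FrameCoords E j} {W : S.Opens} {v : Fin (totalRank h) → Γ(E.H, W)}
    (hv : IsCompatibleFrame (h := h) E.F v) (hW : ⊤ ≤ (diskSpecMap d r (RingHom.id A) ≫ j) ⁻¹ᵁ W)
    (hF : ∀ a b, F.ev (diskSpecMap d r (RingHom.id A)) W hW b (v a) =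
      F'.ev (diskSpecMap d r (RingHom.id A)) W hW b (v a)) : F = F' := by
  refine ext_ev fun B u U hU a s => ?_
  have hW' : ⊤ ≤ (diskSpecMap d r u ≫ j) ⁻¹ᵁ W := by
    have : diskSpecMap d r u ≫ j = diskSpecMap d r u ≫ diskSpecMap d r (RingHom.id A) ≫ j := by
      rw [diskSpecMap_id, Category.id_comp]
    rw [this]
    exact fun x _ => hW (Set.mem_univ _)
  have hV : ⊤ ≤ (diskSpecMap d r u ≫ j) ⁻¹ᵁ (U ⊓ W) :=
    fun x _ => ⟨hU (Set.mem_univ _), hW' (Set.mem_univ _)⟩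
  refine (F.ev_resMap _ inf_le_left hV a s).symm.trans (Eq.trans ?_ (F'.ev_resMap _ inf_le_left hV a s))
  rw [ev_eq_sum F _ hv inf_le_right hV hW', ev_eq_sum F' _ hv inf_le_right hV hW']
  refine Finset.sum_congr rfl fun b _ => congrArg _ ?_
  exact (F.ev_comp (RingHom.id A) u hW hW' a (v b)).trans ((congrArg _ (hF b a)).trans
    (F'.ev_comp (RingHom.id A) u hW hW' a (v b)).symm)

theorem isHorizontalAt_of_iSup (F : FrameCoords E j) (u : A →+* B) {U : S.affineOpens}
    (hU : ⊤ ≤ (diskSpecMap d r u ≫ j) ⁻¹ᵁ U.1) {a : Fin (totalRank h)} {s : Γ(E.H, U.1)}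
    {ι : Type*} (W : ι → (diskSpec d r B).Opens) (hW : ∀ p, ∃ i, p ∈ W i)
    (hs : ∀ (i : ι) (C : CommRingCat.{u}) (w : B →+* C), ⊤ ≤ diskSpecMap d r w ⁻¹ᵁ W i →
      ∀ hU' : ⊤ ≤ (diskSpecMap d r (w.comp u) ≫ j) ⁻¹ᵁ U.1,
      IsHorizontalAt (E.nabla U) (diskPt (diskSpecMap d r (w.comp u) ≫ j) U.1 hU')
        (F.ev (diskSpecMap d r (w.comp u)) U.1 hU' a) s) :
    IsHorizontalAt (E.nabla U) (diskPt (diskSpecMap d r u ≫ j) U.1 hU)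
      (F.ev (diskSpecMap d r u) U.1 hU a) s := by
  refine isHorizontalAt_of_away (span_eq_top_of_iSup_opens W hW) ?_
  rintro g ⟨i, hi⟩
  have hU' : ⊤ ≤ (diskSpecMap d r ((algebraMap B (Localization.Away g)).comp u) ≫ j) ⁻¹ᵁ U.1 := by
    rw [diskSpecMap_comp, Category.assoc]
    exact fun x _ => hU (Set.mem_univ _)
  exact isHorizontalAt_congr (hs i (.of (Localization.Away g)) _ hi hU')
    (diskPt_comp j u _ hU hU') (F.ev_comp u _ hU hU' a)

theorem preimage_le_preimage_inf {X Y : Scheme.{u}} {j : X ⟶ Y} {U : Y.Opens} (hU : ⊤ ≤ j ⁻¹ᵁ U)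
    (V : Y.Opens) : j ⁻¹ᵁ V ≤ j ⁻¹ᵁ (V ⊓ U) :=
  fun x hx => ⟨hx, hU (Set.mem_univ x)⟩

/-- The frame along a jet given by an invertible matrix and a frame of the bundle. -/
def ofMatrix {U : S.Opens} {v : Fin (totalRank h) → Γ(E.H, U)}
    (hv : IsCompatibleFrame (h := h) E.F v) (hU : ⊤ ≤ j ⁻¹ᵁ U)
    (G : Matrix (Fin (totalRank h)) (Fin (totalRank h)) (DiskRing d r A)) (hG : IsUnit G) :
    FrameCoords E j where
  -- The section is restricted to `V ⊓ U`, where `v` is a basis. Nothing of `j⁻¹ V` is lost, since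
  -- the jet lands in `U`. The entry `G b a` is the `a`-th coordinate of `v b`.
  c V s a := ∑ b, j.appLE (V ⊓ U) (j ⁻¹ᵁ V) (preimage_le_preimage_inf hU _)
    ((hv.basis (V := V ⊓ U) inf_le_right).repr (resMap E.H inf_le_left s) b) *
      diskSection (j ⁻¹ᵁ V) (G b a)
  map_add V s t a := by
    simp only [_root_.map_add, Finsupp.add_apply, add_mul, Finset.sum_add_distrib]
  map_smul V x s a := by
    rw [Finset.mul_sum]
    refine Finset.sum_congr rfl fun b _ => ?_
    rw [LinearMap.map_smulₛₗ, _root_.map_smul, Finsupp.smul_apply, smul_eq_mul, map_mul, mul_assoc]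
    congr 1
    rw [Scheme.Hom.app_eq_appLE]
    exact ConcreteCategory.congr_hom (Scheme.Hom.map_appLE j _ (homOfLE inf_le_left).op) x
  map_res {V V'} i s a := by
    rw [map_sum]
    refine Finset.sum_congr rfl fun b _ => ?_
    refine Eq.trans ?_ (map_mul _ _ _).symm
    refine congrArg₂ (· * ·) ?_ (map_diskSection _ _).symm
    have h1 : resMap E.H (inf_le_left : V' ⊓ U ≤ V') (resMap E.H i s) =
        resMap E.H (inf_le_inf_right U i) (resMap E.H inf_le_left s) := by
      rw [resMap_resMap, resMap_resMap]
    rw [h1, hv.repr_res inf_le_right (inf_le_inf_right U i)]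
    generalize (hv.basis (V := V ⊓ U) inf_le_right).repr (resMap E.H inf_le_left s) b = x
    have h2 := Scheme.Hom.map_appLE j
      (preimage_le_preimage_inf hU V') (homOfLE (inf_le_inf_right U i)).op
    have h3 := Scheme.Hom.appLE_map j
      (preimage_le_preimage_inf hU V) (homOfLE (fun _ hx => i hx : j ⁻¹ᵁ V' ≤ j ⁻¹ᵁ V)).op
    exact ConcreteCategory.congr_hom (h2.trans h3.symm) x
  isUnit V v' hv' := by
    have h1 := (((Matrix.isUnit_transpose _).mpr
      (changeOfBasis (hv'.basis (V := V ⊓ U) inf_le_left)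
        (hv.basis (V := V ⊓ U) inf_le_right)).isUnit).map
      (j.appLE (V ⊓ U) (j ⁻¹ᵁ V) (preimage_le_preimage_inf hU _)).hom.mapMatrix).mul
      (hG.map (diskSection (j ⁻¹ᵁ V)).mapMatrix)
    convert h1 using 1
    ext1 a b
    rw [Matrix.mul_apply]
    rw [Matrix.of_apply]
    refine Finset.sum_congr rfl fun k _ => ?_
    refine congrArg (fun t => t * diskSection (j ⁻¹ᵁ V) (G k b)) ?_
    change _ = (j.appLE (V ⊓ U) (j ⁻¹ᵁ V) _).hom
      (((hv.basis (V := V ⊓ U) inf_le_right).toMatrix _) k a)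
    rw [Module.Basis.toMatrix_apply, IsCompatibleFrame.basis_apply]

theorem ev_ofMatrix {U : S.Opens} {v : Fin (totalRank h) → Γ(E.H, U)}
    (hv : IsCompatibleFrame (h := h) E.F v) (hU : ⊤ ≤ j ⁻¹ᵁ U)
    (G : Matrix (Fin (totalRank h)) (Fin (totalRank h)) (DiskRing d r A)) (hG : IsUnit G)
    (u : A →+* B) (hU' : ⊤ ≤ (diskSpecMap d r u ≫ j) ⁻¹ᵁ U) (a b : Fin (totalRank h)) :
    (ofMatrix hv hU G hG).ev (diskSpecMap d r u) U hU' b (v a) = diskMap d r u (G a b) := by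
  have hU'' : ⊤ ≤ diskSpecMap d r u ⁻¹ᵁ j ⁻¹ᵁ U := hU'
  change diskPt (diskSpecMap d r u) (j ⁻¹ᵁ U) hU'' (∑ k, _) = _
  rw [map_sum, Finset.sum_eq_single a]
  · rw [map_mul, diskPt_diskSection, ← IsCompatibleFrame.basis_apply hv (V := U ⊓ U) inf_le_right]
    rw [Module.Basis.repr_self, Finsupp.single_eq_same, map_one, map_one, one_mul]
  · intro k _ hk
    rw [map_mul, ← IsCompatibleFrame.basis_apply hv (V := U ⊓ U) inf_le_right,
      Module.Basis.repr_self, Finsupp.single_eq_of_ne hk, map_zero, map_zero, zero_mul]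
  · simp

end

/-- Flatness can be checked on the sections of frames of the bundle. -/
theorem isFlat_of_frames {A : Under R} {x : (jetSpace π d r).obj A} {F : FrameCoords E x.1}
    {ι : Type*} (W : ι → S.affineOpens) (v : ∀ i, Fin (totalRank h) → Γ(E.H, (W i).1))
    (hv : ∀ i, IsCompatibleFrame (h := h) E.F (v i)) (hW : ∀ p, ∃ i, x.1 p ∈ (W i).1)
    (hF : ∀ (i : ι) (B : CommRingCat.{u}) (u : A.right →+* B)
      (hU : ⊤ ≤ (diskSpecMap d r u ≫ x.1) ⁻¹ᵁ (W i).1) (a b : Fin (totalRank h)),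
      IsHorizontalAt (E.nabla (W i)) (diskPt (diskSpecMap d r u ≫ x.1) (W i).1 hU)
        (F.ev (diskSpecMap d r u) (W i).1 hU a) (v i b)) : F.IsFlat := by
  intro B u U hU a s
  choose i hi using fun p : diskSpec d r B => hW (diskSpecMap d r u p)
  -- The affine open sets `U` and `W i` are compared through affine neighbourhoods contained in
  -- both, because the connection is given only over affine open sets.
  choose V _ hVU hxV _ using fun p : diskSpec d r B => E.exists_affine_frame
    (U := U.1 ⊓ (W (i p)).1) (x := x.1 (diskSpecMap d r u p)) ⟨hU (Set.mem_univ p), hi p⟩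
  refine F.isHorizontalAt_of_iSup u hU (fun p => (diskSpecMap d r u ≫ x.1) ⁻¹ᵁ (V p).1)
    (fun p => ⟨p, hxV p⟩) fun p C w hw hU' => ?_
  have hVU1 : (V p).1 ≤ U.1 := (hVU p).trans inf_le_left
  have hVU2 : (V p).1 ≤ (W (i p)).1 := (hVU p).trans inf_le_right
  have hV : ⊤ ≤ (diskSpecMap d r (w.comp u) ≫ x.1) ⁻¹ᵁ (V p).1 := by
    rw [diskSpecMap_comp, Category.assoc]
    exact hw
  have hW' : ⊤ ≤ (diskSpecMap d r (w.comp u) ≫ x.1) ⁻¹ᵁ (W (i p)).1 := fun y hy => hVU2 (hV hy)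
  -- Horizontality at `s` over `U` is moved to `V`. There it follows from horizontality at the
  -- restricted frame, which is moved from `W i`.
  refine (isHorizontalAt_map_iff (structMap_res π hVU1) (resMap E.H hVU1)
    (truncDeriv_diskPt_structMap x _ hU') (truncDeriv_diskPt_structMap x _ hV) _
    (F.ev (diskSpecMap d r (w.comp u)) (V p).1 hV a)
    (fun c => (diskPt_map _ hVU1 hV c).symm) (fun t => (F.ev_resMap _ hVU1 hV a t).symm)
    (E.nabla_res hVU1 s)).mpr ?_
  refine isHorizontalAt_of_span (E.isFlatConnection (V p)) (truncDeriv_diskPt_structMap x _ hV) _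
    ((hv (i p)).res hVU2).span_range (fun b => ?_) _
  exact (isHorizontalAt_map_iff (structMap_res π hVU2) (resMap E.H hVU2)
    (truncDeriv_diskPt_structMap x _ hW') (truncDeriv_diskPt_structMap x _ hV) _
    (F.ev (diskSpecMap d r (w.comp u)) (V p).1 hV a)
    (fun c => (diskPt_map _ hVU2 hV c).symm) (fun t => (F.ev_resMap _ hVU2 hV a t).symm)
    (E.nabla_res hVU2 (v (i p) b))).mp (hF (i p) C (w.comp u) hW' a b)

end FrameCoords

namespace FramedJet

/-- The matrix solution of the horizontal system defines the frame. Its flatness need be checked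
only on members of the bundle frame and over `A` itself, as horizontality is stable under change of
base. -/
theorem exists_of_frame {A : Under R} (hr : IsUnit ((r.factorial : ℕ) : A.right))
    (x : (jetSpace π d r).obj A) {W : S.affineOpens} {v : Fin (totalRank h) → Γ(E.H, W.1)}
    (hv : IsCompatibleFrame (h := h) E.F v) (hW : ⊤ ≤ x.1 ⁻¹ᵁ W.1) :
    ∃ p : FramedJet E d r A, p.jet = x := by
  have hW' : ⊤ ≤ (diskSpecMap d r (RingHom.id A.right) ≫ x.1) ⁻¹ᵁ W.1 := fun y _ =>
    hW (Set.mem_univ _)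
  obtain ⟨G, hG, hl⟩ := exists_horizontal_matrix hr (E.isFlatConnection W)
    (truncDeriv_diskPt_structMap x _ hW') (hv.basis le_rfl)
  refine ⟨⟨x, .ofMatrix hv hW G hG, ?_⟩, rfl⟩
  refine FrameCoords.isFlat_of_frames (ι := Unit) (fun _ => W) (fun _ => v) (fun _ => hv)
    (fun p => ⟨(), hW (Set.mem_univ p)⟩) fun _ B u hU a b => ?_
  have h1 := hl a ((FrameCoords.ofMatrix hv hW G hG).ev (diskSpecMap d r (RingHom.id _)) W.1 hW' a)
    (fun b => by
      rw [IsCompatibleFrame.basis_apply, resMap_self]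
      refine (FrameCoords.ev_ofMatrix hv hW G hG (RingHom.id _) hW' b a).trans ?_
      rw [diskMap_id]
      rfl) b
  rw [IsCompatibleFrame.basis_apply, resMap_self] at h1
  exact isHorizontalAt_congr (h1.diskMap u) (fun c => (FrameCoords.diskPt_comp _ _ u hW' hU c).symm)
    fun t => (FrameCoords.ev_comp _ _ u hW' hU a t).symm

end FramedJet

end FramesFromBundleFrames

/-! ### Simple transitivity of `GL_m` on flat frames -/

section Torsor

/-- The matrix relating two horizontal frames is constant. -/
theorem truncDeriv_eq_zero_of_horizontal {R C : CommRingCat.{u}} {f : R ⟶ C} {M : Type u}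
    [AddCommGroup M] [Module C M] {d r m : ℕ} {A : Type u} [CommRing A]
    {nabla : M → CommRingCat.KaehlerDifferential f ⊗[C] M} {φ : C →+* DiskRing d r A}
    {l l' : Fin m → M →ₛₗ[φ] DiskRing d r A} {v : Fin m → M}
    (hv : Submodule.span C (Set.range v) = ⊤)
    (hl : ∀ a b, IsHorizontalAt nabla φ (l b) (v a))
    (hl' : ∀ a b, IsHorizontalAt nabla φ (l' b) (v a))
    {T : Matrix (Fin m) (Fin m) (DiskRing d r A)} (hT : ∀ a c, l' c (v a) = ∑ b, l b (v a) * T b c)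
    (hu : IsUnit (Matrix.of fun a b => l b (v a))) (b c : Fin m) (i : Fin d) :
    truncDeriv r i (T b c) = 0 := by
  have hT' : ∀ s c, l' c s = ∑ b, l b s * T b c := by
    intro s c
    have hs : s ∈ Submodule.span C (Set.range v) := hv ▸ Submodule.mem_top
    induction hs using Submodule.span_induction with
    | mem x hx =>
      obtain ⟨a, rfl⟩ := hx
      exact hT a c
    | zero => simp
    | add x y _ _ hx hy => simp only [map_add, hx, hy, add_mul, Finset.sum_add_distrib]
    | smul a x _ hx =>
      simp only [LinearMap.map_smulₛₗ, hx, smul_eq_mul, Finset.mul_sum, mul_assoc]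
  -- Differentiate `l' c = ∑ b, l b * T b c`. The terms with derivatives of `l b` already account
  -- for the horizontality of `l' c`, so what remains is the matrix of the `l b` times `∂ᵢ T`, which
  -- must vanish; that matrix is invertible.
  have key : (Matrix.of fun a b => l b (v a)).map (truncSucc d r A) *
      (Matrix.of fun b c => truncDeriv r i (T b c)) = 0 := by
    ext a c
    obtain ⟨n, x, y, e, hx⟩ := exists_eq_sum_smul_d_tmul (f := f) M (id : M → M) (by simp) (nabla (v a))
    have h1 := hl' a c n x y _ hx i
    rw [hT', map_sum] at h1
    simp only [truncDeriv_mul, hl a _ n x y _ hx i, hT', Finset.sum_add_distrib] at h1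
    rw [Matrix.mul_apply]
    simp only [Matrix.map_apply, Matrix.of_apply, Matrix.zero_apply]
    have h2 : ∑ k, truncSucc d r A (φ (x k) * ∑ b, l b (id (e k)) * T b c) *
        truncDeriv r i (φ (y k)) = ∑ b, truncSucc d r A (T b c) *
          ∑ k, truncSucc d r A (φ (x k) * l b (id (e k))) * truncDeriv r i (φ (y k)) := by
      simp only [Finset.mul_sum, map_sum, Finset.sum_mul]
      rw [Finset.sum_comm]
      refine Finset.sum_congr rfl fun b _ => Finset.sum_congr rfl fun k _ => ?_
      simp only [map_mul]
      ring
    rw [h2] at h1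
    exact add_eq_right.mp h1
  have h3 := hu.map (truncSucc d r A).mapMatrix
  have h4 := (h3.mul_right_eq_zero).mp key
  exact congr_fun (congr_fun h4 b) c

section GluingGL

variable {A : Type u} [CommRing A] {s : Set A} {m : ℕ}

theorem GL_ext_of_away (hs : Ideal.span s = ⊤) {g g' : GL (Fin m) A}
    (h : ∀ f ∈ s, Matrix.GeneralLinearGroup.map (algebraMap A (Localization.Away f)) g =
      Matrix.GeneralLinearGroup.map (algebraMap A (Localization.Away f)) g') : g = g' := by
  refine Units.ext (Matrix.ext fun i j => sub_eq_zero.mp (eq_zero_of_forall_away hs fun f hf => ?_))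
  rw [map_sub, sub_eq_zero]
  exact congrArg (fun g : GL (Fin m) _ => g.1 i j) (h f hf)

/-- The entries of the matrices and those of their inverses are glued separately; that the results
are inverse to each other holds locally, hence globally. -/
theorem exists_glue_GL (hs : Ideal.span s = ⊤) (g : ∀ f : s, GL (Fin m) (Localization.Away f.1))
    (hg : ∀ f f' : s, Matrix.GeneralLinearGroup.map (IsLocalization.Away.awayToAwayRight
        (P := Localization.Away (f.1 * f'.1)) f.1 f'.1) (g f) =
      Matrix.GeneralLinearGroup.map (IsLocalization.Away.awayToAwayLeft
        (P := Localization.Away (f.1 * f'.1)) f'.1 f.1) (g f')) :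
    ∃ N : GL (Fin m) A, ∀ f : s,
      Matrix.GeneralLinearGroup.map (algebraMap A (Localization.Away f.1)) N = g f := by
  choose N hN _ using fun i j => Localization.existsUnique_algebraMap_eq_of_span_eq_top s hs
    (fun f => (g f).1 i j) fun f f' => congrArg (fun g : GL (Fin m) _ => g.1 i j) (hg f f')
  choose N' hN' _ using fun i j => Localization.existsUnique_algebraMap_eq_of_span_eq_top s hs
    (fun f => ((g f)⁻¹).1 i j) fun f f' => by
      have := congrArg (fun g : GL (Fin m) _ => (g⁻¹).1 i j) (hg f f')
      simp only [← map_inv] at this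
      exact this
  have one : ∀ (f : s) (i j : Fin m), algebraMap A (Localization.Away f.1) ((1 : Matrix _ _ A) i j) =
      (1 : Matrix _ _ _) i j := fun f i j => congr_fun (congr_fun
    (Matrix.map_one (algebraMap A (Localization.Away f.1)) (map_zero _) (map_one _)) i) j
  refine ⟨⟨Matrix.of N, Matrix.of N', ?_, ?_⟩, fun f => Units.ext (Matrix.ext fun i j => hN i j f)⟩
  · refine Matrix.ext fun i j => sub_eq_zero.mp (eq_zero_of_forall_away hs fun f hf => ?_)
    rw [map_sub, sub_eq_zero, Matrix.mul_apply, map_sum, one ⟨f, hf⟩, ← (g ⟨f, hf⟩).mul_inv,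
      Matrix.mul_apply]
    refine Finset.sum_congr rfl fun k _ => ?_
    rw [map_mul]
    exact congrArg₂ (· * ·) (hN i k ⟨f, hf⟩) (hN' k j ⟨f, hf⟩)
  · refine Matrix.ext fun i j => sub_eq_zero.mp (eq_zero_of_forall_away hs fun f hf => ?_)
    rw [map_sub, sub_eq_zero, Matrix.mul_apply, map_sum, one ⟨f, hf⟩, ← (g ⟨f, hf⟩).inv_mul,
      Matrix.mul_apply]
    refine Finset.sum_congr rfl fun k _ => ?_
    rw [map_mul]
    exact congrArg₂ (· * ·) (hN' i k ⟨f, hf⟩) (hN k j ⟨f, hf⟩)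

end GluingGL

variable {R : CommRingCat.{u}} {S : Scheme.{u}} {π : S ⟶ Spec R} {h : ℤ →₀ ℕ}
  {E : FlatFilteredBundle π h} {d r : ℕ}

namespace FrameCoords

/-- If `C` and `C'` are the matrices of coordinates of `v` in the two frames, then `T = C⁻¹ C'`
relates two horizontal systems. Its derivatives vanish, and with `r!` invertible its entries are
constants. -/
theorem exists_act_eq {A : Under R} (hr : IsUnit ((r.factorial : ℕ) : A.right))
    {x : (jetSpace π d r).obj A} {F F' : FrameCoords E x.1} (hF : F.IsFlat) (hF' : F'.IsFlat)
    {W : S.affineOpens} {v : Fin (totalRank h) → Γ(E.H, W.1)}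
    (hv : IsCompatibleFrame (h := h) E.F v)
    (hW : ⊤ ≤ (diskSpecMap d r (RingHom.id A.right) ≫ x.1) ⁻¹ᵁ W.1) :
    ∃ g : GL (Fin (totalRank h)) A.right, F.act g = F' := by
  set C := Matrix.of fun a b => F.ev (diskSpecMap d r (RingHom.id A.right)) W.1 hW b (v a) with hC
  set C' := Matrix.of fun a b => F'.ev (diskSpecMap d r (RingHom.id A.right)) W.1 hW b (v a) with hC'
  have hu : IsUnit C := F.isUnit_ev _ hv hW
  have hu' : IsUnit C' := F'.isUnit_ev _ hv hW
  have hCT : C * (C⁻¹ * C') = C' := by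
    rw [← mul_assoc, Matrix.mul_nonsing_inv _ ((Matrix.isUnit_iff_isUnit_det _).mp hu), one_mul]
  set T := C⁻¹ * C' with hT
  have hTu : IsUnit T := ((Matrix.isUnit_nonsing_inv_iff).mpr hu).mul hu'
  have hsum : ∀ a c, C' a c = ∑ b, C a b * T b c := fun a c => by
    rw [← Matrix.mul_apply, hCT]
  have hconst : ∀ b c, T b c = diskConst d r A.right (diskEval d r A.right (T b c)) := fun b c =>
    eq_const_of_truncDeriv_eq_zero hr fun i => truncDeriv_eq_zero_of_horizontal hv.span_range
      (fun a b => hF A.right (RingHom.id _) W hW b (v a))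
      (fun a b => hF' A.right (RingHom.id _) W hW b (v a)) hsum hu b c i
  -- The group acts on vectors of coordinates from the left, whereas `T` multiplies `C` from the
  -- right; hence the transpose.
  have hgu : IsUnit ((diskEval d r A.right).mapMatrix T).transpose :=
    (Matrix.isUnit_transpose _).mpr (hTu.map (diskEval d r A.right).mapMatrix)
  refine ⟨hgu.unit, ext_of_frame hv hW fun a b => ?_⟩
  refine (F.ev_act _ _ hW b (v a)).trans (Eq.trans ?_ (hsum a b).symm)
  refine Finset.sum_congr rfl fun k _ => ?_
  rw [mul_comm]
  exact congrArg (C a k * ·) (hconst k b).symm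

/-- The matrix `C` of coordinates of a bundle frame is invertible and can be cancelled, and
constants inject into the disk ring. -/
theorem act_injective {A : Under R} {x : (jetSpace π d r).obj A} (F : FrameCoords E x.1)
    {W : S.Opens} {v : Fin (totalRank h) → Γ(E.H, W)} (hv : IsCompatibleFrame (h := h) E.F v)
    (hW : ⊤ ≤ (diskSpecMap d r (RingHom.id A.right) ≫ x.1) ⁻¹ᵁ W)
    {g g' : GL (Fin (totalRank h)) A.right} (hg : F.act g = F.act g') : g = g' := by
  have hu := F.isUnit_ev (diskSpecMap d r (RingHom.id A.right)) hv hW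
  set C := Matrix.of fun a b => F.ev (diskSpecMap d r (RingHom.id A.right)) W hW b (v a) with hC
  have key : ∀ g : GL (Fin (totalRank h)) A.right,
      C * ((diskConst d r A.right).mapMatrix g.1).transpose = Matrix.of fun a b =>
        (F.act g).ev (diskSpecMap d r (RingHom.id A.right)) W hW b (v a) := by
    intro g
    ext1 a b
    refine Eq.trans ?_ (F.ev_act g _ hW b (v a)).symm
    rw [Matrix.mul_apply]
    exact Finset.sum_congr rfl fun k _ => mul_comm _ _
  have h1 := (key g).trans ((congrArg (fun F' : FrameCoords E x.1 => Matrix.of fun a b =>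
    F'.ev (diskSpecMap d r (RingHom.id A.right)) W hW b (v a)) hg).trans (key g').symm)
  have h2 := hu.mul_left_cancel h1
  refine Units.ext (Matrix.ext fun i j => ?_)
  have h3 : diskConst d r A.right (g.1 i j) = diskConst d r A.right (g'.1 i j) :=
    congr_fun (congr_fun h2 j) i
  rw [← diskEval_diskConst (d := d) (r := r) (g.1 i j), h3, diskEval_diskConst]

end FrameCoords

theorem awayToAwayRight_comp_algebraMap {A : Type*} [CommRing A] (x y : A) (S P : Type*)
    [CommRing S] [CommRing P] [Algebra A S] [Algebra A P] [IsLocalization.Away x S]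
    [IsLocalization.Away (x * y) P] :
    (IsLocalization.Away.awayToAwayRight (S := S) (P := P) x y).comp (algebraMap A S) =
      algebraMap A P :=
  RingHom.ext (IsLocalization.Away.awayToAwayRight_eq x y)

theorem awayToAwayLeft_comp_algebraMap {A : Type*} [CommRing A] (x y : A) (S P : Type*)
    [CommRing S] [CommRing P] [Algebra A S] [Algebra A P] [IsLocalization.Away x S]
    [IsLocalization.Away (y * x) P] :
    (IsLocalization.Away.awayToAwayLeft (S := S) (P := P) x y).comp (algebraMap A S) =
      algebraMap A P :=
  RingHom.ext (IsLocalization.Away.awayToAwayLeft_eq x y)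

/-- A homomorphism from a localization of `A` to a localization of `A`, under `R`. -/
def awayHom {A : Under R} {f g : A.right} (t : Localization.Away f →+* Localization.Away g)
    (ht : t.comp (algebraMap A.right _) = algebraMap A.right _) : away A f ⟶ away A g :=
  Under.homMk (CommRingCat.ofHom t) (by
    change (A.hom ≫ CommRingCat.ofHom _) ≫ _ = A.hom ≫ CommRingCat.ofHom _
    rw [Category.assoc, ← CommRingCat.ofHom_comp, ht])

theorem toAway_awayHom {A : Under R} {f g : A.right}
    (t : Localization.Away f →+* Localization.Away g)
    (ht : t.comp (algebraMap A.right _) = algebraMap A.right _) :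
    toAway A f ≫ awayHom t ht = toAway A g := by
  ext1
  change CommRingCat.ofHom _ ≫ CommRingCat.ofHom _ = CommRingCat.ofHom _
  rw [← CommRingCat.ofHom_comp, ht]

namespace FramedJet

theorem exists_smul_eq_of_frame {A : Under R} (hr : IsUnit ((r.factorial : ℕ) : A.right))
    {p q : FramedJet E d r A} (hpq : p.jet = q.jet) {W : S.affineOpens}
    {v : Fin (totalRank h) → Γ(E.H, W.1)} (hv : IsCompatibleFrame (h := h) E.F v)
    (hW : ⊤ ≤ (diskSpecMap d r (RingHom.id A.right) ≫ p.jet.1) ⁻¹ᵁ W.1) :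
    ∃ g : GL (Fin (totalRank h)) A.right, g • p = q := by
  obtain ⟨x, F, hF⟩ := p
  obtain ⟨F', hF', rfl⟩ := exists_eq_mk hpq.symm
  obtain ⟨g, hg⟩ := FrameCoords.exists_act_eq hr hF hF' hv hW
  exact ⟨g, mk_congr x hg _ _⟩

theorem smul_injective_of_frame {A : Under R} {p : FramedJet E d r A} {W : S.Opens}
    {v : Fin (totalRank h) → Γ(E.H, W)} (hv : IsCompatibleFrame (h := h) E.F v)
    (hW : ⊤ ≤ (diskSpecMap d r (RingHom.id A.right) ≫ p.jet.1) ⁻¹ᵁ W)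
    {g g' : GL (Fin (totalRank h)) A.right} (hg : g • p = g' • p) : g = g' := by
  refine FrameCoords.act_injective p.frame hv hW ?_
  have h1 : FramedJet.mk p.jet (p.frame.act g) (p.isFlat.act g) =
    ⟨p.jet, p.frame.act g', p.isFlat.act g'⟩ := hg
  injection h1

theorem exists_cover (E : FlatFilteredBundle π h) {A : Under R} (x : (jetSpace π d r).obj A) :
    ∃ s : Set A.right, Ideal.span s = ⊤ ∧ ∀ f ∈ s, ∃ (W : S.affineOpens)
      (v : Fin (totalRank h) → Γ(E.H, W.1)), IsCompatibleFrame (h := h) E.F v ∧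
      ⊤ ≤ (diskSpecMap d r (algebraMap A.right (Localization.Away f)) ≫ x.1) ⁻¹ᵁ W.1 := by
  choose W v _ hxW hv using fun y : diskSpec d r A.right => E.exists_affine_frame
    (U := ⊤) (x := x.1 y) trivial
  refine ⟨_, span_eq_top_of_iSup_opens (fun y => x.1 ⁻¹ᵁ (W y).1) fun y => ⟨y, hxW y⟩, ?_⟩
  rintro f ⟨y, hy⟩
  exact ⟨W y, v y, hv y, hy⟩

theorem exists_locally {A : Under R} (hr : IsUnit ((r.factorial : ℕ) : R))
    (E : FlatFilteredBundle π h) (x : (jetSpace π d r).obj A) :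
    ∃ s : Set A.right, Ideal.span s = ⊤ ∧ ∀ f ∈ s, ∃ p : FramedJet E d r (away A f),
      p.jet = (jetSpace π d r).map (toAway A f) x := by
  obtain ⟨s, hs, hW⟩ := exists_cover E x
  refine ⟨s, hs, fun f hf => ?_⟩
  obtain ⟨W, v, hv, hW⟩ := hW f hf
  refine exists_of_frame ?_ ((jetSpace π d r).map (toAway A f) x) hv hW
  simpa using hr.map (away A f).hom.hom

/-- Over a cover the jet lands in domains of bundle frames, where the group acts transitively and
freely. Freeness on overlaps makes the local matrices agree there, so they glue to an element of
`GL_m(A)`. -/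
theorem existsUnique_smul {A : Under R} (hr : IsUnit ((r.factorial : ℕ) : R))
    (p q : FramedJet E d r A) (hpq : p.jet = q.jet) :
    ∃! g : GL (Fin (totalRank h)) A.right, g • p = q := by
  obtain ⟨s, hs, hW⟩ := exists_cover E p.jet
  choose W v hv hW using hW
  have hjet : ∀ {B : Under R} (u : A ⟶ B), diskSpecMap d r (RingHom.id B.right) ≫ (p.map u).jet.1 =
      diskSpecMap d r u.right.hom ≫ p.jet.1 := fun u => by
    rw [diskSpecMap_id]
    exact Category.id_comp _
  -- Freeness is stated over every algebra over the localization, because the local matrices are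
  -- compared over the localization at `f f'`.
  have inj : ∀ (f : A.right) (hf : f ∈ s) {B : Under R} (u : away A f ⟶ B)
      {g g' : GL (Fin (totalRank h)) B.right},
      g • p.map (toAway A f ≫ u) = g' • p.map (toAway A f ≫ u) → g = g' := by
    intro f hf B u g g' hg
    refine smul_injective_of_frame (hv f hf) ?_ hg
    rw [hjet]
    have : diskSpecMap d r (toAway A f ≫ u).right.hom =
      diskSpecMap d r u.right.hom ≫ diskSpecMap d r (toAway A f).right.hom :=
      diskSpecMap_comp _ _ _ _
    rw [this]
    exact fun y _ => hW f hf (Set.mem_univ _)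
  have ex : ∀ f : s, ∃ g : GL (Fin (totalRank h)) (Localization.Away f.1),
      (show GL (Fin (totalRank h)) (away A f.1).right from g) • p.map (toAway A f.1) =
        q.map (toAway A f.1) := by
    intro f
    refine exists_smul_eq_of_frame (A := away A f.1) (by simpa using hr.map (away A f.1).hom.hom)
      (congrArg ((jetSpace π d r).map (toAway A f.1)) hpq) (hv f.1 f.2) ?_
    rw [hjet]
    exact hW f.1 f.2
  choose g hg using ex
  have hg' : ∀ (f : s) {B : Under R} (u : away A f.1 ⟶ B),
      Matrix.GeneralLinearGroup.map u.right.hom (g f) • p.map (toAway A f.1 ≫ u) =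
        q.map (toAway A f.1 ≫ u) := by
    intro f B u
    rw [← map_map, ← map_map, ← hg f, map_smul]
  have glue : ∀ (f f' : s) (k : A.right) (t : Localization.Away f.1 →+* Localization.Away k)
      (t' : Localization.Away f'.1 →+* Localization.Away k),
      t.comp (algebraMap A.right _) = algebraMap A.right _ →
      t'.comp (algebraMap A.right _) = algebraMap A.right _ →
      Matrix.GeneralLinearGroup.map t (g f) = Matrix.GeneralLinearGroup.map t' (g f') := by
    intro f f' k t t' ht ht'
    have h1 := hg' f (awayHom t ht)
    have h2 := hg' f' (awayHom t' ht')
    rw [toAway_awayHom, ← toAway_awayHom t ht] at h2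
    exact inj f.1 f.2 (awayHom t ht) (h1.trans h2.symm)
  have hglue : ∀ f f' : s, Matrix.GeneralLinearGroup.map (IsLocalization.Away.awayToAwayRight
        (P := Localization.Away (f.1 * f'.1)) f.1 f'.1) (g f) =
      Matrix.GeneralLinearGroup.map (IsLocalization.Away.awayToAwayLeft
        (P := Localization.Away (f.1 * f'.1)) f'.1 f.1) (g f') := by
    intro f f'
    apply glue
    · exact awayToAwayRight_comp_algebraMap _ _ _ _
    · exact awayToAwayLeft_comp_algebraMap _ _ _ _
  obtain ⟨N, hN⟩ := exists_glue_GL hs g hglue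
  refine ⟨N, ?_, fun N' hN' => GL_ext_of_away hs fun f hf => ?_⟩
  -- Both `N • p` and `q` glue the restrictions of `q`, so the uniqueness in the sheaf property
  -- identifies them.
  · refine ((isSheaf E d r A s hs (fun f => q.map (toAway A f.1)) fun f f' B a b hab => ?_).unique
      (y₁ := N • p) (y₂ := q) (fun f => ?_) fun f => rfl)
    · exact (map_map _ _ q).trans ((congrArg q.map hab).trans (map_map _ _ q).symm)
    · refine (map_smul (toAway A f.1) N p).trans (Eq.trans ?_ (hg f))
      exact congrArg (fun g : GL (Fin (totalRank h)) (away A f.1).right =>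
        g • p.map (toAway A f.1)) (hN f)
  · rw [hN ⟨f, hf⟩]
    have h1 := (map_smul (toAway A f) N' p).symm.trans (congrArg (FramedJet.map (toAway A f)) hN')
    have h2 := h1.trans (hg ⟨f, hf⟩).symm
    have h3 := inj f hf (𝟙 _) (g := Matrix.GeneralLinearGroup.map (toAway A f).right.hom N')
      (g' := g ⟨f, hf⟩)
    rw [Category.comp_id] at h3
    exact h3 h2

end FramedJet

end Torsor

/-! ### Local nature of flags -/

section FlagGluing

/-! ### Base change of submodules to a localization -/

section Away

variable {D D' : Type u} [CommRing D] [CommRing D'] [Algebra D D'] (a : D)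
  [IsLocalization.Away a D'] {n : ℕ}

/-- Clearing of denominators: a finite combination of images of vectors of `N` involves only
finitely many powers of `a` in its coefficients. -/
theorem exists_pow_smul_eq_of_mem_baseChangeStep {N : Submodule D (Fin n → D)} {y : Fin n → D'}
    (hy : y ∈ baseChangeStep (algebraMap D D') N) :
    ∃ (k : ℕ) (z : Fin n → D), z ∈ N ∧ a ^ k • y = fun i => algebraMap D D' (z i) := by
  induction hy using Submodule.span_induction with
  | mem x hx =>
    obtain ⟨z, hz, rfl⟩ := hx
    exact ⟨0, z, hz, by rw [pow_zero, one_smul]⟩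
  | zero => exact ⟨0, 0, N.zero_mem, by ext; simp⟩
  | add x y _ _ hx hy =>
    obtain ⟨k, z, hz, hzx⟩ := hx
    obtain ⟨l, w, hw, hwy⟩ := hy
    refine ⟨k + l, a ^ l • z + a ^ k • w, N.add_mem (N.smul_mem _ hz) (N.smul_mem _ hw), ?_⟩
    have : a ^ (k + l) • (x + y) = a ^ l • (a ^ k • x) + a ^ k • (a ^ l • y) := by
      rw [smul_add, smul_smul, smul_smul, pow_add, mul_comm]
    rw [this, hzx, hwy]
    ext i
    simp [Algebra.smul_def]
  | smul c x _ hx =>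
    obtain ⟨k, z, hz, hzx⟩ := hx
    obtain ⟨⟨c', _, ⟨l, rfl⟩⟩, hc⟩ := IsLocalization.surj (Submonoid.powers a) c
    refine ⟨k + l, c' • z, N.smul_mem _ hz, ?_⟩
    have : a ^ (k + l) • c • x = (c * algebraMap D D' (a ^ l)) • (a ^ k • x) := by
      ext i
      simp only [Pi.smul_apply, smul_eq_mul, Algebra.smul_def (R := D) (A := D'), map_pow, map_mul, pow_add]
      ring
    simp only at hc
    rw [this, hc, hzx]
    ext i
    simp

/-- After denominators are cleared, two vectors over `D` agree in the localization. Each coordinate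
needs its own further power of `a`, and the sum of the exponents serves for all. -/
theorem exists_pow_smul_mem_of_mem_baseChangeStep {N : Submodule D (Fin n → D)} {x : Fin n → D}
    (hx : (fun i => algebraMap D D' (x i)) ∈ baseChangeStep (algebraMap D D') N) :
    ∃ k : ℕ, a ^ k • x ∈ N := by
  obtain ⟨k, z, hz, hzx⟩ := exists_pow_smul_eq_of_mem_baseChangeStep a hx
  have h1 : ∀ i, ∃ l : ℕ, a ^ l * (a ^ k * x i) = a ^ l * z i := fun i => by
    have h2 := congr_fun hzx i
    simp only [Pi.smul_apply, Algebra.smul_def, ← map_mul] at h2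
    obtain ⟨⟨_, l, rfl⟩, hl⟩ := (IsLocalization.eq_iff_exists (Submonoid.powers a) D').mp h2
    exact ⟨l, hl⟩
  choose l hl using h1
  refine ⟨(∑ i, l i) + k, ?_⟩
  have : a ^ ((∑ i, l i) + k) • x = a ^ (∑ i, l i) • z := by
    ext i
    obtain ⟨t, ht⟩ := Nat.exists_eq_add_of_le (Finset.single_le_sum (f := l)
      (fun _ _ => Nat.zero_le _) (Finset.mem_univ i))
    simp only [Pi.smul_apply, smul_eq_mul]
    rw [ht, pow_add, pow_add]
    linear_combination a ^ t * hl i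
  rw [this]
  exact N.smul_mem _ hz

/-- The map from the quotient of two submodules to the quotient of their base changes. -/
def quotientBaseChange (D' : Type u) [CommRing D'] [Algebra D D'] (N N' : Submodule D (Fin n → D)) :
    (N ⧸ N'.submoduleOf N) →ₗ[D] (baseChangeStep (algebraMap D D') N ⧸
      (baseChangeStep (algebraMap D D') N').submoduleOf (baseChangeStep (algebraMap D D') N)) :=
  Submodule.liftQ _
    { toFun := fun x => Submodule.Quotient.mk ⟨fun i => algebraMap D D' (x.1 i),
        Submodule.subset_span ⟨x.1, x.2, rfl⟩⟩
      map_add' := fun x y => by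
        rw [← Submodule.Quotient.mk_add]
        congr 1
        ext i
        simp
      map_smul' := fun c x => by
        rw [RingHom.id_apply, ← Submodule.Quotient.mk_smul]
        congr 1
        ext i
        simp [Algebra.smul_def] } <| by
    intro x hx
    exact (Submodule.Quotient.mk_eq_zero _).mpr (Submodule.subset_span ⟨x.1, hx, rfl⟩)

/-- Surjectivity up to denominators and injectivity up to `a`-power torsion are the two preceding
lemmas. Thus the graded pieces of a base-changed filtration are the localized graded pieces. -/
instance isLocalizedModule_quotientBaseChange (N N' : Submodule D (Fin n → D)) :
    IsLocalizedModule (Submonoid.powers a) (quotientBaseChange D' N N') where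
  map_units := by
    rintro ⟨_, k, rfl⟩
    rw [Module.End.isUnit_iff]
    have hu : IsUnit (algebraMap D D' (a ^ k)) :=
      IsLocalization.map_units D' (⟨a ^ k, k, rfl⟩ : Submonoid.powers a)
    have : ∀ y, (algebraMap D (Module.End D (baseChangeStep (algebraMap D D') N ⧸
      (baseChangeStep (algebraMap D D') N').submoduleOf (baseChangeStep (algebraMap D D') N)))
        (a ^ k)) y = algebraMap D D' (a ^ k) • y := fun y => (algebraMap_smul D' (a ^ k) y).symm
    constructor
    · intro x y hxy
      simp only [this] at hxy
      exact (hu.smul_left_cancel).mp hxy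
    · intro y
      refine ⟨(hu.unit⁻¹ : D'ˣ).1 • y, ?_⟩
      rw [this, smul_smul, IsUnit.mul_val_inv, one_smul]
  surj y := by
    obtain ⟨y, rfl⟩ := Submodule.Quotient.mk_surjective _ y
    obtain ⟨k, z, hz, hzy⟩ := exists_pow_smul_eq_of_mem_baseChangeStep a y.2
    refine ⟨⟨Submodule.Quotient.mk ⟨z, hz⟩, ⟨a ^ k, k, rfl⟩⟩, ?_⟩
    change Submodule.Quotient.mk (a ^ k • y) = Submodule.Quotient.mk _
    congr 1
    exact Subtype.ext hzy
  exists_of_eq {x x'} hxx := by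
    obtain ⟨x, rfl⟩ := Submodule.Quotient.mk_surjective _ x
    obtain ⟨x', rfl⟩ := Submodule.Quotient.mk_surjective _ x'
    have h1 := (Submodule.Quotient.eq _).mp hxx
    have h2 : (fun i => algebraMap D D' ((x.1 - x'.1) i)) ∈
        baseChangeStep (algebraMap D D') N' := by
      convert (show _ ∈ baseChangeStep (algebraMap D D') N' from h1) using 1
      ext i
      simp
    obtain ⟨k, hk⟩ := exists_pow_smul_mem_of_mem_baseChangeStep a h2
    refine ⟨⟨a ^ k, k, rfl⟩, ?_⟩
    change Submodule.Quotient.mk (a ^ k • x) = Submodule.Quotient.mk (a ^ k • x')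
    rw [Submodule.Quotient.eq]
    change a ^ k • x.1 - a ^ k • x'.1 ∈ N'
    rwa [← smul_sub]

end Away

/-! ### Descent of graded locally free filtrations -/

section Span

variable {D : Type u} [CommRing D] {s : Set D} {Dp : s → Type u} [∀ g, CommRing (Dp g)]
  [∀ g, Algebra D (Dp g)] [∀ g, IsLocalization.Away g.1 (Dp g)] {n : ℕ}

theorem mem_of_forall_mem_baseChangeStep (hs : Ideal.span s = ⊤) (Dp : s → Type u)
    [∀ g, CommRing (Dp g)] [∀ g, Algebra D (Dp g)] [∀ g, IsLocalization.Away g.1 (Dp g)]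
    {N : Submodule D (Fin n → D)} {x : Fin n → D}
    (hx : ∀ g : s, (fun i => algebraMap D (Dp g) (x i)) ∈
      baseChangeStep (algebraMap D (Dp g)) N) : x ∈ N := by
  refine Submodule.mem_of_span_eq_top_of_smul_pow_mem N s hs x fun g => ?_
  exact exists_pow_smul_mem_of_mem_baseChangeStep g.1 (hx g)

theorem baseChangeStep_ext_of_away (hs : Ideal.span s = ⊤) (Dp : s → Type u)
    [∀ g, CommRing (Dp g)] [∀ g, Algebra D (Dp g)] [∀ g, IsLocalization.Away g.1 (Dp g)]
    {N N' : Submodule D (Fin n → D)} (h : ∀ g : s, baseChangeStep (algebraMap D (Dp g)) N =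
      baseChangeStep (algebraMap D (Dp g)) N') : N = N' := by
  apply le_antisymm
  · intro x hx
    refine mem_of_forall_mem_baseChangeStep hs Dp fun g => ?_
    rw [← h g]
    exact Submodule.subset_span ⟨x, hx, rfl⟩
  · intro x hx
    refine mem_of_forall_mem_baseChangeStep hs Dp fun g => ?_
    rw [h g]
    exact Submodule.subset_span ⟨x, hx, rfl⟩

/-- Finite presentation and flatness can be checked on a Zariski cover, and together they give
projectivity. The rank at a prime is read off over any localization `Dp g` with `g` outside that
prime. -/
theorem isGLF_of_away (hs : Ideal.span s = ⊤) (Dp : s → Type u)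
    [∀ g, CommRing (Dp g)] [∀ g, Algebra D (Dp g)] [∀ g, IsLocalization.Away g.1 (Dp g)]
    {h : ℤ →₀ ℕ} {F : ℤ → Submodule D (Fin (totalRank h) → D)} (hanti : Antitone F)
    (hexh : ∃ a, F a = ⊤) (hsep : ∃ b, F b = ⊥)
    (hF : ∀ g, IsGLF h fun k => baseChangeStep (algebraMap D (Dp g)) (F k)) : IsGLF h F := by
  have hfp : ∀ k, Module.FinitePresentation D (F k ⧸ (F (k + 1)).submoduleOf (F k)) := fun k =>
    Module.FinitePresentation.of_localizationSpan' (Rₚ := Dp) s hs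
      (Mₚ := fun g => baseChangeStep (algebraMap D (Dp g)) (F k) ⧸
        (baseChangeStep (algebraMap D (Dp g)) (F (k + 1))).submoduleOf
          (baseChangeStep (algebraMap D (Dp g)) (F k)))
      (fun g => quotientBaseChange (Dp g) (F k) (F (k + 1))) fun g => by
        have := (hF g).finite k
        have := (hF g).projective k
        exact Module.finitePresentation_of_projective _ _
  have hproj : ∀ k, Module.Projective D (F k ⧸ (F (k + 1)).submoduleOf (F k)) := fun k => by
    have := hfp k
    have : Module.Flat D (F k ⧸ (F (k + 1)).submoduleOf (F k)) :=
      Module.flat_of_isLocalized_span _ _ s hs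
        (fun g => baseChangeStep (algebraMap D (Dp g)) (F k) ⧸
          (baseChangeStep (algebraMap D (Dp g)) (F (k + 1))).submoduleOf
            (baseChangeStep (algebraMap D (Dp g)) (F k)))
        (fun g => quotientBaseChange (Dp g) (F k) (F (k + 1))) fun g => by
          have := (hF g).projective k
          have : Module.Flat D (Dp g) := IsLocalization.flat (Dp g) (Submonoid.powers g.1)
          exact Module.Flat.trans D (Dp g) _
    exact Module.Flat.projective_of_finitePresentation
  refine ⟨hanti, hexh, hsep, fun k => ?_, hproj, fun k => ?_⟩
  · have := hfp k
    infer_instance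
  · have := hfp k
    have := hproj k
    ext p
    obtain ⟨g, hg⟩ : ∃ g : s, g.1 ∉ p.asIdeal := by
      by_contra! hc
      exact p.2.ne_top (top_le_iff.mp (hs ▸ Ideal.span_le.mpr fun g hg => hc ⟨g, hg⟩))
    obtain ⟨P, rfl⟩ : p ∈ Set.range (PrimeSpectrum.comap (algebraMap D (Dp g))) := by
      rw [PrimeSpectrum.localization_away_comap_range (Dp g) g.1]
      exact hg
    have h1 : IsBaseChange (Dp g) (quotientBaseChange (Dp g) (F k) (F (k + 1))) :=
      IsLocalizedModule.isBaseChange (Submonoid.powers g.1) _ _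
    rw [← Module.rankAtStalk_isBaseChange h1, (hF g).rank k]

end Span

/-! ### Gluing of flags on disks -/

section Disk

variable {d r n : ℕ} {A : Type u} [CommRing A]

theorem exists_comp_algebraMap_eq {A B : Type*} [CommRing A] [CommRing B] {f : A} {b : A →+* B}
    (hu : IsUnit (b f)) : ∃ a : Localization.Away f →+* B, a.comp (algebraMap A _) = b :=
  ⟨IsLocalization.Away.lift f hu, RingHom.ext fun z => IsLocalization.Away.lift_eq f hu z⟩

theorem exists_pow_smul_eq_of_disk (f : A) (y : Fin n → DiskRing d r (Localization.Away f)) :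
    ∃ (k : ℕ) (x : Fin n → DiskRing d r A), diskMap d r
      (algebraMap A (Localization.Away f)) (diskConst d r A f ^ k) • y =
      fun i => diskMap d r (algebraMap A (Localization.Away f)) (x i) := by
  let _ := (diskMap d r (algebraMap A (Localization.Away f))).toAlgebra
  have := isLocalization_diskRing (d := d) r f (Localization.Away f)
  have hy : y ∈ baseChangeStep (algebraMap (DiskRing d r A) (DiskRing d r (Localization.Away f))) ⊤ := by
    have : y = ∑ i, y i • fun j => algebraMap (DiskRing d r A)
        (DiskRing d r (Localization.Away f)) ((Pi.single i 1 : Fin n → DiskRing d r A) j) := by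
      ext j
      rw [Finset.sum_apply, Finset.sum_eq_single j]
      · simp
      · intro i _ hi
        simp [hi.symm]
      · simp
    rw [this]
    exact Submodule.sum_mem _ fun i _ => Submodule.smul_mem _ _
      (Submodule.subset_span ⟨_, trivial, rfl⟩)
  obtain ⟨k, x, _, hx⟩ := exists_pow_smul_eq_of_mem_baseChangeStep (diskConst d r A f) hy
  exact ⟨k, x, hx⟩

theorem exists_pow_smul_mem_of_disk (f : A) {N : Submodule (DiskRing d r A) (Fin n → DiskRing d r A)}
    {x : Fin n → DiskRing d r A}
    (hx : (fun i => diskMap d r (algebraMap A (Localization.Away f)) (x i)) ∈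
      baseChangeStep (diskMap d r (algebraMap A (Localization.Away f))) N) :
    ∃ k : ℕ, diskConst d r A f ^ k • x ∈ N := by
  let _ := (diskMap d r (algebraMap A (Localization.Away f))).toAlgebra
  have := isLocalization_diskRing (d := d) r f (Localization.Away f)
  exact exists_pow_smul_mem_of_mem_baseChangeStep (diskConst d r A f) hx

variable {s : Set A}

/-- The disk ring is covered by constants `diskConst f`. The cover is indexed by the image of `s`,
and the element of `A` is recovered from such a constant by evaluation at `t = 0`. -/
theorem isLocalization_diskRing_image (g : diskConst d r A '' s) :
    letI := (diskMap d r (algebraMap A (Localization.Away (diskEval d r A g.1)))).toAlgebra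
    IsLocalization.Away g.1 (DiskRing d r (Localization.Away (diskEval d r A g.1))) := by
  obtain ⟨_, f, hf, rfl⟩ := g
  let _ := (diskMap d r (algebraMap A
    (Localization.Away (diskEval d r A (diskConst d r A f))))).toAlgebra
  have := isLocalization_diskRing (d := d) r (diskEval d r A (diskConst d r A f))
    (Localization.Away (diskEval d r A (diskConst d r A f)))
  rwa [congrArg (diskConst d r A) (diskEval_diskConst (d := d) (r := r) f)] at this

theorem disk_baseChangeStep_ext (hs : Ideal.span s = ⊤)
    {N N' : Submodule (DiskRing d r A) (Fin n → DiskRing d r A)}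
    (h : ∀ f ∈ s, baseChangeStep (diskMap d r (algebraMap A (Localization.Away f))) N =
      baseChangeStep (diskMap d r (algebraMap A (Localization.Away f))) N') : N = N' := by
  let _ := fun g : diskConst d r A '' s =>
    (diskMap d r (algebraMap A (Localization.Away (diskEval d r A g.1)))).toAlgebra
  have := fun g : diskConst d r A '' s => isLocalization_diskRing_image g
  refine baseChangeStep_ext_of_away (span_image_eq_top (diskConst d r A) hs)
    (fun g => DiskRing d r (Localization.Away (diskEval d r A g.1))) ?_
  rintro ⟨_, f, hf, rfl⟩
  refine h _ ?_
  rwa [diskEval_diskConst]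

theorem disk_isGLF_of_away (hs : Ideal.span s = ⊤) {h : ℤ →₀ ℕ}
    {F : ℤ → Submodule (DiskRing d r A) (Fin (totalRank h) → DiskRing d r A)} (hanti : Antitone F)
    (hexh : ∃ a, F a = ⊤) (hsep : ∃ b, F b = ⊥)
    (hF : ∀ f ∈ s, IsGLF h fun k =>
      baseChangeStep (diskMap d r (algebraMap A (Localization.Away f))) (F k)) : IsGLF h F := by
  let _ := fun g : diskConst d r A '' s =>
    (diskMap d r (algebraMap A (Localization.Away (diskEval d r A g.1)))).toAlgebra
  have := fun g : diskConst d r A '' s => isLocalization_diskRing_image g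
  refine isGLF_of_away (span_image_eq_top (diskConst d r A) hs)
    (fun g => DiskRing d r (Localization.Away (diskEval d r A g.1))) hanti hexh hsep ?_
  rintro ⟨_, f, hf, rfl⟩
  refine hF _ ?_
  rwa [diskEval_diskConst]

theorem Flag.ext_of_away (hs : Ideal.span s = ⊤) {h : ℤ →₀ ℕ} {x y : Flag h (DiskRing d r A)}
    (hxy : ∀ f ∈ s, x.baseChange (diskMap d r (algebraMap A (Localization.Away f))) =
      y.baseChange (diskMap d r (algebraMap A (Localization.Away f)))) : x = y :=
  Flag.ext (funext fun k => disk_baseChangeStep_ext hs fun f hf =>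
    congr_fun (congrArg Flag.F (hxy f hf)) k)

/-- The submodule of vectors that belong locally to given submodules. -/
def glueStep (t : Set A)
    (N : ∀ f : t, Submodule (DiskRing d r (Localization.Away f.1))
      (Fin n → DiskRing d r (Localization.Away f.1))) :
    Submodule (DiskRing d r A) (Fin n → DiskRing d r A) where
  carrier := {x | ∀ f : t, (fun i => diskMap d r (algebraMap A _) (x i)) ∈ N f}
  add_mem' {x y} hx hy f := by
    convert (N f).add_mem (hx f) (hy f) using 1
    ext i
    simp
  zero_mem' f := by
    convert (N f).zero_mem using 1
    ext i
    simp
  smul_mem' c x hx f := by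
    convert (N f).smul_mem (diskMap d r (algebraMap A _) c) (hx f) using 1
    ext i
    simp

/-- This is the usual argument that compatible submodules over a finite cover glue. A vector of `N
f` has a multiple by a power of `f` that comes from a vector `x` over `A`, and a further power of
`f` moves `x` into every `N g`. Finiteness of the cover allows one exponent for all `g`. -/
theorem baseChangeStep_glueStep {t : Set A} [Finite t]
    {N : ∀ f : t, Submodule (DiskRing d r (Localization.Away f.1))
      (Fin n → DiskRing d r (Localization.Away f.1))}
    (hN : ∀ (f g : t) (B : CommRingCat.{u}) (a : Localization.Away f.1 →+* B)
      (b : Localization.Away g.1 →+* B), a.comp (algebraMap A _) = b.comp (algebraMap A _) →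
      baseChangeStep (diskMap d r a) (N f) = baseChangeStep (diskMap d r b) (N g)) (f : t) :
    baseChangeStep (diskMap d r (algebraMap A (Localization.Away f.1))) (glueStep t N) = N f := by
  apply le_antisymm
  · refine Submodule.span_le.mpr ?_
    rintro _ ⟨x, hx, rfl⟩
    exact hx f
  · intro y hy
    obtain ⟨k, x, hx⟩ := exists_pow_smul_eq_of_disk f.1 y
    -- Over the localization of `A_g` at `f` the submodules `N f` and `N g` agree, so `x` belongs to
    -- `N g` up to a power of `f`.
    have h1 : ∀ g : t, ∃ l : ℕ, diskConst d r (Localization.Away g.1) (algebraMap A _ f.1) ^ l •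
        (fun i => diskMap d r (algebraMap A (Localization.Away g.1)) (x i)) ∈ N g := by
      intro g
      have hu : IsUnit (((algebraMap (Localization.Away g.1) (Localization.Away
          (algebraMap A (Localization.Away g.1) f.1))).comp
            (algebraMap A (Localization.Away g.1))) f.1) :=
        IsLocalization.Away.algebraMap_isUnit (algebraMap A (Localization.Away g.1) f.1)
      obtain ⟨a, hab⟩ := exists_comp_algebraMap_eq hu
      refine exists_pow_smul_mem_of_disk _ ?_
      have h2 := hN f g (.of (Localization.Away (algebraMap A (Localization.Away g.1) f.1))) a _ hab
      refine (congrArg (fun N => _ ∈ N) h2).mp ?_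
      refine Submodule.subset_span ⟨_, (N f).smul_mem (diskMap d r (algebraMap A _)
        (diskConst d r A f.1 ^ k)) hy, ?_⟩
      rw [hx]
      ext i
      change diskMap d r a (diskMap d r _ (x i)) = diskMap d r _ (diskMap d r _ (x i))
      rw [← RingHom.comp_apply, ← RingHom.comp_apply, ← diskMap_comp, ← diskMap_comp, hab]
    choose l hl using h1
    have := Fintype.ofFinite t
    have hmem : diskConst d r A f.1 ^ (∑ g, l g) • x ∈ glueStep t N := by
      intro g
      obtain ⟨m, hm⟩ := Nat.exists_eq_add_of_le (Finset.single_le_sum (f := l)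
        (fun _ _ => Nat.zero_le _) (Finset.mem_univ g))
      convert (N g).smul_mem
        (diskConst d r (Localization.Away g.1) (algebraMap A _ f.1) ^ m) (hl g) using 1
      ext i
      have hc := RingHom.congr_fun (diskMap_const d r (algebraMap A (Localization.Away g.1))) f.1
      have hT : ∀ {T : Type u} [CommRing T] (c z : T), c ^ (l g + m) * z = c ^ m * (c ^ l g * z) :=
        fun c z => by ring
      rw [hm]
      change diskMap d r _ (diskConst d r A f.1 ^ (l g + m) * x i) = _
      rw [map_mul, map_pow]
      refine (hT _ _).trans ?_
      exact congrArg (fun c => c ^ m * (c ^ l g * _)) hc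
    have hu : IsUnit (diskMap d r (algebraMap A (Localization.Away f.1))
        (diskConst d r A f.1 ^ ((∑ g, l g) + k))) := by
      have h3 := RingHom.congr_fun (diskMap_const d r (algebraMap A (Localization.Away f.1))) f.1
      rw [map_pow]
      refine IsUnit.pow _ ?_
      rw [← RingHom.comp_apply, h3]
      exact (IsLocalization.Away.algebraMap_isUnit (S := Localization.Away f.1) f.1).map
        (diskConst d r (Localization.Away f.1))
    have h4 : diskMap d r (algebraMap A (Localization.Away f.1))
        (diskConst d r A f.1 ^ ((∑ g, l g) + k)) • y ∈
          baseChangeStep (diskMap d r (algebraMap A (Localization.Away f.1))) (glueStep t N) := by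
      refine Submodule.subset_span ⟨_, hmem, ?_⟩
      have h5 : diskConst d r A f.1 ^ ((∑ g, l g) + k) =
          diskConst d r A f.1 ^ (∑ g, l g) * diskConst d r A f.1 ^ k := pow_add _ _ _
      rw [h5, map_mul]
      ext i
      have h6 := congr_fun hx i
      refine (map_mul (diskMap d r _) _ (x i)).trans ((congrArg _ h6.symm).trans ?_)
      exact (mul_assoc _ _ _).symm
    exact (Submodule.smul_mem_iff_of_isUnit _ hu).mp h4

/-- The steps are glued over a finite subcover, which `baseChangeStep_glueStep` requires; the flags
of the other members of the cover are then recovered by comparison with it. -/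
theorem Flag.exists_glue (hs : Ideal.span s = ⊤) {h : ℤ →₀ ℕ}
    (x : ∀ f : s, Flag h (DiskRing d r (Localization.Away f.1)))
    (hx : ∀ (f g : s) (B : CommRingCat.{u}) (a : Localization.Away f.1 →+* B)
      (b : Localization.Away g.1 →+* B), a.comp (algebraMap A _) = b.comp (algebraMap A _) →
      (x f).baseChange (diskMap d r a) = (x g).baseChange (diskMap d r b)) :
    ∃ y : Flag h (DiskRing d r A),
      ∀ f : s, y.baseChange (diskMap d r (algebraMap A (Localization.Away f.1))) = x f := by
  obtain ⟨t, hts, ht⟩ := (Ideal.span_eq_top_iff_finite s).mp hs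
  let x' : ∀ f : (t : Set A), Flag h (DiskRing d r (Localization.Away f.1)) :=
    fun f => x ⟨f.1, hts f.2⟩
  have key : ∀ (k : ℤ) (f : (t : Set A)),
      baseChangeStep (diskMap d r (algebraMap A (Localization.Away f.1)))
        (glueStep (t : Set A) fun f => (x' f).F k) = (x' f).F k := fun k f =>
    baseChangeStep_glueStep (fun f g B a b hab => congr_fun (congrArg Flag.F
      (hx ⟨f.1, hts f.2⟩ ⟨g.1, hts g.2⟩ B a b hab)) k) f
  have hanti : Antitone fun k => glueStep (t : Set A) fun f => (x' f).F k :=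
    fun k l hkl y hy f => (x' f).isGLF.antitone hkl (hy f)
  have := Fintype.ofFinite (t : Set A)
  let y : Flag h (DiskRing d r A) :=
    ⟨fun k => glueStep (t : Set A) fun f => (x' f).F k, disk_isGLF_of_away ht hanti (by
      -- Finitely many exhaustive filtrations are all full at one common index; the same holds for
      -- vanishing below.
      choose a ha using fun f => (x' f).isGLF.exhaustive
      obtain ⟨b, hb⟩ := (Set.finite_range a).bddBelow
      refine ⟨b, eq_top_iff.mpr fun z _ f => ?_⟩
      have : (x' f).F b = ⊤ := top_le_iff.mp ((ha f).ge.trans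
        ((x' f).isGLF.antitone (hb ⟨f, rfl⟩)))
      change _ ∈ (x' f).F b
      rw [this]
      trivial) (by
      choose a ha using fun f => (x' f).isGLF.separated
      obtain ⟨b, hb⟩ := (Set.finite_range a).bddAbove
      refine ⟨b, disk_baseChangeStep_ext ht fun f hf => ?_⟩
      refine (key b ⟨f, hf⟩).trans ?_
      have : (x' ⟨f, hf⟩).F b = ⊥ := le_bot_iff.mp
        (((x' _).isGLF.antitone (hb ⟨⟨f, hf⟩, rfl⟩)).trans (ha ⟨f, hf⟩).le)
      rw [this, eq_comm, eq_bot_iff]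
      refine Submodule.span_le.mpr ?_
      rintro _ ⟨z, hz, rfl⟩
      obtain rfl : z = 0 := hz
      simp only [Pi.zero_apply, map_zero]
      exact Submodule.zero_mem _) fun f hf => by
      simp only [key _ ⟨f, hf⟩]
      exact (x' ⟨f, hf⟩).isGLF⟩
  refine ⟨y, fun f => ?_⟩
  have h1 : ∀ g (hg : g ∈ t), y.baseChange (diskMap d r (algebraMap A (Localization.Away g))) =
      x ⟨g, hts hg⟩ := fun g hg => Flag.ext (funext fun k => key k ⟨g, hg⟩)
  -- As `f` need not belong to the finite subcover, the two flags are compared after localizing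
  -- further at each `g ∈ t`, where the descent condition relates `x f` to `x g`.
  refine Flag.ext_of_away (span_image_eq_top (algebraMap A (Localization.Away f.1)) ht) ?_
  rintro _ ⟨g, hg, rfl⟩
  have hu : IsUnit (((algebraMap (Localization.Away f.1) (Localization.Away
      (algebraMap A (Localization.Away f.1) g))).comp (algebraMap A (Localization.Away f.1))) g) :=
    IsLocalization.Away.algebraMap_isUnit (algebraMap A (Localization.Away f.1) g)
  obtain ⟨a, hab⟩ := exists_comp_algebraMap_eq hu
  rw [← Flag.baseChange_comp, ← diskMap_comp, ← hab, diskMap_comp, Flag.baseChange_comp, h1 g hg]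
  exact hx ⟨g, hts hg⟩ f (.of (Localization.Away (algebraMap A (Localization.Away f.1) g))) a _ hab

end Disk

end FlagGluing

/-! ### The flag of a framed jet -/

section MatrixFlags

variable {h : ℤ →₀ ℕ} {B C : Type u} [CommRing B] [CommRing C]

theorem flagOfMatrix_baseChange (f : B →+* C) (M : GL (Fin (totalRank h)) B) :
    (flagOfMatrix h M).baseChange f =
      flagOfMatrix h (Matrix.GeneralLinearGroup.map f M) := by
  refine Flag.ext (funext fun k => ?_)
  change baseChangeStep f (Submodule.span B _) = Submodule.span C _
  apply le_antisymm
  · refine Submodule.span_le.mpr ?_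
    rintro _ ⟨x, hx, rfl⟩
    simp only [SetLike.mem_coe]
    induction hx using Submodule.span_induction with
    | mem x hx =>
      obtain ⟨i, hi, rfl⟩ := hx
      exact Submodule.subset_span ⟨i, hi, rfl⟩
    | zero =>
      convert Submodule.zero_mem _ using 1
      ext i
      simp
    | add x y _ _ hx hy =>
      convert Submodule.add_mem _ hx hy using 1
      ext i
      simp
    | smul a x _ hx =>
      convert Submodule.smul_mem _ (f a) hx using 1
      ext i
      simp
  · refine Submodule.span_mono ?_
    rintro _ ⟨i, hi, rfl⟩
    exact ⟨_, Submodule.subset_span ⟨i, hi, rfl⟩, rfl⟩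

theorem flagOfMatrix_act (g M : GL (Fin (totalRank h)) B) :
    (flagOfMatrix h M).act g = flagOfMatrix h (g * M) := by
  refine Flag.ext (funext fun k => ?_)
  change Submodule.map _ (Submodule.span B _) = Submodule.span B _
  rw [Submodule.map_span, Set.image_image]
  rfl

theorem Flag.baseChange_act (f : B →+* C) (g : GL (Fin (totalRank h)) B) (x : Flag h B) :
    (x.act g).baseChange f = (x.baseChange f).act (Matrix.GeneralLinearGroup.map f g) := by
  have key : ∀ y : Fin (totalRank h) → B, (fun i => f (g.1.mulVec y i)) =
      (Matrix.GeneralLinearGroup.map f g).1.mulVec fun i => f (y i) := by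
    intro y
    ext i
    exact RingHom.map_mulVec f g.1 y i
  refine Flag.ext (funext fun k => ?_)
  change Submodule.span C _ = Submodule.map _ (Submodule.span C _)
  rw [Submodule.map_span, Set.image_image]
  congr 1
  ext y
  constructor
  · rintro ⟨_, ⟨z, hz, rfl⟩, rfl⟩
    exact ⟨z, hz, (key z).symm⟩
  · rintro ⟨z, hz, rfl⟩
    exact ⟨_, ⟨z, hz, rfl⟩, key z⟩

end MatrixFlags

/-! ### The flag of a flat frame and the map of stacks -/

section PeriodFlag

variable {R : CommRingCat.{u}} {S : Scheme.{u}} {π : S ⟶ Spec R} {h : ℤ →₀ ℕ}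
  {E : FlatFilteredBundle π h}

namespace FrameCoords

section

variable {d r d' r' : ℕ} {A B C : Type u} [CommRing A] [CommRing B] [CommRing C]
  {j : diskSpec d r A ⟶ S}

/-- The matrix whose columns are the coordinates of the members of a frame of the bundle. -/
def frameMatrix (F : FrameCoords E j) (q : diskSpec d' r' B ⟶ diskSpec d r A) {U : S.Opens}
    {v : Fin (totalRank h) → Γ(E.H, U)} (hv : IsCompatibleFrame (h := h) E.F v)
    (hU : ⊤ ≤ (q ≫ j) ⁻¹ᵁ U) : GL (Fin (totalRank h)) (DiskRing d' r' B) :=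
  ((Matrix.isUnit_transpose _).mpr (F.isUnit_ev q hv hU)).unit

/-- The flag given by the coordinates of the filtration of the bundle. -/
def localFlag (F : FrameCoords E j) (q : diskSpec d' r' B ⟶ diskSpec d r A) {U : S.Opens}
    {v : Fin (totalRank h) → Γ(E.H, U)} (hv : IsCompatibleFrame (h := h) E.F v)
    (hU : ⊤ ≤ (q ≫ j) ⁻¹ᵁ U) : Flag h (DiskRing d' r' B) :=
  flagOfMatrix h (F.frameMatrix q hv hU)

/-- A description free of the frame `v`: the step is spanned by the coordinates of all sections of
`F k` over a smaller open set through which the point factors. This yields the independence of the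
bundle frame in `localFlag_eq`. -/
theorem localFlag_F (F : FrameCoords E j) (q : diskSpec d' r' B ⟶ diskSpec d r A) {U V : S.Opens}
    {v : Fin (totalRank h) → Γ(E.H, U)} (hv : IsCompatibleFrame (h := h) E.F v)
    (hU : ⊤ ≤ (q ≫ j) ⁻¹ᵁ U) (i : V ≤ U) (hV : ⊤ ≤ (q ≫ j) ⁻¹ᵁ V) (k : ℤ) :
    (F.localFlag q hv hU).F k = Submodule.span (DiskRing d' r' B)
      ((fun (s : Γ(E.H, V)) a => F.ev q V hV a s) '' (E.F k V : Set Γ(E.H, V))) := by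
  apply le_antisymm
  · refine Submodule.span_le.mpr ?_
    rintro _ ⟨b, hb, rfl⟩
    refine Submodule.subset_span ⟨resMap E.H i (v b), ?_, ?_⟩
    · rw [hv.span_eq_filtration k V i]
      exact Submodule.subset_span ⟨b, hb, rfl⟩
    · ext a
      exact F.ev_resMap q i hV a (v b)
  · refine Submodule.span_le.mpr ?_
    rintro _ ⟨s, hs, rfl⟩
    rw [hv.span_eq_filtration k V i] at hs
    change _ ∈ (F.localFlag q hv hU).F k
    induction hs using Submodule.span_induction with
    | mem s hs =>
      obtain ⟨b, hb, rfl⟩ := hs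
      refine Submodule.subset_span ⟨b, hb, ?_⟩
      ext a
      exact (F.ev_resMap q i hV a (v b)).symm
    | zero =>
      convert Submodule.zero_mem _ using 1
      ext a
      exact _root_.map_zero (F.ev q V hV a)
    | add x y _ _ hx hy =>
      convert Submodule.add_mem _ hx hy using 1
      ext a
      exact _root_.map_add (F.ev q V hV a) x y
    | smul c x _ hx =>
      convert Submodule.smul_mem _ (diskPt (q ≫ j) V hV c) hx using 1
      ext a
      exact (F.ev q V hV a).map_smulₛₗ c x

theorem localFlag_eq (F : FrameCoords E j) (q : diskSpec d' r' B ⟶ diskSpec d r A)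
    {U U' : S.Opens} {v : Fin (totalRank h) → Γ(E.H, U)} (hv : IsCompatibleFrame (h := h) E.F v)
    (hU : ⊤ ≤ (q ≫ j) ⁻¹ᵁ U) {v' : Fin (totalRank h) → Γ(E.H, U')}
    (hv' : IsCompatibleFrame (h := h) E.F v') (hU' : ⊤ ≤ (q ≫ j) ⁻¹ᵁ U') :
    F.localFlag q hv hU = F.localFlag q hv' hU' := by
  have hV : ⊤ ≤ (q ≫ j) ⁻¹ᵁ (U ⊓ U') := fun x hx => ⟨hU hx, hU' hx⟩
  refine Flag.ext (funext fun k => ?_)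
  rw [F.localFlag_F q hv hU inf_le_left hV, F.localFlag_F q hv' hU' inf_le_right hV]

theorem localFlag_congr {d₁ r₁ : ℕ} {A₁ : Type u} [CommRing A₁] {R₁ : CommRingCat.{u}}
    {S₁ : Scheme.{u}} {π₁ : S₁ ⟶ Spec R₁} {E₁ : FlatFilteredBundle π₁ h}
    {j₁ : diskSpec d₁ r₁ A₁ ⟶ S₁} (F : FrameCoords E j) (F₁ : FrameCoords E₁ j₁)
    (q : diskSpec d' r' B ⟶ diskSpec d r A) (q₁ : diskSpec d' r' B ⟶ diskSpec d₁ r₁ A₁)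
    {U : S.Opens} {U₁ : S₁.Opens} {v : Fin (totalRank h) → Γ(E.H, U)}
    {v₁ : Fin (totalRank h) → Γ(E₁.H, U₁)} (hv : IsCompatibleFrame (h := h) E.F v)
    (hv₁ : IsCompatibleFrame (h := h) E₁.F v₁) (hU : ⊤ ≤ (q ≫ j) ⁻¹ᵁ U)
    (hU₁ : ⊤ ≤ (q₁ ≫ j₁) ⁻¹ᵁ U₁)
    (hF : ∀ a b, F.ev q U hU a (v b) = F₁.ev q₁ U₁ hU₁ a (v₁ b)) :
    F.localFlag q hv hU = F₁.localFlag q₁ hv₁ hU₁ :=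
  congrArg (flagOfMatrix h) (Units.ext (Matrix.ext hF))

theorem ev_SpecMap {d'' r'' : ℕ} (F : FrameCoords E j)
    (f : DiskRing d' r' B →+* DiskRing d'' r'' C) (q : diskSpec d' r' B ⟶ diskSpec d r A)
    {U : S.Opens} (hU : ⊤ ≤ (q ≫ j) ⁻¹ᵁ U)
    (hU' : ⊤ ≤ (((Spec.map (CommRingCat.ofHom f) : diskSpec d'' r'' C ⟶ _) ≫ q) ≫ j) ⁻¹ᵁ U)
    (a : Fin (totalRank h)) (s : Γ(E.H, U)) :
    F.ev (Spec.map (CommRingCat.ofHom f) ≫ q) U hU' a s = f (F.ev q U hU a s) :=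
  evalAt_SpecMap (CommRingCat.ofHom f) q (U := j ⁻¹ᵁ U) hU hU' _

theorem localFlag_act (F : FrameCoords E j) (g : GL (Fin (totalRank h)) A) (u : A →+* B)
    {U : S.Opens} {v : Fin (totalRank h) → Γ(E.H, U)} (hv : IsCompatibleFrame (h := h) E.F v)
    (hU : ⊤ ≤ (diskSpecMap d r u ≫ j) ⁻¹ᵁ U) :
    (F.act g).localFlag (diskSpecMap d r u) hv hU =
      (F.localFlag (diskSpecMap d r u) hv hU).act
        (Matrix.GeneralLinearGroup.map ((diskConst d r B).comp u) g) := by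
  refine Eq.trans (congrArg (flagOfMatrix h) ?_) (flagOfMatrix_act _ _).symm
  exact Units.ext (Matrix.ext fun a b => F.ev_act g u hU a (v b))

/-- `y` is the flag that the frame `F` defines on the disk. -/
def IsPeriodFlag (F : FrameCoords E j) (y : Flag h (DiskRing d r A)) : Prop :=
  ∀ (B : CommRingCat.{u}) (u : A →+* B) (U : S.Opens) (v : Fin (totalRank h) → Γ(E.H, U))
    (hv : IsCompatibleFrame (h := h) E.F v) (hU : ⊤ ≤ (diskSpecMap d r u ≫ j) ⁻¹ᵁ U),
    y.baseChange (diskMap d r u) = F.localFlag (diskSpecMap d r u) hv hU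

theorem top_le_preimage_diskSpecMap_comp (u : A →+* B) (w : B →+* C) {U : S.Opens}
    (hU : ⊤ ≤ (diskSpecMap d r u ≫ j) ⁻¹ᵁ U) : ⊤ ≤ (diskSpecMap d r (w.comp u) ≫ j) ⁻¹ᵁ U := by
  rw [diskSpecMap_comp, Category.assoc]
  exact fun x _ => hU (Set.mem_univ _)

theorem localFlag_diskMap (F : FrameCoords E j) (u : A →+* B) (w : B →+* C) {U : S.Opens}
    {v : Fin (totalRank h) → Γ(E.H, U)} (hv : IsCompatibleFrame (h := h) E.F v)
    (hU : ⊤ ≤ (diskSpecMap d r u ≫ j) ⁻¹ᵁ U) :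
    (F.localFlag (diskSpecMap d r u) hv hU).baseChange (diskMap d r w) =
      F.localFlag (diskSpecMap d r (w.comp u)) hv (top_le_preimage_diskSpecMap_comp u w hU) := by
  refine (flagOfMatrix_baseChange _ _).trans (congrArg (flagOfMatrix h) ?_)
  exact Units.ext (Matrix.ext fun a b => (F.ev_comp u w hU _ a (v b)).symm)

/-- One bundle frame on each member of a cover suffices, because local flags do not depend on the
bundle frame and are compatible with change of base. -/
theorem isPeriodFlag_of_away {F : FrameCoords E j} {y : Flag h (DiskRing d r A)} {s : Set A}
    (hs : Ideal.span s = ⊤) (hy : ∀ f ∈ s, ∃ (U : S.Opens) (v : Fin (totalRank h) → Γ(E.H, U))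
      (hv : IsCompatibleFrame (h := h) E.F v)
      (hU : ⊤ ≤ (diskSpecMap d r (algebraMap A (Localization.Away f)) ≫ j) ⁻¹ᵁ U),
      y.baseChange (diskMap d r (algebraMap A (Localization.Away f))) =
        F.localFlag (diskSpecMap d r (algebraMap A (Localization.Away f))) hv hU) :
    F.IsPeriodFlag y := by
  intro B u U v hv hU
  refine Flag.ext_of_away (span_image_eq_top u hs) ?_
  rintro _ ⟨f, hf, rfl⟩
  obtain ⟨W, w, hw, hW, hy⟩ := hy f hf
  have hu : IsUnit (((algebraMap B (Localization.Away (u f))).comp u) f) :=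
    IsLocalization.Away.algebraMap_isUnit (u f)
  obtain ⟨a, ha⟩ := exists_comp_algebraMap_eq hu
  rw [← Flag.baseChange_comp, ← diskMap_comp, localFlag_diskMap]
  have h1 : ∀ (t : A →+* Localization.Away (u f)) (ht : ⊤ ≤ (diskSpecMap d r t ≫ j) ⁻¹ᵁ U)
      (_ : t = a.comp (algebraMap A (Localization.Away f))),
      y.baseChange (diskMap d r t) = F.localFlag (diskSpecMap d r t) hv ht := by
    rintro _ ht rfl
    rw [diskMap_comp, Flag.baseChange_comp, hy, localFlag_diskMap]
    exact localFlag_eq _ _ _ _ _ _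
  exact h1 _ _ ha.symm

end

section

variable {d r : ℕ} {A : Under R} {x : (jetSpace π d r).obj A}

/-- The flag of a framed jet is obtained by choice, and this uniqueness is the only way it is used:
each compatibility of `flag` is shown by verifying that the other side is a period flag too. -/
theorem IsPeriodFlag.unique {F : FrameCoords E x.1} {y y' : Flag h (DiskRing d r A.right)}
    (hy : F.IsPeriodFlag y) (hy' : F.IsPeriodFlag y') : y = y' := by
  obtain ⟨s, hs, hW⟩ := FramedJet.exists_cover E x
  refine Flag.ext_of_away hs fun f hf => ?_
  obtain ⟨W, v, hv, hW⟩ := hW f hf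
  exact (hy (.of (Localization.Away f)) _ _ _ hv hW).trans
    (hy' (.of (Localization.Away f)) _ _ _ hv hW).symm

/-- Local flags from different bundle frames coincide on overlaps by `localFlag_eq`, so they glue.
-/
theorem exists_isPeriodFlag (F : FrameCoords E x.1) :
    ∃ y : Flag h (DiskRing d r A.right), F.IsPeriodFlag y := by
  obtain ⟨s, hs, hW⟩ := FramedJet.exists_cover E x
  choose W v hv hW using hW
  obtain ⟨y, hy⟩ := Flag.exists_glue hs
    (fun f => F.localFlag (diskSpecMap d r (algebraMap A.right (Localization.Away f.1)))
      (hv f.1 f.2) (hW f.1 f.2)) fun f g B a b hab => by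
    rw [localFlag_diskMap, localFlag_diskMap]
    have h1 : ∀ (t : A.right →+* B) (ht : ⊤ ≤ (diskSpecMap d r t ≫ x.1) ⁻¹ᵁ (W g.1 g.2).1)
        (_ : t = a.comp (algebraMap A.right (Localization.Away f.1))),
        F.localFlag (diskSpecMap d r (a.comp (algebraMap A.right (Localization.Away f.1))))
          (hv f.1 f.2) (top_le_preimage_diskSpecMap_comp _ a (hW f.1 f.2)) =
        F.localFlag (diskSpecMap d r t) (hv g.1 g.2) ht := by
      rintro _ ht rfl
      exact localFlag_eq _ _ _ _ _ _
    exact h1 _ _ hab.symm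
  exact ⟨y, isPeriodFlag_of_away hs fun f hf => ⟨_, _, hv f hf, hW f hf, hy ⟨f, hf⟩⟩⟩

end

end FrameCoords

namespace FramedJet

variable {d r : ℕ}

/-- The flag on the disk defined by a jet with a flat frame. -/
def flag {A : Under R} (p : FramedJet E d r A) : Flag h (DiskRing d r A.right) :=
  p.frame.exists_isPeriodFlag.choose

theorem isPeriodFlag_flag {A : Under R} (p : FramedJet E d r A) : p.frame.IsPeriodFlag p.flag :=
  p.frame.exists_isPeriodFlag.choose_spec

theorem flag_map {A B : Under R} (u : A ⟶ B) (p : FramedJet E d r A) :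
    (p.map u).flag = p.flag.baseChange (diskMap d r u.right.hom) := by
  refine (p.map u).isPeriodFlag_flag.unique fun C w U v hv hU => ?_
  have hU' := top_le_of_map u p w hU
  rw [← Flag.baseChange_comp, ← diskMap_comp, p.isPeriodFlag_flag C _ U v hv hU']
  exact FrameCoords.localFlag_congr _ _ _ _ _ _ _ _ fun a b => (ev_map u p w hU hU' a (v b)).symm

theorem flag_smul {A : Under R} (g : GL (Fin (totalRank h)) A.right) (p : FramedJet E d r A) :
    (g • p).flag =
      p.flag.act (Matrix.GeneralLinearGroup.map (diskConst d r A.right) g) := by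
  refine (g • p).isPeriodFlag_flag.unique fun C w U v hv hU => ?_
  have hU' : ⊤ ≤ (diskSpecMap d r w ≫ p.jet.1) ⁻¹ᵁ U := hU
  rw [Flag.baseChange_act, p.isPeriodFlag_flag C w U v hv hU']
  refine Eq.trans ?_ (p.frame.localFlag_act g w hv hU').symm
  congr 1
  exact Units.ext (Matrix.ext fun a b => RingHom.congr_fun (diskMap_const d r w) (g.1 a b))

end FramedJet

/-- The map of stacks from the jet space to the quotient stack defined by the bundle. -/
def periodMap (E : FlatFilteredBundle π h) (d r : ℕ) (hr : IsUnit ((r.factorial : ℕ) : R)) :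
    ToFlagQuotient (jetSpace π d r) h d r where
  P := FramedJet.functor E d r
  act A := inferInstanceAs (MulAction (GL (Fin (totalRank h)) A.right) (FramedJet E d r A))
  map_smul u g p := FramedJet.map_smul u g p
  isSheaf := FramedJet.isSheaf E d r
  γ :=
    { app := fun _ => ↾fun p : FramedJet E d r _ => p.jet
      naturality := fun _ _ _ => rfl }
  γ_smul _ _ := rfl
  existsUnique_smul p q hpq := FramedJet.existsUnique_smul hr p q hpq
  locally_nonempty x := FramedJet.exists_locally hr E x
  α :=
    { app := fun A => ↾fun p : FramedJet E d r A => (show (jetFlag R h d r).obj A from p.flag)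
      naturality := fun _ _ u => ConcreteCategory.hom_ext _ _ fun p => FramedJet.flag_map u p }
  α_smul g p := FramedJet.flag_smul g p

end PeriodFlag

/-! ### Functoriality -/

section Pullback

variable {R R' : CommRingCat.{u}} {S S' : Scheme.{u}} {π : S ⟶ Spec R} {π' : S' ⟶ Spec R'}
  {h : ℤ →₀ ℕ} {f : R ⟶ R'} {g : S' ⟶ S} {w : g ≫ π = π' ≫ Spec.map f}

theorem resMap_pullMap {H : S.Modules} {H' : S'.Modules}
    (φ : H ⟶ (Scheme.Modules.pushforward g).obj H') {U : S.Opens} {V V' : S'.Opens}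
    (i : V ≤ g ⁻¹ᵁ U) (k : V' ≤ V) (s : Γ(H, U)) :
    resMap H' k (pullMap g φ i s) = pullMap g φ (k.trans i) s :=
  resMap_resMap H' i k (φ.app U s)

theorem pullMap_resMap {H : S.Modules} {H' : S'.Modules}
    (φ : H ⟶ (Scheme.Modules.pushforward g).obj H') {U U' : S.Opens} {V : S'.Opens}
    (k : U' ≤ U) (i : V ≤ g ⁻¹ᵁ U') (s : Γ(H, U)) :
    pullMap g φ i (resMap H k s) = pullMap g φ (i.trans fun _ hx => k hx) s := by
  have h1 : φ.app U' (resMap H k s) =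
      resMap H' (fun _ hx => k hx : g ⁻¹ᵁ U' ≤ g ⁻¹ᵁ U) (φ.app U s) :=
    ConcreteCategory.congr_hom (φ.mapPresheaf.naturality (homOfLE k).op) s
  change resMap H' i (φ.app U' (resMap H k s)) = _
  rw [h1]
  exact resMap_resMap H' (fun _ hx => k hx : g ⁻¹ᵁ U' ≤ g ⁻¹ᵁ U) i (φ.app U s)

variable {E : FlatFilteredBundle π h} {E' : FlatFilteredBundle π' h}
  {φ : E.H ⟶ (Scheme.Modules.pushforward g).obj E'.H} {d r : ℕ}

namespace FrameCoords

section

variable {A B : Type u} [CommRing A] [CommRing B] {j : diskSpec d r A ⟶ S'}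

/-- A frame along `j` of the pullback of a bundle along `g`, as a frame of the bundle along
`j ≫ g`. -/
def ofPullback (hE : IsPullbackTriple f g w E E' φ) (F : FrameCoords E' j) :
    FrameCoords E (j ≫ g) where
  c U s a := F.c (g ⁻¹ᵁ U) (pullMap g φ le_rfl s) a
  map_add U s t a := by
    rw [_root_.map_add]
    exact F.map_add _ _ _ a
  map_smul U x s a := by
    rw [LinearMap.map_smulₛₗ]
    refine (F.map_smul _ _ _ a).trans (congrArg (· * _) ?_)
    rw [Scheme.Hom.comp_app, Scheme.Hom.app_eq_appLE g]
    rfl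
  map_res {U V} i s a := by
    rw [pullMap_resMap, ← resMap_pullMap φ (le_rfl : g ⁻¹ᵁ U ≤ g ⁻¹ᵁ U) (fun _ hx => i hx)]
    exact F.map_res _ _ a
  isUnit U v hv := F.isUnit (g ⁻¹ᵁ U) _ (hE.frame v hv)

theorem ev_ofPullback (hE : IsPullbackTriple f g w E E' φ) (F : FrameCoords E' j) {d' r' : ℕ}
    (q : diskSpec d' r' B ⟶ diskSpec d r A) {U : S.Opens} {V : S'.Opens} (i : V ≤ g ⁻¹ᵁ U)
    (hU : ⊤ ≤ (q ≫ j ≫ g) ⁻¹ᵁ U) (hV : ⊤ ≤ (q ≫ j) ⁻¹ᵁ V) (a : Fin (totalRank h)) (s : Γ(E.H, U)) :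
    (F.ofPullback hE).ev q U hU a s = F.ev q V hV a (pullMap g φ i s) := by
  rw [← resMap_pullMap φ le_rfl i, F.ev_resMap]
  rfl

theorem IsPeriodFlag.ofPullback (hE : IsPullbackTriple f g w E E' φ) {F : FrameCoords E' j}
    {y : Flag h (DiskRing d r A)} (hy : F.IsPeriodFlag y) : (F.ofPullback hE).IsPeriodFlag y := by
  intro B u U v hv hU
  rw [hy B u (g ⁻¹ᵁ U) _ (hE.frame v hv) hU]
  exact localFlag_congr _ _ _ _ _ _ _ _ fun a b => rfl

end

/-- Locally on the disk the jet lands in an affine open `V` with `V ≤ g⁻¹ U`. There the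
compatibility of the connections with pullback transfers horizontality from the pulled-back section
to the section itself. -/
theorem IsFlat.ofPullback (hE : IsPullbackTriple f g w E E' φ) {A : Under R'}
    {x : (jetSpace π' d r).obj A} {F : FrameCoords E' x.1} (hF : F.IsFlat) :
    (F.ofPullback hE).IsFlat := by
  intro B u U hU a s
  choose V _ hVU hxV _ using fun p : diskSpec d r B => E'.exists_affine_frame
    (U := g ⁻¹ᵁ U.1) (x := (diskSpecMap d r u ≫ x.1) p) (hU (Set.mem_univ p))
  refine (F.ofPullback hE).isHorizontalAt_of_iSup u hU
    (fun p => (diskSpecMap d r u ≫ x.1) ⁻¹ᵁ (V p).1) (fun p => ⟨p, hxV p⟩)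
    fun p C w' hw hU' => ?_
  have hV : ⊤ ≤ (diskSpecMap d r (w'.comp u) ≫ x.1) ⁻¹ᵁ (V p).1 := by
    rw [diskSpecMap_comp, Category.assoc]
    exact hw
  exact (isHorizontalAt_map_iff (structMap_appLE w (hVU p)) (pullMap g φ (hVU p))
    (truncDeriv_diskPt_structMap ((jetMapOver f g w d r).app A x) (w'.comp u) hU')
    (truncDeriv_diskPt_structMap x (w'.comp u) hV) _
    (F.ev (diskSpecMap d r (w'.comp u)) (V p).1 hV a)
    (fun c => (diskPt_appLE (diskSpecMap d r (w'.comp u) ≫ x.1) g hV (hVU p) c).symm)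
    (fun t => F.ev_ofPullback hE _ (hVU p) hU' hV a t) (hE.nabla (hVU p) s)).mpr
    (hF C (w'.comp u) (V p) hV a _)

end FrameCoords

/-- A framed jet `j` of the pullback bundle is a framed jet `j ≫ g` of the original bundle with the
same coordinates. Equivariance and compatibility with projections are therefore definitional, and
the flags agree by uniqueness. -/
theorem commutesOver_periodMap (hE : IsPullbackTriple f g w E E' φ)
    (hr : IsUnit ((r.factorial : ℕ) : R)) (hr' : IsUnit ((r.factorial : ℕ) : R')) :
    CommutesOver f (periodMap E' d r hr') (periodMap E d r hr) (jetMapOver f g w d r) := by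
  refine ⟨fun A (p : FramedJet E' d r A) => (⟨(jetMapOver f g w d r).app A p.jet,
    p.frame.ofPullback hE, p.isFlat.ofPullback hE⟩ : FramedJet E d r ((Under.map f).obj A)),
    fun u p => ?_, fun A N p => rfl, fun A p => rfl, fun A p => ?_⟩
  · refine FramedJet.ext_ev (Subtype.ext (Category.assoc _ _ _)) fun B u U hU hU' a s => ?_
    rfl
  · exact (FramedJet.isPeriodFlag_flag _).unique (p.isPeriodFlag_flag.ofPullback hE)

namespace FramedJet

variable {π' : S' ⟶ Spec R} {E' : FlatFilteredBundle π' h}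
  {φ : E.H ⟶ (Scheme.Modules.pushforward g).obj E'.H} {w' : g ≫ π = π' ≫ Spec.map (𝟙 R)}

/-- The image under a morphism of `R`-schemes of a jet with a flat frame of a pullback. -/
def ofPullback (w : g ≫ π = π') (hE : IsPullbackTriple (𝟙 R) g w' E E' φ) {A : Under R}
    (p : FramedJet E' d r A) : FramedJet E d r A :=
  ⟨(jetMap g w d r).app A p.jet, p.frame.ofPullback hE, p.isFlat.ofPullback hE⟩

theorem map_ofPullback (w : g ≫ π = π') (hE : IsPullbackTriple (𝟙 R) g w' E E' φ) {A B : Under R}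
    (u : A ⟶ B) (p : FramedJet E' d r A) : (p.map u).ofPullback w hE = (p.ofPullback w hE).map u :=
  FramedJet.ext_ev (Subtype.ext (Category.assoc _ _ _)) fun _ _ _ _ _ _ _ => rfl

theorem smul_ofPullback (w : g ≫ π = π') (hE : IsPullbackTriple (𝟙 R) g w' E E' φ) {A : Under R}
    (N : GL (Fin (totalRank h)) A.right) (p : FramedJet E' d r A) :
    (N • p).ofPullback w hE = N • p.ofPullback w hE :=
  rfl

theorem flag_ofPullback (w : g ≫ π = π') (hE : IsPullbackTriple (𝟙 R) g w' E E' φ) {A : Under R}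
    (p : FramedJet E' d r A) : (p.ofPullback w hE).flag = p.flag :=
  (p.ofPullback w hE).isPeriodFlag_flag.unique (p.isPeriodFlag_flag.ofPullback hE)

end FramedJet

theorem commutes_periodMap_jetMap {π' : S' ⟶ Spec R} {E' : FlatFilteredBundle π' h}
    {φ : E.H ⟶ (Scheme.Modules.pushforward g).obj E'.H} (w : g ≫ π = π')
    {w' : g ≫ π = π' ≫ Spec.map (𝟙 R)} (hE : IsPullbackTriple (𝟙 R) g w' E E' φ)
    (hr : IsUnit ((r.factorial : ℕ) : R)) :
    Commutes (periodMap E' d r hr) (periodMap E d r hr) (jetMap g w d r) (𝟙 _) := by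
  refine ⟨{ app := fun A => ↾fun p : FramedJet E' d r A => p.ofPullback w hE,
            naturality := fun A B u => ConcreteCategory.hom_ext _ _ fun p =>
              FramedJet.map_ofPullback w hE u p }, fun N p => FramedJet.smul_ofPullback w hE N p,
    ?_, ?_⟩
  · ext A p
    rfl
  · ext A p
    exact FramedJet.flag_ofPullback w hE p

end Pullback

/-! ### Precomposition with morphisms of disks -/

section Precomposition

theorem diskConst_diskEval_mem_iff {d r : ℕ} {A : Type u} [CommRing A] {I : Ideal (DiskRing d r A)}
    (hI : I.IsPrime) (e : DiskRing d r A) : diskConst d r A (diskEval d r A e) ∈ I ↔ e ∈ I := by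
  have h1 : e - diskConst d r A (diskEval d r A e) ∈ I := by
    obtain ⟨n, hn⟩ := isNilpotent_of_diskEval_eq_zero d r
      (x := e - diskConst d r A (diskEval d r A e)) (by
        rw [map_sub, diskEval_diskConst, sub_self])
    exact hI.mem_of_pow_mem n (hn ▸ Ideal.zero_mem _)
  exact ⟨fun h => by simpa using Ideal.add_mem _ h1 h, fun h => by
    simpa using Ideal.sub_mem _ h h1⟩

/-- A morphism of disks over the same base is surjective. -/
theorem exists_SpecMap_eq {d r d' r' : ℕ} {A : Type u} [CommRing A]
    (ρ : DiskRing d' r' A →+* DiskRing d r A)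
    (hρ : ρ.comp (diskConst d' r' A) = diskConst d r A) (p : diskSpec d' r' A) :
    ∃ p₀ : diskSpec d r A, Spec.map (CommRingCat.ofHom ρ) p₀ = p := by
  have := p.2
  have hp : (p.asIdeal.comap (diskConst d' r' A)).IsPrime :=
    Ideal.IsPrime.comap (diskConst d' r' A) (K := p.asIdeal)
  -- A disk has the same points as its base. The point sought is the one over the image of `p` in
  -- `Spec A`.
  refine ⟨⟨(p.asIdeal.comap (diskConst d' r' A)).comap (diskEval d r A),
    Ideal.IsPrime.comap _⟩, PrimeSpectrum.ext (Ideal.ext fun e => ?_)⟩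
  change diskConst d' r' A (diskEval d r A (ρ e)) ∈ p.asIdeal ↔ e ∈ p.asIdeal
  refine Iff.trans ?_ (diskConst_diskEval_mem_iff p.2 e)
  obtain ⟨n, hn⟩ := isNilpotent_of_diskEval_eq_zero d' r'
    (x := e - diskConst d' r' A (diskEval d' r' A e)) (by
      rw [map_sub, diskEval_diskConst, sub_self])
  have h1 : diskEval d r A (ρ (e - diskConst d' r' A (diskEval d' r' A e))) ∈
      p.asIdeal.comap (diskConst d' r' A) := by
    refine hp.mem_of_pow_mem n ?_
    rw [← map_pow, ← map_pow, hn, map_zero, map_zero]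
    exact Ideal.zero_mem _
  have h2 : diskEval d r A (ρ (e - diskConst d' r' A (diskEval d' r' A e))) =
      diskEval d r A (ρ e) - diskEval d' r' A e := by
    rw [map_sub, map_sub, ← RingHom.comp_apply ρ, hρ, diskEval_diskConst]
  rw [h2] at h1
  have h3 : diskConst d' r' A (diskEval d r A (ρ e) - diskEval d' r' A e) ∈ p.asIdeal := h1
  rw [map_sub] at h3
  exact ⟨fun h => by simpa using Ideal.sub_mem _ h h3, fun h => by
    simpa using Ideal.add_mem _ h3 h⟩

/-- Apply the chain rule on both sides: each `ψ k` is semilinear over pullback, so it carries the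
equation in the direction `k` to the corresponding summand. The domain hypothesis enters here,
through the existence of the `ψ k`. -/
theorem IsHorizontalAt.diskBaseChange {R C : CommRingCat.{u}} [IsDomain R] {R₀ : CommRingCat.{u}}
    {f : R₀ ⟶ C} {M : Type u} [AddCommGroup M] [Module C M] {d r d' r' : ℕ} {A : Under R}
    {nabla : M → CommRingCat.KaehlerDifferential f ⊗[C] M}
    {φ : C →+* DiskRing d' r' A.right} {l : M → DiskRing d' r' A.right} {s : M}
    (hs : IsHorizontalAt nabla φ l s) (v : DiskRing d' r' R →ₐ[R] DiskRing d r R) :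
    IsHorizontalAt nabla ((PeriodJets.diskBaseChange v A).comp φ)
      (fun t => PeriodJets.diskBaseChange v A (l t)) s := by
  intro n a b e hx i
  obtain ⟨ψ, hψ, hv⟩ := exists_truncDeriv_diskBaseChange v A i
  rw [hv]
  simp only [hs n a b e hx, RingHom.comp_apply, hv, map_sum, hψ, Finset.mul_sum]
  rw [Finset.sum_comm]
  simp only [map_mul]

variable {R : CommRingCat.{u}} {S : Scheme.{u}} {π : S ⟶ Spec R} {h : ℤ →₀ ℕ}
  {E : FlatFilteredBundle π h} {d r d' r' : ℕ}

/-- The morphism `𝔻^d_{r, A} ⟶ 𝔻^{d'}_{r', A}` defined by a morphism over `R`. -/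
def diskPrecomp (v : DiskRing d' r' R →ₐ[R] DiskRing d r R) (A : Under R) :
    diskSpec d r A.right ⟶ diskSpec d' r' A.right :=
  Spec.map (CommRingCat.ofHom (diskBaseChange v A))

theorem diskSpecMap_diskPrecomp (v : DiskRing d' r' R →ₐ[R] DiskRing d r R) {A B : Under R}
    (u : A ⟶ B) : diskSpecMap d r u.right.hom ≫ diskPrecomp v A =
      diskPrecomp v B ≫ diskSpecMap d' r' u.right.hom := by
  simp only [diskSpecMap, diskPrecomp, ← Spec.map_comp, ← CommRingCat.ofHom_comp,
    diskBaseChange_natural v u]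

/-- Morphisms of disks over the same base are surjective on points, so if the composite jet factors
through `U`, so does the original one. -/
theorem top_le_of_diskPrecomp (v : DiskRing d' r' R →ₐ[R] DiskRing d r R) {A B : Under R}
    (u : A ⟶ B) (j : diskSpec d' r' A.right ⟶ S) {U : S.Opens}
    (hU : ⊤ ≤ (diskSpecMap d r u.right.hom ≫ diskPrecomp v A ≫ j) ⁻¹ᵁ U) :
    ⊤ ≤ (diskSpecMap d' r' u.right.hom ≫ j) ⁻¹ᵁ U := by
  intro p _
  obtain ⟨p₀, rfl⟩ := exists_SpecMap_eq _ (diskBaseChange_const v B) p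
  have h1 : diskSpecMap d r u.right.hom ≫ diskPrecomp v A ≫ j =
      diskPrecomp v B ≫ diskSpecMap d' r' u.right.hom ≫ j := by
    rw [← Category.assoc, diskSpecMap_diskPrecomp, Category.assoc]
  rw [h1] at hU
  exact hU (Set.mem_univ p₀)

namespace FrameCoords

theorem ev_pull_diskPrecomp (v : DiskRing d' r' R →ₐ[R] DiskRing d r R) {A B : Under R}
    (u : A ⟶ B) {j : diskSpec d' r' A.right ⟶ S} (F : FrameCoords E j) {U : S.Opens}
    (hU : ⊤ ≤ (diskSpecMap d r u.right.hom ≫ diskPrecomp v A ≫ j) ⁻¹ᵁ U)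
    (hU' : ⊤ ≤ (diskSpecMap d' r' u.right.hom ≫ j) ⁻¹ᵁ U) (a : Fin (totalRank h))
    (s : Γ(E.H, U)) : (F.pull (diskPrecomp v A)).ev (diskSpecMap d r u.right.hom) U hU a s =
      diskBaseChange v B (F.ev (diskSpecMap d' r' u.right.hom) U hU' a s) := by
  have hU'' : ⊤ ≤ ((diskPrecomp v B ≫ diskSpecMap d' r' u.right.hom) ≫ j) ⁻¹ᵁ U :=
    fun _ _ => hU' (Set.mem_univ _)
  refine (F.ev_pull _ _ hU a s).trans ?_
  refine (F.ev_congr (diskSpecMap_diskPrecomp v u) hU hU'' a s).trans ?_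
  exact F.ev_SpecMap (diskBaseChange v B) _ hU' hU'' a s

theorem IsFlat.pull_diskPrecomp [IsDomain R] (v : DiskRing d' r' R →ₐ[R] DiskRing d r R)
    {A : Under R} {j : diskSpec d' r' A.right ⟶ S} {F : FrameCoords E j} (hF : F.IsFlat) :
    (F.pull (diskPrecomp v A)).IsFlat := by
  intro B u U hU a s
  -- The base change of `v` is defined for `R`-algebras, so the test ring receives the structure of
  -- an `R`-algebra through `A`.
  let B' : Under R := Under.mk (A.hom ≫ CommRingCat.ofHom u)
  let u' : A ⟶ B' := Under.homMk (CommRingCat.ofHom u)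
  have hU' := top_le_of_diskPrecomp v u' j hU
  have hU'' : ⊤ ≤ (diskPrecomp v B' ≫ diskSpecMap d' r' u ≫ j) ⁻¹ᵁ U.1 :=
    fun _ _ => hU' (Set.mem_univ _)
  have h1 : diskSpecMap d r u ≫ diskPrecomp v A ≫ j =
      diskPrecomp v B' ≫ diskSpecMap d' r' u ≫ j := by
    rw [← Category.assoc, ← Category.assoc]
    exact congrArg (· ≫ j) (diskSpecMap_diskPrecomp v u')
  refine isHorizontalAt_congr (IsHorizontalAt.diskBaseChange (A := B') (hF B u U hU' a s) v)
    (fun c => ?_) (fun t => (F.ev_pull_diskPrecomp v u' hU hU' a t).symm)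
  exact ((diskPt_congr h1 hU hU'' c).trans
    (evalAt_SpecMap (CommRingCat.ofHom (diskBaseChange v B')) _ hU' hU'' c)).symm

theorem IsPeriodFlag.pull_diskPrecomp (v : DiskRing d' r' R →ₐ[R] DiskRing d r R)
    {A : Under R} {j : diskSpec d' r' A.right ⟶ S} {F : FrameCoords E j}
    {y : Flag h (DiskRing d' r' A.right)} (hy : F.IsPeriodFlag y) :
    (F.pull (diskPrecomp v A)).IsPeriodFlag (y.baseChange (diskBaseChange v A)) := by
  intro B u U w hw hU
  let B' : Under R := Under.mk (A.hom ≫ CommRingCat.ofHom u)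
  let u' : A ⟶ B' := Under.homMk (CommRingCat.ofHom u)
  have hU' := top_le_of_diskPrecomp v u' j hU
  have h1 : (diskMap d r u).comp (diskBaseChange v A) =
      (diskBaseChange v B').comp (diskMap d' r' u) := (diskBaseChange_natural v u').symm
  rw [← Flag.baseChange_comp, h1, Flag.baseChange_comp, hy B u U w hw hU']
  refine (flagOfMatrix_baseChange _ _).trans (congrArg (flagOfMatrix h) ?_)
  exact Units.ext (Matrix.ext fun a b => (F.ev_pull_diskPrecomp v u' hU hU' a (w b)).symm)

end FrameCoords

namespace FramedJet

variable [IsDomain R]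

/-- The composition of a jet with a flat frame with a morphism of disks. -/
def precomp (v : DiskRing d' r' R →ₐ[R] DiskRing d r R) {A : Under R} (p : FramedJet E d' r' A) :
    FramedJet E d r A :=
  ⟨(jetPrecomp π v).app A p.jet, p.frame.pull (diskPrecomp v A), p.isFlat.pull_diskPrecomp v⟩

theorem ev_precomp (v : DiskRing d' r' R →ₐ[R] DiskRing d r R) {A B : Under R} (u : A ⟶ B)
    (p : FramedJet E d' r' A) {U : S.Opens}
    (hU : ⊤ ≤ (diskSpecMap d r u.right.hom ≫ (p.precomp v).jet.1) ⁻¹ᵁ U)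
    (hU' : ⊤ ≤ (diskSpecMap d' r' u.right.hom ≫ p.jet.1) ⁻¹ᵁ U) (a : Fin (totalRank h))
    (s : Γ(E.H, U)) : (p.precomp v).frame.ev (diskSpecMap d r u.right.hom) U hU a s =
      diskBaseChange v B (p.frame.ev (diskSpecMap d' r' u.right.hom) U hU' a s) :=
  p.frame.ev_pull_diskPrecomp v u hU hU' a s

theorem map_precomp (v : DiskRing d' r' R →ₐ[R] DiskRing d r R) {A B : Under R} (u : A ⟶ B)
    (p : FramedJet E d' r' A) : (p.map u).precomp v = (p.precomp v).map u := by
  refine FramedJet.ext_ev ?_ fun C w U hU hU' a s => ?_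
  · exact ConcreteCategory.congr_hom ((jetPrecomp π v).naturality u) p.jet
  · let C' : Under R := Under.mk (B.hom ≫ CommRingCat.ofHom w)
    let w' : B ⟶ C' := Under.homMk (CommRingCat.ofHom w)
    have h1 := top_le_of_diskPrecomp v w' (p.map u).jet.1 hU
    have h2 := top_le_of_map u p w h1
    have h3 := top_le_of_map u (p.precomp v) w hU'
    refine (ev_precomp v w' (p.map u) hU h1 a s).trans ?_
    refine (congrArg _ (ev_map u p w h1 h2 a s)).trans ?_
    exact ((ev_map u (p.precomp v) w hU' h3 a s).trans
      (ev_precomp v (u ≫ w') p h3 h2 a s)).symm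

theorem smul_precomp (v : DiskRing d' r' R →ₐ[R] DiskRing d r R) {A : Under R}
    (N : GL (Fin (totalRank h)) A.right) (p : FramedJet E d' r' A) :
    (N • p).precomp v = N • p.precomp v := by
  refine FramedJet.ext_ev rfl fun C w U hU hU' a s => ?_
  let C' : Under R := Under.mk (A.hom ≫ CommRingCat.ofHom w)
  let w' : A ⟶ C' := Under.homMk (CommRingCat.ofHom w)
  have h1 := top_le_of_diskPrecomp v w' p.jet.1 hU
  refine (ev_precomp v w' (N • p) hU h1 a s).trans ?_
  refine (congrArg _ (ev_smul N p w h1 a s)).trans ?_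
  refine Eq.trans ?_ (ev_smul N (p.precomp v) w hU' a s).symm
  rw [map_sum]
  refine Finset.sum_congr rfl fun b _ => ?_
  refine (map_mul _ _ _).trans (congrArg₂ (· * ·) ?_ (ev_precomp v w' p hU' h1 b s).symm)
  exact RingHom.congr_fun (diskBaseChange_const v C') _

theorem flag_precomp (v : DiskRing d' r' R →ₐ[R] DiskRing d r R) {A : Under R}
    (p : FramedJet E d' r' A) : (p.precomp v).flag = p.flag.baseChange (diskBaseChange v A) :=
  (p.precomp v).isPeriodFlag_flag.unique (p.isPeriodFlag_flag.pull_diskPrecomp v)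

end FramedJet

theorem commutes_periodMap_precomp [IsDomain R] (E : FlatFilteredBundle π h)
    (hr : IsUnit ((r.factorial : ℕ) : R)) (hr' : IsUnit ((r'.factorial : ℕ) : R))
    (v : DiskRing d' r' R →ₐ[R] DiskRing d r R) :
    Commutes (periodMap E d' r' hr') (periodMap E d r hr) (jetPrecomp π v)
      (jetFlagPrecomp h v) := by
  refine ⟨{ app := fun A => ↾fun p : FramedJet E d' r' A => p.precomp v,
            naturality := fun A B u => ConcreteCategory.hom_ext _ _ fun p =>
              FramedJet.map_precomp v u p }, fun N p => FramedJet.smul_precomp v N p, ?_, ?_⟩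
  · ext A p
    rfl
  · ext A p
    exact FramedJet.flag_precomp v p

end Precomposition

/-! ### Extension of sections from basic open subsets -/

section QuasiCoherence

variable {S : Scheme.{u}}

theorem resMap_pow_smul (H : S.Modules) {U V W : S.Opens} (i : V ≤ U) (k : W ≤ V) (f : Γ(S, U))
    (n : ℕ) (x : Γ(H, V)) :
    resMap H k (S.presheaf.map (homOfLE i).op f ^ n • x) =
      S.presheaf.map (homOfLE (k.trans i)).op f ^ n • resMap H k x := by
  rw [LinearMap.map_smulₛₗ, map_pow]
  exact congrArg (fun c => c ^ n • resMap H k x) (presheaf_map_map i k f)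

theorem eq_of_locally_resMap_eq (H : S.Modules) {ι : Type*} {U : S.Opens} (W : ι → S.Opens)
    (hWU : ∀ i, W i ≤ U) (hW : ∀ x ∈ U, ∃ i, x ∈ W i) {s t : Γ(H, U)}
    (hst : ∀ i, resMap H (hWU i) s = resMap H (hWU i) t) : s = t :=
  TopCat.Sheaf.eq_of_locally_eq' (⟨H.presheaf, H.isSheaf⟩ : TopCat.Sheaf Ab S) W U
    (fun i => homOfLE (hWU i)) (fun x hx => by
      obtain ⟨i, hi⟩ := hW x hx
      exact TopologicalSpace.Opens.mem_iSup.mpr ⟨i, hi⟩) s t hst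

theorem exists_resMap_eq (H : S.Modules) {ι : Type*} {U : S.Opens} (W : ι → S.Opens)
    (hWU : ∀ i, W i ≤ U) (hW : ∀ x ∈ U, ∃ i, x ∈ W i) (s : ∀ i, Γ(H, W i))
    (hs : ∀ i j, resMap H (inf_le_left : W i ⊓ W j ≤ W i) (s i) =
      resMap H (inf_le_right : W i ⊓ W j ≤ W j) (s j)) :
    ∃ t : Γ(H, U), ∀ i, resMap H (hWU i) t = s i :=
  (TopCat.Sheaf.existsUnique_gluing' (⟨H.presheaf, H.isSheaf⟩ : TopCat.Sheaf Ab S) W U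
    (fun i => homOfLE (hWU i)) (fun x hx => by
      obtain ⟨i, hi⟩ := hW x hx
      exact TopologicalSpace.Opens.mem_iSup.mpr ⟨i, hi⟩) s fun i j => hs i j).exists

namespace IsCompatibleFrame

variable {H : S.Modules} {h : ℤ →₀ ℕ} {F : ℤ → ∀ U : S.Opens, Submodule Γ(S, U) Γ(H, U)}
  {W V : S.Opens} {w : Fin (totalRank h) → Γ(H, W)}

theorem exists_pow_smul_eq_resMap (hw : IsCompatibleFrame F w) (hW : IsAffineOpen W) (f : Γ(S, W))
    (hV : V = S.basicOpen f) (i : V ≤ W) {k : ℤ} {t : Γ(H, V)} (ht : t ∈ F k V) :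
    ∃ (n : ℕ) (t' : Γ(H, W)), t' ∈ F k W ∧
      resMap H i t' = S.presheaf.map (homOfLE i).op f ^ n • t := by
  subst hV
  have := hW.isLocalization_basicOpen f
  rw [hw.span_eq_filtration k _ i] at ht
  induction ht using Submodule.span_induction with
  | mem t ht =>
    obtain ⟨a, ha, rfl⟩ := ht
    refine ⟨0, w a, ?_, by simp⟩
    rw [hw.span_eq_filtration k W le_rfl]
    exact Submodule.subset_span ⟨a, ha, resMap_self H (w a)⟩
  | zero => exact ⟨0, 0, Submodule.zero_mem _, by simp⟩
  | add x y _ _ hx hy =>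
    obtain ⟨n, x', hx', hx⟩ := hx
    obtain ⟨m, y', hy', hy⟩ := hy
    refine ⟨n + m, f ^ m • x' + f ^ n • y',
      Submodule.add_mem _ (Submodule.smul_mem _ _ hx') (Submodule.smul_mem _ _ hy'), ?_⟩
    rw [map_add, LinearMap.map_smulₛₗ, LinearMap.map_smulₛₗ, hx, hy, smul_add, map_pow, map_pow,
      smul_smul, smul_smul, ← pow_add, ← pow_add, add_comm m n]
  | smul c x _ hx =>
    obtain ⟨n, x', hx', hx⟩ := hx
    obtain ⟨m, c', hc⟩ := IsLocalization.Away.surj f c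
    have hc' : S.presheaf.map (homOfLE i).op c' =
      c * S.presheaf.map (homOfLE i).op f ^ m := hc.symm
    refine ⟨n + m, c' • x', Submodule.smul_mem _ _ hx', ?_⟩
    rw [LinearMap.map_smulₛₗ, hx]
    refine (congrArg (· • _) hc').trans ?_
    rw [smul_smul, smul_smul]
    congr 1
    ring

theorem exists_pow_smul_eq_zero (hw : IsCompatibleFrame F w) (hW : IsAffineOpen W) (f : Γ(S, W))
    (hV : V = S.basicOpen f) (i : V ≤ W) {t : Γ(H, W)} (ht : resMap H i t = 0) :
    ∃ n : ℕ, f ^ n • t = 0 := by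
  subst hV
  have := hW.isLocalization_basicOpen f
  have h1 : ∀ a, ∃ n : ℕ, f ^ n * (hw.basis le_rfl).repr t a = 0 := by
    intro a
    have h2 := hw.repr_res le_rfl i t a
    rw [ht, map_zero, Finsupp.zero_apply] at h2
    obtain ⟨n, hn⟩ := IsLocalization.Away.exists_of_eq (S := Γ(S, S.basicOpen f)) f
      (a := (hw.basis le_rfl).repr t a) (b := 0) (h2.symm.trans (map_zero _).symm)
    exact ⟨n, hn.trans (mul_zero _)⟩
  choose n hn using h1
  refine ⟨∑ a, n a, ?_⟩
  rw [← (hw.basis le_rfl).sum_repr t, Finset.smul_sum]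
  refine Finset.sum_eq_zero fun a _ => ?_
  obtain ⟨m, hm⟩ := Nat.exists_eq_add_of_le (Finset.single_le_sum (f := n)
    (fun _ _ => Nat.zero_le _) (Finset.mem_univ a))
  rw [smul_smul, hm, add_comm, pow_add, mul_assoc, hn, mul_zero, zero_smul]

end IsCompatibleFrame

namespace FlatFilteredBundle

variable {R : CommRingCat.{u}} {π : S ⟶ Spec R} {h : ℤ →₀ ℕ} (E : FlatFilteredBundle π h)

theorem exists_basicOpen_frame {U : S.Opens} (hU : IsAffineOpen U) {x : S} (hx : x ∈ U) :
    ∃ (f : Γ(S, U)) (w : Fin (totalRank h) → Γ(E.H, S.basicOpen f)), x ∈ S.basicOpen f ∧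
      IsCompatibleFrame (h := h) E.F w := by
  obtain ⟨W, w, _, hxW, hw⟩ := E.exists_affine_frame hx
  obtain ⟨f, hf, hxf⟩ := hU.exists_basicOpen_le ⟨x, hxW⟩ hx
  exact ⟨f, _, hxf, hw.res hf⟩

theorem exists_finite_frames {U : S.Opens} (hU : IsAffineOpen U) :
    ∃ (ι : Type u) (_ : Finite ι) (g : ι → Γ(S, U))
      (w : ∀ i, Fin (totalRank h) → Γ(E.H, S.basicOpen (g i))),
      (∀ i, IsCompatibleFrame (h := h) E.F (w i)) ∧ ∀ x ∈ U, ∃ i, x ∈ S.basicOpen (g i) := by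
  choose g w hx hw using fun x : U => E.exists_basicOpen_frame hU x.2
  obtain ⟨t, ht⟩ := hU.isCompact.elim_finite_subcover (fun x => (S.basicOpen (g x) : Set S))
    (fun x => (S.basicOpen (g x)).2) fun x hxU => Set.mem_iUnion.mpr ⟨⟨x, hxU⟩, hx ⟨x, hxU⟩⟩
  refine ⟨t, inferInstance, fun x => g x.1, fun x => w x.1, fun x => hw x.1, fun x hxU => ?_⟩
  obtain ⟨y, hy, hxy⟩ := Set.mem_iUnion₂.mp (ht hxU)
  exact ⟨⟨y, hy⟩, hxy⟩

theorem filtration_eq_top {k : ℤ} (hk : tailRank h k = totalRank h) (U : S.Opens) :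
    E.F k U = ⊤ := by
  refine eq_top_iff.mpr fun s _ => E.mem_of_locally k U s fun x hx => ?_
  obtain ⟨W, w, hWU, hxW, hw⟩ := E.exists_affine_frame hx
  refine ⟨W.1, hWU, hxW, ?_⟩
  rw [hw.span_eq_filtration k W.1 le_rfl, hk]
  have h1 : {a : Fin (totalRank h) | (a : ℕ) < totalRank h} = Set.univ :=
    Set.eq_univ_of_forall fun a => a.2
  rw [h1, Set.image_univ, hw.span_eq_top W.1 le_rfl]
  trivial

/-- Sections of the filtration over a basic open subset extend, up to a denominator. -/
theorem exists_pow_smul_eq_resMap {U V : S.Opens} (hU : IsAffineOpen U) (f : Γ(S, U))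
    (hV : V = S.basicOpen f) (hVU : V ≤ U) {k : ℤ} {t : Γ(E.H, V)} (ht : t ∈ E.F k V) :
    ∃ (n : ℕ) (t' : Γ(E.H, U)), t' ∈ E.F k U ∧
      resMap E.H hVU t' = S.presheaf.map (homOfLE hVU).op f ^ n • t := by
  obtain ⟨ι, _, g, w, hw, hcov⟩ := E.exists_finite_frames hU
  have := Fintype.ofFinite ι
  have hgU : ∀ i, S.basicOpen (g i) ≤ U := fun i => S.basicOpen_le _
  have hbV : ∀ {W : S.Opens} (i : W ≤ U), W ⊓ V = S.basicOpen (S.presheaf.map (homOfLE i).op f) :=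
    fun i => by rw [Scheme.basicOpen_res, hV]
  have h1 : ∀ i, ∃ (n : ℕ) (t' : Γ(E.H, S.basicOpen (g i))), t' ∈ E.F k (S.basicOpen (g i)) ∧
      resMap E.H (inf_le_left : S.basicOpen (g i) ⊓ V ≤ _) t' =
        S.presheaf.map (homOfLE ((inf_le_right : S.basicOpen (g i) ⊓ V ≤ V).trans hVU)).op f ^ n •
          resMap E.H (inf_le_right : S.basicOpen (g i) ⊓ V ≤ _) t := by
    intro i
    obtain ⟨n, t', ht', hn⟩ := (hw i).exists_pow_smul_eq_resMap (hU.basicOpen (g i))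
      (S.presheaf.map (homOfLE (hgU i)).op f) (hbV (hgU i)) inf_le_left
      (E.res_mem k (inf_le_right : S.basicOpen (g i) ⊓ V ≤ _) t ht)
    refine ⟨n, t', ht', hn.trans ?_⟩
    rw [presheaf_map_map]
  choose n t₁ ht₁ hn using h1
  -- The cover by domains of frames is finite, so one exponent of `f` extends the section over every
  -- member.
  obtain ⟨N, hN⟩ : ∃ N, ∀ i, n i ≤ N := ⟨∑ i, n i, fun i => Finset.single_le_sum (f := n)
    (fun _ _ => Nat.zero_le _) (Finset.mem_univ i)⟩
  obtain ⟨t₂, ht₂', ht₂⟩ : ∃ t₂ : ∀ i, Γ(E.H, S.basicOpen (g i)),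
      (∀ i, t₂ i ∈ E.F k (S.basicOpen (g i))) ∧
      ∀ i, resMap E.H (inf_le_left : S.basicOpen (g i) ⊓ V ≤ _) (t₂ i) =
        S.presheaf.map (homOfLE ((inf_le_right : S.basicOpen (g i) ⊓ V ≤ V).trans hVU)).op f ^ N •
          resMap E.H (inf_le_right : S.basicOpen (g i) ⊓ V ≤ _) t := by
    refine ⟨fun i => S.presheaf.map (homOfLE (hgU i)).op f ^ (N - n i) • t₁ i,
      fun i => Submodule.smul_mem _ _ (ht₁ i), fun i => ?_⟩
    rw [resMap_pow_smul, hn, smul_smul, ← pow_add, Nat.sub_add_cancel (hN i)]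
  -- Two extensions agree where `f` is invertible, so on the affine overlap, where `H` is free,
  -- their difference is killed by a power of `f`.
  have h2 : ∀ i j, ∃ m : ℕ, S.presheaf.map (homOfLE
      (inf_le_left.trans (hgU i) : S.basicOpen (g i) ⊓ S.basicOpen (g j) ≤ U)).op f ^ m •
        (resMap E.H inf_le_left (t₂ i) - resMap E.H inf_le_right (t₂ j)) = 0 := by
    intro i j
    have haff : IsAffineOpen (S.basicOpen (g i) ⊓ S.basicOpen (g j)) := by
      rw [← Scheme.basicOpen_mul]
      exact hU.basicOpen _
    refine ((hw i).res inf_le_left).exists_pow_smul_eq_zero haff _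
      (hbV (inf_le_left.trans (hgU i))) inf_le_left ?_
    have e1 : (S.basicOpen (g i) ⊓ S.basicOpen (g j)) ⊓ V ≤ S.basicOpen (g i) ⊓ V :=
      inf_le_inf_right _ inf_le_left
    have e2 : (S.basicOpen (g i) ⊓ S.basicOpen (g j)) ⊓ V ≤ S.basicOpen (g j) ⊓ V :=
      inf_le_inf_right _ inf_le_right
    have h3 := congrArg (resMap E.H e1) (ht₂ i)
    have h4 := congrArg (resMap E.H e2) (ht₂ j)
    rw [resMap_pow_smul, resMap_resMap, resMap_resMap] at h3 h4
    rw [map_sub, resMap_resMap, resMap_resMap, sub_eq_zero]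
    exact h3.trans h4.symm
  choose m hm using h2
  obtain ⟨M, hM⟩ : ∃ M, ∀ i j, m i j ≤ M := ⟨∑ i, ∑ j, m i j, fun i j =>
    (Finset.single_le_sum (f := m i) (fun _ _ => Nat.zero_le _) (Finset.mem_univ j)).trans
      (Finset.single_le_sum (f := fun i => ∑ j, m i j) (fun _ _ => Nat.zero_le _)
        (Finset.mem_univ i))⟩
  -- After multiplication by one more common power of `f` the local extensions agree on all
  -- overlaps.
  obtain ⟨t', ht'⟩ := exists_resMap_eq E.H (fun i => S.basicOpen (g i)) hgU hcov
    (fun i => S.presheaf.map (homOfLE (hgU i)).op f ^ M • t₂ i) fun i j => by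
      rw [resMap_pow_smul, resMap_pow_smul, ← sub_eq_zero]
      refine (smul_sub _ _ _).symm.trans ?_
      obtain ⟨c, hc⟩ := Nat.exists_eq_add_of_le (hM i j)
      rw [hc, add_comm, pow_add, mul_smul, hm, smul_zero]
  refine ⟨M + N, t', E.mem_of_locally k U t' fun x hx => ?_, ?_⟩
  · obtain ⟨i, hi⟩ := hcov x hx
    refine ⟨_, hgU i, hi, ?_⟩
    rw [ht']
    exact Submodule.smul_mem _ _ (ht₂' i)
  · refine eq_of_locally_resMap_eq E.H (fun i => S.basicOpen (g i) ⊓ V) (fun i => inf_le_right)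
      (fun x hx => ?_) fun i => ?_
    · obtain ⟨i, hi⟩ := hcov x (hVU hx)
      exact ⟨i, hi, hx⟩
    · have h3 := congrArg (resMap E.H (inf_le_left : S.basicOpen (g i) ⊓ V ≤ _)) (ht' i)
      rw [resMap_pow_smul, ht₂, resMap_resMap, smul_smul, ← pow_add] at h3
      rw [resMap_resMap, resMap_pow_smul]
      exact h3

end FlatFilteredBundle

end QuasiCoherence

/-! ### Frames defined by étale local infinitesimal period maps -/

section ElimpFrames

variable {d r : ℕ} {A : Type u} [CommRing A]

section

variable {C : Type u} [CommRing C] {ι : Type*} {z : ι → C}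

theorem map_mem_span_diskVar_pow {χ : C →+* DiskRing d r A}
    (hz : ∀ i, diskEval d r A (χ (z i)) = 0) {n : ℕ} {c : C}
    (hc : c ∈ Ideal.span (Set.range z) ^ n) : χ c ∈ Ideal.span (Set.range (diskVar d r A)) ^ n := by
  have h1 : (Ideal.span (Set.range z)).map χ ≤ Ideal.span (Set.range (diskVar d r A)) := by
    rw [Ideal.map_span, Ideal.span_le]
    rintro _ ⟨_, ⟨i, rfl⟩, rfl⟩
    exact mem_span_diskVar d r (hz i)
  have h2 := Ideal.mem_map_of_mem χ hc
  rw [Ideal.map_pow] at h2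
  exact Ideal.pow_right_mono h1 n h2

theorem map_eq_zero_of_mem_pow {χ : C →+* DiskRing d r A}
    (hz : ∀ i, diskEval d r A (χ (z i)) = 0) {c : C}
    (hc : c ∈ Ideal.span (Set.range z) ^ (r + 1)) : χ c = 0 := by
  have := map_mem_span_diskVar_pow hz hc
  rwa [span_diskVar_pow, Ideal.mem_bot] at this

theorem truncSucc_eq_zero_of_mem_pow {x : DiskRing d r A}
    (hx : x ∈ Ideal.span (Set.range (diskVar d r A)) ^ r) : truncSucc d r A x = 0 := by
  have h1 := Ideal.mem_map_of_mem (truncSucc d r A) hx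
  have h2 : (Ideal.span (Set.range (diskVar d r A))).map (truncSucc d r A) =
      (MvPolynomial.idealOfVars (Fin d) A).map
        (Ideal.Quotient.mk ((MvPolynomial.idealOfVars (Fin d) A) ^ r)) := by
    unfold MvPolynomial.idealOfVars
    rw [Ideal.map_span, Ideal.map_span, ← Set.range_comp, ← Set.range_comp]
    rfl
  rwa [Ideal.map_pow, h2, ← Ideal.map_pow, Ideal.map_quotient_self, Ideal.mem_bot] at h1

/-- Both sides of the horizontality equation vanish: the derivative by assumption, and the
contraction because it carries a factor from `I`, which dies modulo `(t)^r`. -/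
theorem isHorizontalAt_of_mem_smul {R C : CommRingCat.{u}} {f : R ⟶ C} {M : Type u}
    [AddCommGroup M] [Module C M] {nabla : M → CommRingCat.KaehlerDifferential f ⊗[C] M}
    {φ : C →+* DiskRing d r A} (hφ : ∀ a i, truncDeriv r i (φ (f.hom a)) = 0)
    (l : M →ₛₗ[φ] DiskRing d r A) {s : M} {I : Ideal C}
    (hI : ∀ c ∈ I, truncSucc d r A (φ c) = 0)
    (hs : nabla s ∈ (I • ⊤ : Submodule C (CommRingCat.KaehlerDifferential f ⊗[C] M)))
    (hl : ∀ i, truncDeriv r i (l s) = 0) : IsHorizontalAt nabla φ l s := by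
  rw [isHorizontalAt_iff hφ]
  intro i
  rw [hl, eq_comm]
  generalize nabla s = y at hs
  induction hs using Submodule.smul_induction_on' with
  | smul c hc x _ => rw [contract_smul, RingHom.comp_apply, hI c hc, zero_mul]
  | add x _ y _ hx hy => rw [map_add, hx, hy, add_zero]

end

variable {R : CommRingCat.{u}} {S : Scheme.{u}} {π : S ⟶ Spec R} {h : ℤ →₀ ℕ}
  {E : FlatFilteredBundle π h}

namespace Elimp

variable (ψ : Elimp E r)

/-- Lifts of the members of the flat frame. -/
def lift (i : Fin (totalRank h)) : Γ(E.H, ψ.U.1) :=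
  (ψ.flat i).choose

theorem mk_lift (i : Fin (totalRank h)) : Submodule.Quotient.mk (ψ.lift i) = ψ.b i :=
  (ψ.flat i).choose_spec.1

theorem nabla_lift_mem (i : Fin (totalRank h)) : E.nabla ψ.U (ψ.lift i) ∈
    (Ideal.span (Set.range ψ.z) ^ r • ⊤ : Submodule Γ(S, ψ.U.1)
      (CommRingCat.KaehlerDifferential (structMap π ψ.U.1) ⊗[Γ(S, ψ.U.1)] Γ(E.H, ψ.U.1))) :=
  (ψ.flat i).choose_spec.2

variable {ψ}

/-- Semilinear maps that kill `I^(r+1)` are determined by their values on the flat frame. -/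
theorem apply_eq_sum {K : Type u} [CommRing K] {χ : Γ(S, ψ.U.1) →+* K}
    (hχ : ∀ c ∈ Ideal.span (Set.range ψ.z) ^ (r + 1), χ c = 0)
    (l : Γ(E.H, ψ.U.1) →ₛₗ[χ] K) (s : Γ(E.H, ψ.U.1)) :
    l s = ∑ a, Ideal.Quotient.lift _ χ hχ (ψ.b.repr (Submodule.Quotient.mk s) a) *
      l (ψ.lift a) := by
  choose c hc using fun a => Ideal.Quotient.mk_surjective (ψ.b.repr (Submodule.Quotient.mk s) a)
  have h1 : s - ∑ a, c a • ψ.lift a ∈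
      (Ideal.span (Set.range ψ.z) ^ (r + 1) • ⊤ : Submodule Γ(S, ψ.U.1) Γ(E.H, ψ.U.1)) := by
    rw [← Submodule.Quotient.mk_eq_zero, Submodule.Quotient.mk_sub, sub_eq_zero]
    refine (ψ.b.sum_repr _).symm.trans ?_
    refine Eq.trans ?_ (map_sum (Submodule.mkQ _) _ _).symm
    refine Finset.sum_congr rfl fun a _ => ?_
    rw [← hc, ← ψ.mk_lift]
    rfl
  have h2 : ∀ x ∈ (Ideal.span (Set.range ψ.z) ^ (r + 1) • ⊤ :
      Submodule Γ(S, ψ.U.1) Γ(E.H, ψ.U.1)), l x = 0 := by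
    intro x hx
    induction hx using Submodule.smul_induction_on' with
    | smul c hc x _ => rw [LinearMap.map_smulₛₗ, hχ c hc, zero_smul]
    | add x _ y _ hx hy => rw [map_add, hx, hy, add_zero]
  have h3 := h2 _ h1
  rw [map_sub, map_sum, sub_eq_zero] at h3
  rw [h3]
  refine Finset.sum_congr rfl fun a _ => ?_
  rw [← hc, LinearMap.map_smulₛₗ]
  rfl

/-- A section over a basic open extends to `U` after multiplication by a power of `f`, and `f` is
invertible on the basic open. The coefficients `c` are chosen before the functional `l`; this lets
one expansion apply to several functionals at once. -/
theorem exists_apply_eq_sum {K : Type u} [CommRing K] {V : S.Opens} {f : Γ(S, ψ.U.1)}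
    (hV : V = S.basicOpen f) (hVU : V ≤ ψ.U.1) {χ : Γ(S, V) →+* K}
    (hχ : ∀ c ∈ Ideal.span (Set.range ψ.z) ^ (r + 1),
      χ (S.presheaf.map (homOfLE hVU).op c) = 0) (t : Γ(E.H, V)) :
    ∃ c : Fin (totalRank h) → K, ∀ l : Γ(E.H, V) →ₛₗ[χ] K,
      l t = ∑ a, c a * l (resMap E.H hVU (ψ.lift a)) := by
  -- The extension of sections is stated for steps of the filtration; a step that is everything
  -- gives the case of arbitrary sections.
  obtain ⟨k, hk⟩ := exists_tailRank_eq_total h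
  obtain ⟨n, t', -, ht'⟩ := E.exists_pow_smul_eq_resMap ψ.U.2 f hV hVU (k := k) (t := t) (by
    rw [E.filtration_eq_top hk]
    trivial)
  have hf : IsUnit (χ (S.presheaf.map (homOfLE hVU).op f) ^ n) := by
    subst hV
    exact ((RingedSpace.isUnit_res_basicOpen S.toRingedSpace f).map χ).pow n
  obtain ⟨e, he⟩ := hf
  refine ⟨fun a => e⁻¹.1 * Ideal.Quotient.lift _ (χ.comp (S.presheaf.map (homOfLE hVU).op).hom) hχ
    (ψ.b.repr (Submodule.Quotient.mk t') a), fun l => ?_⟩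
  let l' : Γ(E.H, ψ.U.1) →ₛₗ[χ.comp (S.presheaf.map (homOfLE hVU).op).hom] K :=
    { toFun := fun s => l (resMap E.H hVU s)
      map_add' := fun x y => by rw [map_add, map_add]
      map_smul' := fun c x => by
        rw [LinearMap.map_smulₛₗ, LinearMap.map_smulₛₗ]
        rfl }
  have h1 := apply_eq_sum (ψ := ψ) hχ l' t'
  have h2 : l' t' = e.1 * l t := by
    change l (resMap E.H hVU t') = _
    rw [ht', LinearMap.map_smulₛₗ, he, map_pow]
    rfl
  simp only [mul_assoc]
  rw [← Finset.mul_sum]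
  exact (Units.eq_inv_mul_iff_mul_eq e).mpr (h2.symm.trans h1)

end Elimp

end ElimpFrames

/-! ### Frames adapted to an elimp -/

section AdaptedFrames

variable {R : CommRingCat.{u}} {S : Scheme.{u}} {π : S ⟶ Spec R} {h : ℤ →₀ ℕ}
  {E : FlatFilteredBundle π h} {d r : ℕ}

namespace IsCompatibleFrame

/-- The coordinates with respect to a frame of the bundle, along a ring homomorphism. -/
def coord {H : S.Modules}
    {F : ℤ → ∀ U : S.Opens, Submodule Γ(S, U) Γ(H, U)} {V : S.Opens}
    {w : Fin (totalRank h) → Γ(H, V)} (hw : IsCompatibleFrame F w) {K : Type u} [CommRing K]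
    (χ : Γ(S, V) →+* K) (a : Fin (totalRank h)) : Γ(H, V) →ₛₗ[χ] K where
  toFun s := χ ((hw.basis le_rfl).repr s a)
  map_add' s t := by rw [map_add, Finsupp.add_apply, map_add]
  map_smul' c s := by rw [map_smul, Finsupp.smul_apply, smul_eq_mul, map_mul]; rfl

theorem coord_apply_frame {H : S.Modules}
    {F : ℤ → ∀ U : S.Opens, Submodule Γ(S, U) Γ(H, U)} {V : S.Opens}
    {w : Fin (totalRank h) → Γ(H, V)} (hw : IsCompatibleFrame F w) {K : Type u} [CommRing K]
    (χ : Γ(S, V) →+* K) (a b : Fin (totalRank h)) :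
    hw.coord χ a (w b) = (1 : Matrix (Fin (totalRank h)) (Fin (totalRank h)) K) a b := by
  change χ ((hw.basis le_rfl).repr (w b) a) = _
  have h1 : w b = hw.basis le_rfl b := by rw [hw.basis_apply, resMap_self]
  rw [h1, Module.Basis.repr_self, Finsupp.single_apply, Matrix.one_apply]
  simp only [eq_comm (a := a), apply_ite χ, map_one, map_zero]

end IsCompatibleFrame

namespace Elimp

variable (ψ : Elimp E r)

/-- The elimp `ψ` is defined at the base points of the family of jets `j`. -/
def IsDefinedAlong {A : Type u} [CommRing A] (j : diskSpec d r A ⟶ S) : Prop :=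
  ∀ (B : CommRingCat.{u}) (u : A →+* B) (hU : ⊤ ≤ (diskSpecMap d r u ≫ j) ⁻¹ᵁ ψ.U.1) (i : Fin ψ.n),
    diskEval d r B (diskPt (diskSpecMap d r u ≫ j) ψ.U.1 hU (ψ.z i)) = 0

/-- The coordinates in the frame `F` extend those in the flat frame of `ψ`. -/
def IsAdapted {A : Type u} [CommRing A] {j : diskSpec d r A ⟶ S} (F : FrameCoords E j) : Prop :=
  ∀ (B : CommRingCat.{u}) (u : A →+* B) (hU : ⊤ ≤ (diskSpecMap d r u ≫ j) ⁻¹ᵁ ψ.U.1)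
    (a b : Fin (totalRank h)), F.ev (diskSpecMap d r u) ψ.U.1 hU b (ψ.lift a) =
      (1 : Matrix (Fin (totalRank h)) (Fin (totalRank h)) (DiskRing d r B)) a b

variable {ψ}

section

variable {A B : Type u} [CommRing A] [CommRing B] {j : diskSpec d r A ⟶ S}

theorem IsDefinedAlong.map_eq_zero (hj : ψ.IsDefinedAlong j) {B : CommRingCat.{u}} (u : A →+* B)
    {V : S.Opens} (hVU : V ≤ ψ.U.1) (hV : ⊤ ≤ (diskSpecMap d r u ≫ j) ⁻¹ᵁ V) {c : Γ(S, ψ.U.1)}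
    (hc : c ∈ Ideal.span (Set.range ψ.z) ^ (r + 1)) :
    diskPt (diskSpecMap d r u ≫ j) V hV (S.presheaf.map (homOfLE hVU).op c) = 0 :=
  (diskPt_map _ hVU hV c).trans (map_eq_zero_of_mem_pow (hj B u _) hc)

/-- The coordinates of the lifts are prescribed, and along a jet at which the elimp is defined they
determine the coordinates of all sections over the basic open. -/
theorem ext_of_isAdapted {F F' : FrameCoords E j} (hF : ψ.IsAdapted F) (hF' : ψ.IsAdapted F')
    (hj : ψ.IsDefinedAlong j) {f : Γ(S, ψ.U.1)}
    {w : Fin (totalRank h) → Γ(E.H, S.basicOpen f)} (hw : IsCompatibleFrame (h := h) E.F w)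
    (hV : ⊤ ≤ (diskSpecMap d r (RingHom.id A) ≫ j) ⁻¹ᵁ S.basicOpen f) : F = F' := by
  have hVU : S.basicOpen f ≤ ψ.U.1 := S.basicOpen_le f
  refine FrameCoords.ext_of_frame hw hV fun a b => ?_
  obtain ⟨c, hc⟩ := exists_apply_eq_sum rfl hVU
    (fun c hc => hj.map_eq_zero (B := .of A) (RingHom.id A) hVU hV hc) (w a)
  rw [hc, hc]
  refine Finset.sum_congr rfl fun i _ => congrArg _ ?_
  rw [F.ev_resMap _ hVU hV, F'.ev_resMap _ hVU hV]
  exact (hF (.of A) _ _ i b).trans (hF' (.of A) _ _ i b).symm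

end

/-- The defect of horizontality is semilinear with values in `A[t]/(t)^r`, along a homomorphism that
kills `I^(r+1)`, so it is determined by its values on the lifts. These vanish: the coordinates of a
lift are the constants `0` and `1`, and its derivative lies in `I^r`. -/
theorem IsAdapted.isFlat {A : Under R} {x : (jetSpace π d r).obj A} {F : FrameCoords E x.1}
    (hF : ψ.IsAdapted F) (hx : ψ.IsDefinedAlong x.1) {f : Γ(S, ψ.U.1)}
    {w : Fin (totalRank h) → Γ(E.H, S.basicOpen f)} (hw : IsCompatibleFrame (h := h) E.F w)
    (hV : ⊤ ≤ x.1 ⁻¹ᵁ S.basicOpen f) : F.IsFlat := by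
  have hVU : S.basicOpen f ≤ ψ.U.1 := S.basicOpen_le f
  refine FrameCoords.isFlat_of_frames (ι := Unit) (fun _ => ⟨S.basicOpen f, ψ.U.2.basicOpen f⟩)
    (fun _ => w) (fun _ => hw) (fun y => ⟨(), hV (Set.mem_univ y)⟩) fun _ B u hVB a b => ?_
  rw [isHorizontalAt_iff_defect (E.isFlatConnection _) (truncDeriv_diskPt_structMap x u hVB)]
  intro i
  have hUB : ⊤ ≤ (diskSpecMap d r u ≫ x.1) ⁻¹ᵁ ψ.U.1 := fun y hy => hVU (hVB hy)
  obtain ⟨e, he⟩ := exists_apply_eq_sum (ψ := ψ) rfl hVU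
    (χ := (truncSucc d r B).comp (diskPt (diskSpecMap d r u ≫ x.1) (S.basicOpen f) hVB))
    (fun c hc => (congrArg _ (hx.map_eq_zero u hVU hVB hc)).trans (map_zero _)) (w b)
  refine (he _).trans (Finset.sum_eq_zero fun k _ => ?_)
  have h1 : IsHorizontalAt (E.nabla ψ.U) (diskPt (diskSpecMap d r u ≫ x.1) ψ.U.1 hUB)
      (F.ev (diskSpecMap d r u) ψ.U.1 hUB a) (ψ.lift k) :=
    isHorizontalAt_of_mem_smul (truncDeriv_diskPt_structMap x u hUB) _
      (fun c hc => truncSucc_eq_zero_of_mem_pow (map_mem_span_diskVar_pow (hx B u hUB) hc))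
      (ψ.nabla_lift_mem k) fun i => by
        rw [hF B u hUB k a, Matrix.one_apply]
        split_ifs
        · have h2 := truncDeriv_diskConst (r := r) i (1 : B)
          rwa [map_one] at h2
        · exact map_zero _
  have h2 := (isHorizontalAt_map_iff (structMap_res π hVU) (resMap E.H hVU)
    (truncDeriv_diskPt_structMap x u hUB) (truncDeriv_diskPt_structMap x u hVB) _
    (F.ev (diskSpecMap d r u) (S.basicOpen f) hVB a)
    (fun c => (diskPt_map _ hVU hVB c).symm) (fun t => (F.ev_resMap _ hVU hVB a t).symm)
    (E.nabla_res (V := ⟨S.basicOpen f, ψ.U.2.basicOpen f⟩) hVU (ψ.lift k))).mp h1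
  have h3 := (isHorizontalAt_iff_defect
    (E.isFlatConnection ⟨S.basicOpen f, ψ.U.2.basicOpen f⟩)
    (truncDeriv_diskPt_structMap x u hVB) _ _).mp h2 i
  exact (congrArg (e k * ·) h3).trans (mul_zero _)

/-- In the adapted frame, the matrix of coordinates of the bundle frame `w` has to express `w` in
terms of the lifts, that is, be the matrix `c`. It remains to see that `c` is invertible. -/
theorem exists_isAdapted_of_frame {A : Type u} [CommRing A] {j : diskSpec d r A ⟶ S}
    (hj : ψ.IsDefinedAlong j) {f : Γ(S, ψ.U.1)}
    {w : Fin (totalRank h) → Γ(E.H, S.basicOpen f)} (hw : IsCompatibleFrame (h := h) E.F w)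
    (hV : ⊤ ≤ j ⁻¹ᵁ S.basicOpen f) : ∃ F : FrameCoords E j, ψ.IsAdapted F := by
  have hVU : S.basicOpen f ≤ ψ.U.1 := S.basicOpen_le f
  have hVu : ∀ {B : CommRingCat.{u}} (u : A →+* B),
      ⊤ ≤ (diskSpecMap d r u ≫ j) ⁻¹ᵁ S.basicOpen f := fun u y _ => hV (Set.mem_univ _)
  have hV1 := hVu (B := .of A) (RingHom.id A)
  let χ := diskPt (diskSpecMap d r (RingHom.id A) ≫ j) (S.basicOpen f) hV1
  let N : Matrix (Fin (totalRank h)) (Fin (totalRank h)) (DiskRing d r A) :=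
    Matrix.of fun a i => hw.coord χ a (resMap E.H hVU (ψ.lift i))
  choose c hc using fun b => exists_apply_eq_sum (χ := χ) rfl hVU
    (fun c hc => hj.map_eq_zero (B := .of A) (RingHom.id A) hVU hV1 hc) (w b)
  -- The expansion of `w b` holds for every semilinear functional, in particular for the coordinates
  -- with respect to `w` itself, whose values on `w` form the identity matrix.
  have hNc : N * (Matrix.of c).transpose = 1 := by
    ext1 a b
    rw [← hw.coord_apply_frame χ, hc b (hw.coord χ a), Matrix.mul_apply]
    exact Finset.sum_congr rfl fun i _ => mul_comm _ _
  have hcN : (Matrix.of c).transpose * N = 1 := mul_eq_one_comm.mp hNc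
  have hG : IsUnit (Matrix.of c) := (Matrix.isUnit_transpose _).mp ⟨⟨_, N, hcN, hNc⟩, rfl⟩
  have hNG : N.transpose * Matrix.of c = 1 := by
    rw [← Matrix.transpose_transpose (Matrix.of c), ← Matrix.transpose_mul, hcN,
      Matrix.transpose_one]
  refine ⟨.ofMatrix hw hV (Matrix.of c) hG, fun B u hU i b => ?_⟩
  have h1 : (FrameCoords.ofMatrix hw hV (Matrix.of c) hG).ev
      (diskSpecMap d r (RingHom.id A)) (S.basicOpen f) hV1 b (resMap E.H hVU (ψ.lift i)) =
        (1 : Matrix _ _ (DiskRing d r A)) i b := by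
    rw [FrameCoords.ev_eq_sum _ (diskSpecMap d r (RingHom.id A)) hw le_rfl hV1 hV1, ← hNG,
      Matrix.mul_apply]
    refine Finset.sum_congr rfl fun a _ => congrArg (N a i * ·) ?_
    refine (FrameCoords.ev_ofMatrix hw hV (Matrix.of c) hG (RingHom.id A) hV1 a b).trans ?_
    rw [diskMap_id]
    rfl
  refine (FrameCoords.ev_resMap _ _ hVU (hVu u) b (ψ.lift i)).symm.trans ?_
  refine (FrameCoords.ev_comp _ (RingHom.id A) u hV1 (hVu u) b _).trans ?_
  rw [h1, Matrix.one_apply, Matrix.one_apply]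
  split_ifs
  · exact map_one _
  · exact map_zero _

theorem IsDefinedAlong.comp {A B : Type u} [CommRing A] [CommRing B] {j : diskSpec d r A ⟶ S}
    (hj : ψ.IsDefinedAlong j) (v : A →+* B) : ψ.IsDefinedAlong (diskSpecMap d r v ≫ j) := by
  intro C u hU i
  have h1 : diskSpecMap d r u ≫ diskSpecMap d r v ≫ j = diskSpecMap d r (u.comp v) ≫ j := by
    rw [diskSpecMap_comp, Category.assoc]
  have hU' : ⊤ ≤ (diskSpecMap d r (u.comp v) ≫ j) ⁻¹ᵁ ψ.U.1 := h1 ▸ hU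
  rw [diskPt_congr h1 hU hU']
  exact hj C (u.comp v) hU' i

theorem IsAdapted.map {A B : Under R} {p : FramedJet E d r A} (hp : ψ.IsAdapted p.frame)
    (u : A ⟶ B) : ψ.IsAdapted (p.map u).frame := by
  intro C v hU a b
  have hU' := FramedJet.top_le_of_map u p v hU
  exact (FramedJet.ev_map u p v hU hU' b _).trans (hp C _ hU' a b)

theorem framedJet_ext_of_isAdapted {A : Under R} {p q : FramedJet E d r A} (hpq : p.jet = q.jet)
    (hp : ψ.IsAdapted p.frame) (hq : ψ.IsAdapted q.frame) (hj : ψ.IsDefinedAlong p.jet.1)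
    {f : Γ(S, ψ.U.1)} {w : Fin (totalRank h) → Γ(E.H, S.basicOpen f)}
    (hw : IsCompatibleFrame (h := h) E.F w)
    (hV : ⊤ ≤ (diskSpecMap d r (RingHom.id A.right) ≫ p.jet.1) ⁻¹ᵁ S.basicOpen f) : p = q := by
  obtain ⟨x, F, hF⟩ := p
  obtain ⟨F', hF', rfl⟩ := FramedJet.exists_eq_mk hpq.symm
  exact FramedJet.mk_congr x (ext_of_isAdapted hp hq hj hw hV) _ _

theorem exists_cover {A : Type u} [CommRing A] (j : diskSpec d r A ⟶ S) (hj : ⊤ ≤ j ⁻¹ᵁ ψ.U.1) :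
    ∃ s : Set A, Ideal.span s = ⊤ ∧ ∀ g ∈ s, ∃ (f : Γ(S, ψ.U.1))
      (w : Fin (totalRank h) → Γ(E.H, S.basicOpen f)), IsCompatibleFrame (h := h) E.F w ∧
      ⊤ ≤ (diskSpecMap d r (algebraMap A (Localization.Away g)) ≫ j) ⁻¹ᵁ S.basicOpen f := by
  choose f w hx hw using fun y : diskSpec d r A => E.exists_basicOpen_frame ψ.U.2
    (x := j y) (hj (Set.mem_univ y))
  refine ⟨_, span_eq_top_of_iSup_opens (fun y => j ⁻¹ᵁ S.basicOpen (f y)) fun y => ⟨y, hx y⟩, ?_⟩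
  rintro g ⟨y, hy⟩
  exact ⟨f y, w y, hw y, hy⟩

end Elimp

end AdaptedFrames

theorem diskEval_diskMap {d r : ℕ} {A B : Type u} [CommRing A] [CommRing B] (u : A →+* B)
    (x : DiskRing d r A) : diskEval d r B (diskMap d r u x) = u (diskEval d r A x) := by
  have h1 : (diskEval d r B).comp (diskMap d r u) = u.comp (diskEval d r A) := by
    refine disk_hom_ext ?_ fun i => ?_
    · ext a
      have h2 := RingHom.congr_fun (diskMap_const d r u) a
      rw [RingHom.comp_apply] at h2
      rw [RingHom.comp_apply, RingHom.comp_apply, h2, RingHom.comp_apply, diskEval_diskConst,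
        RingHom.comp_apply, RingHom.comp_apply, diskEval_diskConst]
    · rw [RingHom.comp_apply, diskMap_var, RingHom.comp_apply]
      exact (diskLift_var _ _ _ _).trans
        ((congrArg u (diskLift_var _ _ _ _)).trans (map_zero u)).symm
  exact RingHom.congr_fun h1 x

/-! ### Gluing of adapted frames and agreement with elimps -/

section AdaptedJets

variable {R : CommRingCat.{u}} {S : Scheme.{u}} {π : S ⟶ Spec R} {h : ℤ →₀ ℕ}
  {E : FlatFilteredBundle π h} {d r : ℕ}

namespace Elimp

variable {ψ : Elimp E r}

/-- Adapted frames exist on a cover and are unique, so they agree on overlaps without any correction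
by a matrix, and the sheaf property glues them. -/
theorem exists_framedJet_isAdapted {A : Under R} (x : (jetSpace π d r).obj A)
    (hxU : ⊤ ≤ x.1 ⁻¹ᵁ ψ.U.1) (hx : ψ.IsDefinedAlong x.1) :
    ∃ p : FramedJet E d r A, p.jet = x ∧ ψ.IsAdapted p.frame := by
  obtain ⟨s, hs, hcov⟩ := exists_cover x.1 hxU
  choose f w hw hV using hcov
  have hp : ∀ g : s, ∃ p : FramedJet E d r (away A g.1),
      p.jet = (jetSpace π d r).map (toAway A g.1) x ∧ ψ.IsAdapted p.frame := by
    intro g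
    obtain ⟨F, hF⟩ := exists_isAdapted_of_frame (ψ := ψ)
      (j := ((jetSpace π d r).map (toAway A g.1) x).1) (hx.comp _) (hw g.1 g.2) (hV g.1 g.2)
    exact ⟨⟨(jetSpace π d r).map (toAway A g.1) x, F,
      hF.isFlat (hx.comp _) (hw g.1 g.2) (hV g.1 g.2)⟩, rfl, hF⟩
  choose p hpx hp using hp
  have hpm : ∀ (g : s) {B : Under R} (a : away A g.1 ⟶ B),
      ((p g).map a).jet = (jetSpace π d r).map (toAway A g.1 ≫ a) x := by
    intro g B a
    refine (congrArg ((jetSpace π d r).map a) (hpx g)).trans ?_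
    exact (ConcreteCategory.congr_hom ((jetSpace π d r).map_comp (toAway A g.1) a) x).symm
  obtain ⟨q, hq, -⟩ := FramedJet.isSheaf E d r A s hs p fun g g' B a b hab => by
    refine framedJet_ext_of_isAdapted (p := (p g).map a) (q := (p g').map b) ?_
      ((hp g).map a) ((hp g').map b) ?_ (hw g.1 g.2) ?_
    · exact (hpm g a).trans ((congrArg (fun t => (jetSpace π d r).map t x) hab).trans (hpm g' b).symm)
    · rw [hpm g a]
      exact hx.comp _
    · rw [hpm g a]
      have h1 : diskSpecMap d r (RingHom.id B.right) ≫
          ((jetSpace π d r).map (toAway A g.1 ≫ a) x).1 = diskSpecMap d r a.right.hom ≫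
            diskSpecMap d r (algebraMap A.right (Localization.Away g.1)) ≫ x.1 := by
        rw [diskSpecMap_id, Category.id_comp, ← Category.assoc]
        exact congrArg (· ≫ x.1) (diskSpecMap_comp d r _ a.right.hom)
      rw [h1]
      exact fun y _ => hV g.1 g.2 (Set.mem_univ _)
  have hq' : ∀ g : s, FramedJet.map (toAway A g.1) q = p g := hq
  refine ⟨q, Subtype.ext (disk_hom_ext_of_away hs fun g hg => ?_), fun B u hU a b => ?_⟩
  · exact congrArg Subtype.val ((congrArg FramedJet.jet (hq' ⟨g, hg⟩)).trans (hpx ⟨g, hg⟩))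
  -- Adaptedness over a test ring `B` is verified over the localizations of `B` at the elements `u
  -- g`, where the frame comes from a restriction `p g`, known to be adapted.
  · refine diskRing_ext_of_away (span_image_eq_top u hs) ?_
    rintro _ ⟨g, hg, rfl⟩
    have hu : IsUnit (((algebraMap B (Localization.Away (u g))).comp u) g) :=
      IsLocalization.Away.algebraMap_isUnit (u g)
    obtain ⟨t, ht⟩ := exists_comp_algebraMap_eq hu
    have hU1 := FrameCoords.top_le_preimage_diskSpecMap_comp u
      (algebraMap B (Localization.Away (u g))) hU
    refine (q.frame.ev_comp u _ hU hU1 b _).symm.trans ?_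
    have h1 : ∀ (v : A.right →+* Localization.Away (u g))
        (hv : ⊤ ≤ (diskSpecMap d r v ≫ q.jet.1) ⁻¹ᵁ ψ.U.1)
        (_ : v = t.comp (algebraMap A.right (Localization.Away g))),
        q.frame.ev (diskSpecMap d r v) ψ.U.1 hv b (ψ.lift a) =
          (1 : Matrix _ _ (DiskRing d r (Localization.Away (u g)))) a b := by
      rintro _ hv rfl
      have hv' : ⊤ ≤ (diskSpecMap d r t ≫ (FramedJet.map (toAway A g) q).jet.1) ⁻¹ᵁ ψ.U.1 := by
        have h2 : diskSpecMap d r t ≫ (FramedJet.map (toAway A g) q).jet.1 =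
            diskSpecMap d r (t.comp (algebraMap A.right (Localization.Away g))) ≫ q.jet.1 := by
          rw [diskSpecMap_comp, Category.assoc]
          rfl
        rw [h2]
        exact hv
      refine (FramedJet.ev_map (toAway A g) q t hv' hv b _).symm.trans ?_
      have h3 : ψ.IsAdapted (FramedJet.map (toAway A g) q).frame := by
        rw [hq' ⟨g, hg⟩]
        exact hp ⟨g, hg⟩
      exact h3 (.of (Localization.Away (u g))) t hv' a b
    refine (h1 _ hU1 ht.symm).trans ?_
    rw [Matrix.one_apply, Matrix.one_apply]
    split_ifs
    · exact (map_one _).symm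
    · exact (map_zero _).symm

section

variable {A B : Type u} [CommRing A] [CommRing B] {j : diskSpec d r A ⟶ S}

/-- A section of the filtration over the basic open is, up to a power of `f`, the restriction of one
over `U`, and `f` becomes a unit on the disk, so the spans of coordinates do not change. This brings
the flag back to `U`, where the elimp lives. -/
theorem span_ev_filtration_eq (F : FrameCoords E j) (u : A →+* B) {f : Γ(S, ψ.U.1)}
    (hU : ⊤ ≤ (diskSpecMap d r u ≫ j) ⁻¹ᵁ ψ.U.1)
    (hV : ⊤ ≤ (diskSpecMap d r u ≫ j) ⁻¹ᵁ S.basicOpen f) (k : ℤ) :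
    Submodule.span (DiskRing d r B) ((fun (s : Γ(E.H, S.basicOpen f)) a =>
        F.ev (diskSpecMap d r u) (S.basicOpen f) hV a s) '' (E.F k (S.basicOpen f) : Set _)) =
      Submodule.span (DiskRing d r B) ((fun (s : Γ(E.H, ψ.U.1)) a =>
        F.ev (diskSpecMap d r u) ψ.U.1 hU a s) '' (E.F k ψ.U.1 : Set _)) := by
  have hVU : S.basicOpen f ≤ ψ.U.1 := S.basicOpen_le f
  apply le_antisymm
  · refine Submodule.span_le.mpr ?_
    rintro _ ⟨t, ht, rfl⟩
    obtain ⟨n, t', ht', hn⟩ := E.exists_pow_smul_eq_resMap ψ.U.2 f rfl hVU ht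
    have hf := ((RingedSpace.isUnit_res_basicOpen S.toRingedSpace f).pow n).map
      (diskPt (diskSpecMap d r u ≫ j) (S.basicOpen f) hV)
    refine (Submodule.smul_mem_iff_of_isUnit _ hf).mp (Submodule.subset_span ⟨t', ht', ?_⟩)
    ext a
    refine (F.ev_resMap _ hVU hV a t').symm.trans ?_
    rw [hn]
    exact (F.ev (diskSpecMap d r u) (S.basicOpen f) hV a).map_smulₛₗ _ t
  · refine Submodule.span_mono ?_
    rintro _ ⟨s, hs, rfl⟩
    refine ⟨resMap E.H hVU s, E.res_mem k hVU s hs, ?_⟩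
    ext a
    exact F.ev_resMap _ hVU hV a s

/-- The flag of an adapted frame is given by the matrix of the elimp. -/
theorem IsAdapted.isPeriodFlag {F : FrameCoords E j} (hF : ψ.IsAdapted F)
    (hjU : ⊤ ≤ j ⁻¹ᵁ ψ.U.1) {χ : Γ(S, ψ.U.1) →+* DiskRing d r A}
    (hχ : ∀ c ∈ Ideal.span (Set.range ψ.z) ^ (r + 1), χ c = 0)
    (hχj : ∀ (B : CommRingCat.{u}) (u : A →+* B) (hU : ⊤ ≤ (diskSpecMap d r u ≫ j) ⁻¹ᵁ ψ.U.1)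
      (c : Γ(S, ψ.U.1)), diskPt (diskSpecMap d r u ≫ j) ψ.U.1 hU c = diskMap d r u (χ c)) :
    F.IsPeriodFlag (flagOfMatrix h
      (Matrix.GeneralLinearGroup.map (Ideal.Quotient.lift _ χ hχ) ψ.M)) := by
  obtain ⟨s, hs, hcov⟩ := exists_cover j hjU
  refine FrameCoords.isPeriodFlag_of_away hs fun g hg => ?_
  obtain ⟨f, w, hw, hV⟩ := hcov g hg
  refine ⟨_, w, hw, hV, ?_⟩
  set u := algebraMap A (Localization.Away g)
  have hU : ⊤ ≤ (diskSpecMap d r u ≫ j) ⁻¹ᵁ ψ.U.1 := fun y _ => hjU (Set.mem_univ _)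
  have hχu : ∀ c ∈ Ideal.span (Set.range ψ.z) ^ (r + 1),
      diskPt (diskSpecMap d r u ≫ j) ψ.U.1 hU c = 0 := fun c hc =>
    (hχj (.of (Localization.Away g)) u hU c).trans ((congrArg _ (hχ c hc)).trans (map_zero _))
  let χ' := Ideal.Quotient.lift _ (diskPt (diskSpecMap d r u ≫ j) ψ.U.1 hU) hχu
  have hχ' : ∀ c, diskMap d r u (Ideal.Quotient.lift _ χ hχ c) = χ' c := by
    intro c
    obtain ⟨c, rfl⟩ := Ideal.Quotient.mk_surjective c
    exact (hχj (.of (Localization.Away g)) u hU c).symm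
  -- In an adapted frame the coordinates of a section are those of its class modulo `I^(r+1)` in the
  -- flat frame `b`, pulled back along the jet.
  have hev : ∀ (s : Γ(E.H, ψ.U.1)) (a : Fin (totalRank h)),
      F.ev (diskSpecMap d r u) ψ.U.1 hU a s = χ' (ψ.b.repr (Submodule.Quotient.mk s) a) := by
    intro s a
    rw [apply_eq_sum hχu (F.ev (diskSpecMap d r u) ψ.U.1 hU a) s, Finset.sum_eq_single a]
    · refine (congrArg _ (hF (.of (Localization.Away g)) u hU a a)).trans ?_
      rw [Matrix.one_apply_eq, mul_one]
    · intro b _ hb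
      refine (congrArg _ (hF (.of (Localization.Away g)) u hU b a)).trans ?_
      rw [Matrix.one_apply_ne hb, mul_zero]
    · simp
  rw [flagOfMatrix_baseChange]
  refine Flag.ext (funext fun k => ?_)
  rw [F.localFlag_F _ hw hV le_rfl hV, span_ev_filtration_eq F u hU hV]
  have hcol : ∀ i, (fun a => χ' (ψ.b.repr (ψ.v i) a)) =
      (Matrix.GeneralLinearGroup.map (diskMap d r u) (Matrix.GeneralLinearGroup.map
        (Ideal.Quotient.lift _ χ hχ) ψ.M)).1.col i := by
    intro i
    ext a
    exact (hχ' _).symm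
  -- The columns of `M` are the coordinates of the `v i` in the basis `b`, so the coordinates of
  -- anything spanned by the first `v i` lie in the span of the first columns.
  have hspan : ∀ x ∈ Submodule.span Γ(S, ψ.U.1) (ψ.v '' {i | (i : ℕ) < tailRank h k}),
      (fun a => χ' (ψ.b.repr x a)) ∈ (flagOfMatrix h (Matrix.GeneralLinearGroup.map (diskMap d r u)
        (Matrix.GeneralLinearGroup.map (Ideal.Quotient.lift _ χ hχ) ψ.M))).F k := by
    intro x hx
    induction hx using Submodule.span_induction with
    | mem x hx =>
      obtain ⟨i, hi, rfl⟩ := hx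
      rw [hcol]
      exact Submodule.subset_span ⟨i, hi, rfl⟩
    | zero =>
      convert Submodule.zero_mem _ using 1
      ext a
      rw [map_zero, Finsupp.zero_apply, map_zero]
      rfl
    | add x y _ _ hx hy =>
      convert Submodule.add_mem _ hx hy using 1
      ext a
      rw [map_add, Finsupp.add_apply, map_add]
      rfl
    | smul c x _ hx =>
      convert Submodule.smul_mem _ (χ' (Ideal.Quotient.mk _ c)) hx using 1
      ext a
      have h1 : ψ.b.repr (c • x) = (Ideal.Quotient.mk _ c) • ψ.b.repr x :=
        map_smul ψ.b.repr (Ideal.Quotient.mk _ c) x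
      rw [h1, Finsupp.smul_apply, smul_eq_mul, map_mul]
      rfl
  apply le_antisymm
  · refine Submodule.span_le.mpr ?_
    rintro _ ⟨i, hi, rfl⟩
    have h1 : ψ.v i ∈ (E.F k ψ.U.1).map (Submodule.mkQ _) := by
      rw [← ψ.compatible]
      exact Submodule.subset_span ⟨i, hi, rfl⟩
    obtain ⟨t, ht, hti⟩ := h1
    refine Submodule.subset_span ⟨t, ht, ?_⟩
    refine Eq.trans ?_ (hcol i)
    ext a
    refine (hev t a).trans ?_
    rw [← hti]
    rfl
  · refine Submodule.span_le.mpr ?_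
    rintro _ ⟨t, ht, rfl⟩
    have h1 := hspan (Submodule.Quotient.mk t) (by
      rw [ψ.compatible]
      exact ⟨t, ht, rfl⟩)
    have h2 : (fun a => F.ev (diskSpecMap d r u) ψ.U.1 hU a t) =
      fun a => χ' (ψ.b.repr (Submodule.Quotient.mk t) a) := funext fun a => hev t a
    change (fun a => F.ev (diskSpecMap d r u) ψ.U.1 hU a t) ∈ _
    rw [h2]
    exact h1

end

/-- The condition that `δ` maps the base point to `0` is stable under change of base, so the elimp
is defined along the whole family; the adapted frame then exists, and its flag is the one given by
`M`. -/
theorem exists_framedJet_flag_eq (ψ : Elimp E r) (j : (jetSpace π d r).obj (Under.mk (𝟙 R)))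
    (j₀ : Γ(S, ψ.U.1) →+* DiskRing d r R)
    (hjj₀ : j.1 = Spec.map (CommRingCat.ofHom j₀) ≫ ψ.U.2.fromSpec) (hj : ψ.IsDefinedAt j₀) :
    ∃ p : FramedJet E d r (Under.mk (𝟙 R)), p.jet = j ∧ p.flag = ψ.comp j₀ hj := by
  have hjU : ⊤ ≤ j.1 ⁻¹ᵁ ψ.U.1 := by
    rw [hjj₀]
    intro y _
    have h1 : Spec.map (CommRingCat.ofHom j₀) y ∈ ψ.U.2.fromSpec ⁻¹ᵁ ψ.U.1 := by
      rw [ψ.U.2.fromSpec_preimage_self]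
      trivial
    exact h1
  have hχj : ∀ (B : CommRingCat.{u}) (u : R →+* B)
      (hU : ⊤ ≤ (diskSpecMap d r u ≫ j.1) ⁻¹ᵁ ψ.U.1) (c : Γ(S, ψ.U.1)),
      diskPt (diskSpecMap d r u ≫ j.1) ψ.U.1 hU c = diskMap d r u (j₀ c) := by
    intro B u hU c
    refine (diskPt_diskSpecMap u j.1 hjU hU c).trans (congrArg _ ?_)
    exact (diskPt_congr hjj₀ hjU (hjj₀ ▸ hjU) c).trans
      (evalAt_fromSpec ψ.U.2 (CommRingCat.ofHom j₀) _ c)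
  have hdef : ψ.IsDefinedAlong j.1 := by
    intro B u hU i
    refine (congrArg _ (hχj B u hU (ψ.z i))).trans ?_
    refine (diskEval_diskMap u _).trans ?_
    exact (congrArg u (hj i)).trans (map_zero u)
  obtain ⟨p, rfl, hp⟩ := exists_framedJet_isAdapted j hjU hdef
  exact ⟨p, rfl, p.isPeriodFlag_flag.unique
    (hp.isPeriodFlag hjU (fun c hc => map_eq_zero_of_mem_pow hj hc) hχj)⟩

end Elimp

end AdaptedJets

end

end PeriodJets

theorem mainTheorem7 :
    ∃ η : ∀ (h : ℤ →₀ ℕ) (d r : ℕ) (R : CommRingCat.{u}) (_ : IsDomain R)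
        (_ : IsUnit ((r.factorial : ℕ) : R)) (S : Scheme.{u}) (π : S ⟶ Spec R)
        (_ : IsQuasiProjective π) (_ : FlatFilteredBundle π h),
        ToFlagQuotient (jetSpace π d r) h d r,
      -- (i) compatibility with base change
      (∀ (h : ℤ →₀ ℕ) (d r : ℕ) (R R' : CommRingCat.{u}) (hR : IsDomain R) (hR' : IsDomain R')
        (hr : IsUnit ((r.factorial : ℕ) : R)) (hr' : IsUnit ((r.factorial : ℕ) : R'))
        (f : R ⟶ R') (S S' : Scheme.{u}) (π : S ⟶ Spec R) (π' : S' ⟶ Spec R')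
        (hπ : IsQuasiProjective π) (hπ' : IsQuasiProjective π') (g : S' ⟶ S)
        (sq : IsPullback g π' π (Spec.map f))
        (E : FlatFilteredBundle π h) (E' : FlatFilteredBundle π' h)
        (φ : E.H ⟶ (Scheme.Modules.pushforward g).obj E'.H),
        IsPullbackTriple f g sq.w E E' φ →
        CommutesOver f (η h d r R' hR' hr' S' π' hπ' E') (η h d r R hR hr S π hπ E)
          (jetMapOver f g sq.w d r)) ∧
      -- (ii) compatibility with pullback along morphisms of `R`-schemes
      (∀ (h : ℤ →₀ ℕ) (d r : ℕ) (R : CommRingCat.{u}) (hR : IsDomain R)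
        (hr : IsUnit ((r.factorial : ℕ) : R)) (S S' : Scheme.{u}) (π : S ⟶ Spec R)
        (π' : S' ⟶ Spec R) (hπ : IsQuasiProjective π) (hπ' : IsQuasiProjective π')
        (g : S' ⟶ S) (w : g ≫ π = π')
        (E : FlatFilteredBundle π h) (E' : FlatFilteredBundle π' h)
        (φ : E.H ⟶ (Scheme.Modules.pushforward g).obj E'.H),
        IsPullbackTriple (𝟙 R) g (by simpa using w) E E' φ →
        Commutes (η h d r R hR hr S' π' hπ' E') (η h d r R hR hr S π hπ E)
          (jetMap g w d r) (𝟙 (jetFlag R h d r))) ∧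
      -- (iii) compatibility with precomposition by morphisms of infinitesimal disks
      (∀ (h : ℤ →₀ ℕ) (d r d' r' : ℕ) (R : CommRingCat.{u}) (hR : IsDomain R)
        (hr : IsUnit ((r.factorial : ℕ) : R)) (hr' : IsUnit ((r'.factorial : ℕ) : R))
        (S : Scheme.{u}) (π : S ⟶ Spec R) (hπ : IsQuasiProjective π)
        (E : FlatFilteredBundle π h) (v : DiskRing d' r' R →ₐ[R] DiskRing d r R),
        r' ≤ r →
        Commutes (η h d' r' R hR hr' S π hπ E) (η h d r R hR hr S π hπ E)
          (jetPrecomp π v) (jetFlagPrecomp h v)) ∧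
      -- (iv) agreement with composition by étale local infinitesimal period maps
      (∀ (h : ℤ →₀ ℕ) (d r : ℕ) (R : CommRingCat.{u}) (hR : IsDomain R)
        (hr : IsUnit ((r.factorial : ℕ) : R)) (S : Scheme.{u}) (π : S ⟶ Spec R)
        (hπ : IsQuasiProjective π) (E : FlatFilteredBundle π h) (ψ : Elimp E r)
        (j : (jetSpace π d r).obj (Under.mk (𝟙 R)))
        (j₀ : Γ(S, ψ.U.1) →+* DiskRing d r R)
        (_ : j.1 = Spec.map (CommRingCat.ofHom j₀) ≫ ψ.U.2.fromSpec) (hj : ψ.IsDefinedAt j₀),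
        ∃ p : (η h d r R hR hr S π hπ E).P.obj (Under.mk (𝟙 R)),
          (η h d r R hR hr S π hπ E).γ.app _ p = j ∧
          (η h d r R hR hr S π hπ E).α.app _ p = ψ.comp j₀ hj) := by
  refine ⟨fun h d r R _ hr S π _ E => periodMap E d r hr, ?_, ?_, ?_, ?_⟩
  · intro h d r R R' _ _ hr hr' f S S' π π' _ _ g sq E E' φ hE
    exact commutesOver_periodMap hE hr hr'
  · intro h d r R _ hr S S' π π' _ _ g w E E' φ hE
    exact commutes_periodMap_jetMap w hE hr
  · intro h d r d' r' R _ hr hr' S π _ E v _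
    exact commutes_periodMap_precomp E hr hr' v
  · intro h d r R _ hr S π _ E ψ j j₀ hjj₀ hj
    exact ψ.exists_framedJet_flag_eq j j₀ hjj₀ hj
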